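/- Let $\mathbb K\in\{\mathbb R,\mathbb C\}$, let $M$ be a compact (Hausdorff) smooth manifold without boundary, let $L\subset M$ be a regular (embedded) submanifold of some codimension $k$ which is a closed subset of $M$, and let $s\in\mathbb R$. Let $C^{-\infty}(M)$ be the space of $\mathbb K$-valued distributions on $M$, i.e. the dual of the space of smooth $\mathbb K$-valued densities on $M$ with its $C^\infty$ topology. Let $H^s(M)\subset C^{-\infty}(M)$ be the Sobolev space of order $s$: the distributions $u$ such that, for a finite family of smooth charts $e_i$ of $M$ and a smooth partition of unity $(\rho_i)$ with $\operatorname{supp}\rho_i$ contained in the domain of $e_i$, all the distributions $(e_i)_*(\rho_i u)$ belong to $H^s(\mathbb R^n)$, with the Hilbertable topology given by the norm $(\sum_i\|(e_i)_*(\rho_i u)\|_{H^s(\mathbb R^n)}^2)^{1/2}$. Let $\operatorname{Diff}(M,L)$ be the algebra of differential operators generated by the smooth functions on $M$ and the smooth vector fields on $M$ that are tangent to $L$ at the points of $L$; it acts on $C^{-\infty}(M)$ by transposition. Put $$I^{(s)}(M,L)=\{u\in C^{-\infty}(M)\mid Pu\in H^s(M)\text{ for all }P\in\operatorname{Diff}(M,L)\},$$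 with the projective (initial) topology given by the maps $P:I^{(s)}(M,L)\to H^s(M)$, $P\in\operatorname{Diff}(M,L)$. Then $I^{(s)}(M,L)$ is a Fréchet space, and it is totally reflexive: for every closed linear subspace $N\subset I^{(s)}(M,L)$, the quotient $I^{(s)}(M,L)/N$ is reflexive, i.e. the canonical map into its bidual is an isomorphism of topological vector spaces, where the dual and the bidual carry the strong topologies. (This holds for every choice of the charts $e_i$ and of the partition of unity.) -/

import Mathlib

open Set Filter Topology MeasureTheory
open scoped Manifold ContDiff SchwartzMap

namespace ConormalDistributions

theorem contDiff_det {n : ℕ} {N : WithTop ℕ∞} :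
    ContDiff ℝ N (fun A : EuclideanSpace ℝ (Fin n) →L[ℝ] EuclideanSpace ℝ (Fin n) ↦ A.det) := by
  have h : (fun A : EuclideanSpace ℝ (Fin n) →L[ℝ] EuclideanSpace ℝ (Fin n) ↦ A.det) =
      fun A ↦ ∑ σ : Equiv.Perm (Fin n), (Equiv.Perm.sign σ : ℤ) •
        ∏ i, (A (EuclideanSpace.single i 1)) (σ i) := by
    funext A
    rw [ContinuousLinearMap.det,
      ← LinearMap.det_toMatrix (EuclideanSpace.basisFun (Fin n) ℝ).toBasis, Matrix.det_apply]
    simp [LinearMap.toMatrix_apply, Units.smul_def]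
  rw [h]
  refine ContDiff.sum fun σ _ ↦ ContDiff.const_smul _ (contDiff_prod fun i _ ↦ ?_)
  have : ContDiff ℝ N (fun A : EuclideanSpace ℝ (Fin n) →L[ℝ] EuclideanSpace ℝ (Fin n) ↦
      A (EuclideanSpace.single i 1)) := contDiff_id.clm_apply contDiff_const
  exact contDiff_euclidean.1 this _

theorem fderiv_det_apply {n : ℕ}
    (A B C : EuclideanSpace ℝ (Fin n) →L[ℝ] EuclideanSpace ℝ (Fin n)) (hAC : A.comp C = .id ℝ _) :
    fderiv ℝ (fun A : EuclideanSpace ℝ (Fin n) →L[ℝ] EuclideanSpace ℝ (Fin n) ↦ A.det) A B =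
      A.det * LinearMap.trace ℝ _ (C.comp B : EuclideanSpace ℝ (Fin n) →L[ℝ] _).toLinearMap := by
  have hd := (contDiff_det (n := n) (N := 1)).differentiable one_ne_zero A
  have hl : HasDerivAt (fun r : ℝ ↦ A + r • B) B 0 := by
    simpa using ((hasDerivAt_id (0 : ℝ)).smul_const B).const_add A
  have h1 : HasDerivAt (fun r : ℝ ↦ (A + r • B).det)
      (fderiv ℝ (fun A : EuclideanSpace ℝ (Fin n) →L[ℝ] EuclideanSpace ℝ (Fin n) ↦ A.det) A B) 0 := by
    have := hd.hasFDerivAt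
    exact HasFDerivAt.comp_hasDerivAt_of_eq (x := (0 : ℝ)) this hl (by ext; simp)
  have h2 : HasDerivAt (fun r : ℝ ↦ (A + r • B).det)
      (A.det * LinearMap.trace ℝ _
        (C.comp B : EuclideanSpace ℝ (Fin n) →L[ℝ] _).toLinearMap) 0 := by
    set b := (EuclideanSpace.basisFun (Fin n) ℝ).toBasis
    set M := LinearMap.toMatrix b b (C.comp B : EuclideanSpace ℝ (Fin n) →L[ℝ] _).toLinearMap
    have e : (fun r : ℝ ↦ (A + r • B).det) = fun r ↦ A.det * (1 + M.trace * r +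
        ((1 + (Polynomial.X : Polynomial ℝ) • M.map Polynomial.C).det.divX.divX.eval r) * r ^ 2) := by
      funext r
      rw [← Matrix.det_one_add_smul]
      have : (A + r • B) = A.comp (.id ℝ _ + r • C.comp B) := by
        ext1 v
        have := congrArg (fun L ↦ L (B v)) hAC
        simp only [ContinuousLinearMap.comp_apply, ContinuousLinearMap.id_apply] at this
        simp [this]
      rw [this, ContinuousLinearMap.det, ContinuousLinearMap.det]
      have h3 : (1 + r • M) = LinearMap.toMatrix b b
          (.id ℝ _ + r • C.comp B : EuclideanSpace ℝ (Fin n) →L[ℝ] _).toLinearMap := by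
        simp [M]
      rw [h3, LinearMap.det_toMatrix, ← LinearMap.det_comp]
      rfl
    rw [e, LinearMap.trace_eq_matrix_trace ℝ b]
    set p := (1 + (Polynomial.X : Polynomial ℝ) • M.map Polynomial.C).det.divX.divX
    have : HasDerivAt (fun r : ℝ ↦ 1 + M.trace * r + p.eval r * r ^ 2) M.trace 0 := by
      have := (((hasDerivAt_id (0 : ℝ)).const_mul M.trace).const_add 1).add
        ((p.hasDerivAt 0).mul ((hasDerivAt_id (0 : ℝ)).pow 2))
      simpa using! this
    exact this.const_mul _
  exact h1.unique h2

/-- The divergence `∑ᵢ ∂ᵢ(Xⁱ h)`. -/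
theorem divergence_eq {n : ℕ} {F : Type*} [NormedAddCommGroup F] [NormedSpace ℝ F]
    {X : EuclideanSpace ℝ (Fin n) → EuclideanSpace ℝ (Fin n)} {h : EuclideanSpace ℝ (Fin n) → F}
    {x : EuclideanSpace ℝ (Fin n)} (hX : DifferentiableAt ℝ X x) (hh : DifferentiableAt ℝ h x) :
    ∑ i, fderiv ℝ (fun y ↦ X y i • h y) x (EuclideanSpace.single i 1) =
      LinearMap.trace ℝ _ (fderiv ℝ X x).toLinearMap • h x + fderiv ℝ h x (X x) := by
  have hXi : ∀ i, HasFDerivAt (fun y ↦ X y i) ((EuclideanSpace.proj i).comp (fderiv ℝ X x)) x :=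
    fun i ↦ (EuclideanSpace.proj (𝕜 := ℝ) i).hasFDerivAt.comp x hX.hasFDerivAt
  have h1 : ∀ i, fderiv ℝ (fun y ↦ X y i • h y) x (EuclideanSpace.single i 1) =
      X x i • fderiv ℝ h x (EuclideanSpace.single i 1) +
        (fderiv ℝ X x (EuclideanSpace.single i 1)) i • h x := by
    intro i
    rw [((hXi i).fun_smul hh.hasFDerivAt).fderiv]
    simp
  simp_rw [h1, Finset.sum_add_distrib, ← Finset.sum_smul]
  rw [add_comm]
  congr 1
  · rw [LinearMap.trace_eq_matrix_trace ℝ (EuclideanSpace.basisFun (Fin n) ℝ).toBasis]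
    simp [Matrix.trace, LinearMap.toMatrix_apply]
  · conv_rhs => rw [← (EuclideanSpace.basisFun (Fin n) ℝ).sum_repr (X x)]
    simp

/-- Change of variables in the divergence of a vector field along a density. -/
theorem divergence_transform {n : ℕ} {F : Type*} [NormedAddCommGroup F] [NormedSpace ℝ F]
    {g k X X' : EuclideanSpace ℝ (Fin n) → EuclideanSpace ℝ (Fin n)}
    {h h' : EuclideanSpace ℝ (Fin n) → F} {x : EuclideanSpace ℝ (Fin n)}
    (hg : ContDiffAt ℝ ∞ g x) (hk : DifferentiableAt ℝ k (g x))
    (hkg : ∀ᶠ y in 𝓝 x, k (g y) = y) (hgk : ∀ᶠ z in 𝓝 (g x), g (k z) = z)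
    (hX : DifferentiableAt ℝ X x) (hX' : DifferentiableAt ℝ X' (g x))
    (hh' : DifferentiableAt ℝ h' (g x))
    (hXX' : ∀ᶠ y in 𝓝 x, X' (g y) = fderiv ℝ g y (X y))
    (hhh' : ∀ᶠ y in 𝓝 x, h y = |(fderiv ℝ g y).det| • h' (g y)) :
    ∑ i, fderiv ℝ (fun y ↦ X y i • h y) x (EuclideanSpace.single i 1) =
      |(fderiv ℝ g x).det| •
        ∑ i, fderiv ℝ (fun y ↦ X' y i • h' y) (g x) (EuclideanSpace.single i 1) := by
  have hgd : DifferentiableAt ℝ g x := hg.differentiableAt (by simp)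
  have hDg : DifferentiableAt ℝ (fderiv ℝ g) x :=
    (hg.fderiv_right (m := 1) (by norm_cast)).differentiableAt one_ne_zero
  have hCA : (fderiv ℝ k (g x)).comp (fderiv ℝ g x) = .id ℝ _ := by
    have h1 : HasFDerivAt (fun y ↦ k (g y)) ((fderiv ℝ k (g x)).comp (fderiv ℝ g x)) x :=
      hk.hasFDerivAt.comp x hgd.hasFDerivAt
    exact (h1.congr_of_eventuallyEq (hkg.mono fun y hy ↦ hy.symm)).unique (hasFDerivAt_id x)
  have hkgx : k (g x) = x := hkg.self_of_nhds
  have hAC : (fderiv ℝ g x).comp (fderiv ℝ k (g x)) = .id ℝ _ := by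
    have h1 : HasFDerivAt (fun y ↦ g (k y)) ((fderiv ℝ g x).comp (fderiv ℝ k (g x))) (g x) := by
      refine HasFDerivAt.comp (g x) ?_ hk.hasFDerivAt
      rw [hkgx]; exact hgd.hasFDerivAt
    exact (h1.congr_of_eventuallyEq (hgk.mono fun y hy ↦ hy.symm)).unique (hasFDerivAt_id _)
  set A := fderiv ℝ g x with hA
  set C := fderiv ℝ k (g x) with hC
  have hdet : A.det * C.det = 1 := by
    have := congrArg (fun L : EuclideanSpace ℝ (Fin n) →L[ℝ] _ ↦ L.det) hAC
    simpa [ContinuousLinearMap.det, LinearMap.det_comp] using! this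
  have hdet0 : A.det ≠ 0 := left_ne_zero_of_mul_eq_one hdet
  -- derivative of the Jacobian
  set J : EuclideanSpace ℝ (Fin n) → ℝ := fun y ↦ |(fderiv ℝ g y).det| with hJ
  set B := fderiv ℝ (fderiv ℝ g) x (X x) with hB
  have hdetD : HasFDerivAt (fun y ↦ (fderiv ℝ g y).det)
      ((fderiv ℝ (fun A : EuclideanSpace ℝ (Fin n) →L[ℝ] EuclideanSpace ℝ (Fin n) ↦ A.det) A).comp
        (fderiv ℝ (fderiv ℝ g) x)) x :=
    ((contDiff_det (n := n) (N := 1)).differentiable one_ne_zero A).hasFDerivAt.comp x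
      hDg.hasFDerivAt
  have hJd : DifferentiableAt ℝ J x := hdetD.differentiableAt.abs hdet0
  have hJX : fderiv ℝ J x (X x) = |A.det| * LinearMap.trace ℝ _ (C.comp B).toLinearMap := by
    have h1 := hdetD.abs hdet0
    rw [h1.fderiv]
    simp only [FunLike.coe_smul, Pi.smul_apply, ContinuousLinearMap.comp_apply]
    rw [fderiv_det_apply A _ C hAC, ← hB]
    rw [smul_eq_mul, ← mul_assoc]
    congr 1
    rw [sign_mul_self]
  -- the transformed vector field
  have hX'D : (fderiv ℝ X' (g x)).comp A = B + A.comp (fderiv ℝ X x) := by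
    have h1 : HasFDerivAt (fun y ↦ X' (g y)) ((fderiv ℝ X' (g x)).comp A) x :=
      hX'.hasFDerivAt.comp x hgd.hasFDerivAt
    have h2 := (hDg.hasFDerivAt.clm_apply hX.hasFDerivAt).congr_of_eventuallyEq hXX'
    rw [h1.unique h2]
    have hs := hg.isSymmSndFDerivAt (by simp; exact WithTop.coe_le_coe.2 (le_top : (2 : ℕ∞) ≤ ⊤))
    ext1 v
    have := hs.eq v (X x)
    simp [hB, hA, this, add_comm]
  have htr : LinearMap.trace ℝ _ (fderiv ℝ X' (g x)).toLinearMap =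
      LinearMap.trace ℝ _ (C.comp B).toLinearMap + LinearMap.trace ℝ _ (fderiv ℝ X x).toLinearMap := by
    have h1 : fderiv ℝ X' (g x) = (B + A.comp (fderiv ℝ X x)).comp C := by
      rw [← hX'D, ContinuousLinearMap.comp_assoc, hAC, ContinuousLinearMap.comp_id]
    have h2 : C.comp ((B + A.comp (fderiv ℝ X x))) = C.comp B + fderiv ℝ X x := by
      rw [ContinuousLinearMap.comp_add, ← ContinuousLinearMap.comp_assoc, hCA,
        ContinuousLinearMap.id_comp]
    rw [← map_add, h1]
    have h3 := congrArg (fun L : EuclideanSpace ℝ (Fin n) →L[ℝ] _ ↦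
      LinearMap.trace ℝ _ L.toLinearMap) h2
    simp only [ContinuousLinearMap.toLinearMap_comp, ContinuousLinearMap.toLinearMap_add] at h3 ⊢
    rw [← h3]
    exact LinearMap.trace_mul_comm ℝ _ _
  have hcomp : HasFDerivAt (fun y ↦ h' (g y)) ((fderiv ℝ h' (g x)).comp A) x :=
    hh'.hasFDerivAt.comp x hgd.hasFDerivAt
  have hhD : HasFDerivAt h _ x :=
    (hJd.hasFDerivAt.smul hcomp).congr_of_eventuallyEq hhh'
  rw [divergence_eq hX hhD.differentiableAt, divergence_eq hX' hh', hhD.fderiv,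
    hhh'.self_of_nhds, hXX'.self_of_nhds, htr]
  simp only [FunLike.coe_add, FunLike.coe_smul, Pi.add_apply,
    Pi.smul_apply, ContinuousLinearMap.smulRight_apply, hJX, ContinuousLinearMap.comp_apply]
  simp only [hJ, ← hA]
  module

/-- The smooth charts of `M`. -/
abbrev Chart (n : ℕ) (M : Type*) [TopologicalSpace M] [ChartedSpace (EuclideanSpace ℝ (Fin n)) M] :
    Type _ :=
  {e : OpenPartialHomeomorph M (EuclideanSpace ℝ (Fin n)) // e ∈ IsManifold.maximalAtlas (𝓡 n) ∞ M}

section Charts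

variable {n : ℕ} {M : Type*} [TopologicalSpace M] [ChartedSpace (EuclideanSpace ℝ (Fin n)) M]

theorem contDiffAt_transition (e e' : Chart n M) {x : EuclideanSpace ℝ (Fin n)}
    (hx : x ∈ e.1.target) (hx' : e.1.symm x ∈ e'.1.source) :
    ContDiffAt ℝ ∞ (fun y ↦ e'.1 (e.1.symm y)) x := by
  rw [← contMDiffAt_iff_contDiffAt]
  exact (contMDiffAt_of_mem_maximalAtlas e'.2 hx').comp x
    (contMDiffAt_symm_of_mem_maximalAtlas e.2 hx)

theorem eventually_mem_source (e e' : Chart n M) {x : EuclideanSpace ℝ (Fin n)}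
    (hx : x ∈ e.1.target) (hx' : e.1.symm x ∈ e'.1.source) :
    ∀ᶠ y in 𝓝 x, y ∈ e.1.target ∧ e.1.symm y ∈ e'.1.source :=
  (Filter.eventually_mem_set.2 (e.1.open_target.mem_nhds hx)).and
    (Filter.eventually_mem_set.2
      ((e.1.continuousAt_symm hx).preimage_mem_nhds (e'.1.open_source.mem_nhds hx')) |>.mono
        fun _ hy ↦ hy)

/-- The components `(X¹, …, Xⁿ)` of the vector field `X` in the chart `e`, as functions on the
target of `e`. -/
noncomputable def vectorCoeff [IsManifold (𝓡 n) ∞ M] (e : Chart n M)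
    (X : Cₛ^∞⟮𝓡 n; EuclideanSpace ℝ (Fin n), (TangentSpace (𝓡 n) : M → Type _)⟯)
    (x : EuclideanSpace ℝ (Fin n)) : EuclideanSpace ℝ (Fin n) :=
  mfderiv (𝓡 n) (𝓡 n) e.1 (e.1.symm x) (X (e.1.symm x))

theorem contDiffOn_vectorCoeff [IsManifold (𝓡 n) ∞ M] (e : Chart n M)
    (X : Cₛ^∞⟮𝓡 n; EuclideanSpace ℝ (Fin n), (TangentSpace (𝓡 n) : M → Type _)⟯) :
    ContDiffOn ℝ ∞ (vectorCoeff e X) e.1.target := by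
  have : IsManifold (𝓡 n) 1 M := IsManifold.of_le (n := ∞) (by norm_cast)
  have h1 := (contMDiffOn_of_mem_maximalAtlas e.2).contMDiffOn_tangentMapWithin
    (m := ∞) (by norm_cast) e.1.open_source.uniqueMDiffOn
  have h2 : ContMDiffOn (𝓡 n) (𝓡 n).tangent ∞
      (fun x ↦ (⟨e.1.symm x, X (e.1.symm x)⟩ : TangentBundle (𝓡 n) M)) e.1.target :=
    X.contMDiff.comp_contMDiffOn (contMDiffOn_symm_of_mem_maximalAtlas e.2)
  have h3 := (contMDiff_snd_tangentBundle_modelSpace (n := ∞) (EuclideanSpace ℝ (Fin n))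
    (𝓡 n)).comp_contMDiffOn (h1.comp h2 fun x hx ↦ e.1.map_target hx)
  rw [← contMDiffOn_iff_contDiffOn]
  refine h3.congr fun x hx ↦ ?_
  have h4 := mfderivWithin_of_isOpen (I := 𝓡 n) (I' := 𝓡 n) (f := e.1) e.1.open_source
    (e.1.map_target hx)
  exact (congrArg (fun L ↦ L (X (e.1.symm x))) h4).symm

theorem vectorCoeff_transition [IsManifold (𝓡 n) ∞ M] (e e' : Chart n M)
    (X : Cₛ^∞⟮𝓡 n; EuclideanSpace ℝ (Fin n), (TangentSpace (𝓡 n) : M → Type _)⟯)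
    {x : EuclideanSpace ℝ (Fin n)} (hx : x ∈ e.1.target) (hx' : e.1.symm x ∈ e'.1.source) :
    vectorCoeff e' X (e'.1 (e.1.symm x)) =
      fderiv ℝ (fun y ↦ e'.1 (e.1.symm y)) x (vectorCoeff e X x) := by
  unfold vectorCoeff
  rw [e'.1.left_inv hx']
  have h1 : MDifferentiableAt (𝓡 n) (𝓡 n) e.1 (e.1.symm x) :=
    (contMDiffAt_of_mem_maximalAtlas e.2 (e.1.map_target hx)).mdifferentiableAt (by simp)
  have h2 : MDifferentiableAt (𝓡 n) (𝓡 n) (fun y ↦ e'.1 (e.1.symm y)) (e.1 (e.1.symm x)) := by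
    rw [e.1.right_inv hx]
    exact ((contDiffAt_transition e e' hx hx').differentiableAt (by simp)).mdifferentiableAt
  have h3 := mfderiv_comp (e.1.symm x) h2 h1
  have h4 : (fun y ↦ e'.1 (e.1.symm y)) ∘ e.1 =ᶠ[𝓝 (e.1.symm x)] e'.1 := by
    filter_upwards [e.1.open_source.mem_nhds (e.1.map_target hx)] with p hp
    simp [e.1.left_inv hp]
  rw [h4.mfderiv_eq, e.1.right_inv hx, mfderiv_eq_fderiv] at h3
  rw [h3]
  rfl

end Charts

/-- A smooth `𝕜`-valued density on `M`, that is, a smooth section of the bundle of `1`-densities.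
In every smooth chart `e` it is `h |dx|` with a smooth function `h = coeff e`, and the coefficients
in two charts are related by the absolute value of the Jacobian determinant of the change of
coordinates. Outside the target of `e` the function `coeff e` has the junk value `0`. -/
structure SmoothDensity (𝕜 : Type*) [RCLike 𝕜] (n : ℕ) (M : Type*) [TopologicalSpace M]
    [ChartedSpace (EuclideanSpace ℝ (Fin n)) M] where
  coeff : Chart n M → EuclideanSpace ℝ (Fin n) → 𝕜
  contDiffOn_coeff : ∀ e, ContDiffOn ℝ ∞ (coeff e) e.1.target
  coeff_transition : ∀ e e' : Chart n M, ∀ x ∈ e.1.target, e.1.symm x ∈ e'.1.source →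
    coeff e x = |(fderiv ℝ (fun y ↦ e'.1 (e.1.symm y)) x).det| • coeff e' (e'.1 (e.1.symm x))
  coeff_eq_zero : ∀ e : Chart n M, ∀ x ∉ e.1.target, coeff e x = 0

namespace SmoothDensity

variable {𝕜 : Type*} [RCLike 𝕜] {n : ℕ} {M : Type*} [TopologicalSpace M]
  [ChartedSpace (EuclideanSpace ℝ (Fin n)) M]

@[ext] theorem ext {σ τ : SmoothDensity 𝕜 n M} (h : ∀ e x, σ.coeff e x = τ.coeff e x) : σ = τ := by
  cases σ; cases τ
  congr
  funext e x
  exact h e x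

instance : Zero (SmoothDensity 𝕜 n M) :=
  ⟨⟨fun _ _ ↦ 0, fun _ ↦ contDiffOn_const, by simp, by simp⟩⟩

instance : Add (SmoothDensity 𝕜 n M) :=
  ⟨fun σ τ ↦ ⟨fun e x ↦ σ.coeff e x + τ.coeff e x,
    fun e ↦ (σ.contDiffOn_coeff e).add (τ.contDiffOn_coeff e),
    fun e e' x hx hx' ↦ by
      rw [σ.coeff_transition e e' x hx hx', τ.coeff_transition e e' x hx hx', smul_add],
    fun e x hx ↦ by rw [σ.coeff_eq_zero e x hx, τ.coeff_eq_zero e x hx, add_zero]⟩⟩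

instance : SMul 𝕜 (SmoothDensity 𝕜 n M) :=
  ⟨fun c σ ↦ ⟨fun e x ↦ c * σ.coeff e x,
    fun e ↦ contDiffOn_const.mul (σ.contDiffOn_coeff e),
    fun e e' x hx hx' ↦ by
      rw [σ.coeff_transition e e' x hx hx', mul_smul_comm],
    fun e x hx ↦ by rw [σ.coeff_eq_zero e x hx, mul_zero]⟩⟩

instance : Neg (SmoothDensity 𝕜 n M) :=
  ⟨fun σ ↦ ⟨fun e x ↦ -σ.coeff e x, fun e ↦ (σ.contDiffOn_coeff e).neg,
    fun e e' x hx hx' ↦ by rw [σ.coeff_transition e e' x hx hx', smul_neg],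
    fun e x hx ↦ by rw [σ.coeff_eq_zero e x hx, neg_zero]⟩⟩

@[simp] theorem zero_coeff (e : Chart n M) (x) : (0 : SmoothDensity 𝕜 n M).coeff e x = 0 := rfl
@[simp] theorem add_coeff (σ τ : SmoothDensity 𝕜 n M) (e : Chart n M) (x) :
    (σ + τ).coeff e x = σ.coeff e x + τ.coeff e x := rfl
@[simp] theorem neg_coeff (σ : SmoothDensity 𝕜 n M) (e : Chart n M) (x) :
    (-σ).coeff e x = -σ.coeff e x := rfl
@[simp] theorem smul_coeff (c : 𝕜) (σ : SmoothDensity 𝕜 n M) (e : Chart n M) (x) :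
    (c • σ).coeff e x = c * σ.coeff e x := rfl

instance : AddCommGroup (SmoothDensity 𝕜 n M) where
  add_assoc _ _ _ := by ext; simp [add_assoc]
  zero_add _ := by ext; simp
  add_zero _ := by ext; simp
  neg_add_cancel _ := by ext; simp
  add_comm _ _ := by ext; simp [add_comm]
  nsmul := nsmulRec
  zsmul := zsmulRec

instance : Module 𝕜 (SmoothDensity 𝕜 n M) where
  one_smul _ := by ext; simp
  mul_smul _ _ _ := by ext; simp [mul_assoc]
  smul_zero _ := by ext; simp
  smul_add _ _ _ := by ext; simp [mul_add]
  add_smul _ _ _ := by ext; simp [add_mul]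
  zero_smul _ := by ext; simp

/-- Index set of the seminorms of the `C^∞` topology: a chart, a compact subset of its target and
an order of differentiation. -/
abbrev SeminormIndex (n : ℕ) (M : Type*) [TopologicalSpace M]
    [ChartedSpace (EuclideanSpace ℝ (Fin n)) M] : Type _ :=
  (Σ e : Chart n M, {K : Set (EuclideanSpace ℝ (Fin n)) // IsCompact K ∧ K ⊆ e.1.target}) × ℕ

theorem continuousOn_iteratedFDeriv (σ : SmoothDensity 𝕜 n M) (e : Chart n M) (k : ℕ) :
    ContinuousOn (iteratedFDeriv ℝ k (σ.coeff e)) e.1.target :=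
  ((σ.contDiffOn_coeff e).continuousOn_iteratedFDerivWithin (m := k) (mod_cast le_top)
    e.1.open_target.uniqueDiffOn).congr
    fun _ hx ↦ (iteratedFDerivWithin_of_isOpen k e.1.open_target hx).symm

theorem bddAbove_iteratedFDeriv (σ : SmoothDensity 𝕜 n M) (i : SeminormIndex n M) :
    BddAbove (range fun x : i.1.2.1 ↦ ‖iteratedFDeriv ℝ i.2 (σ.coeff i.1.1) x‖) := by
  obtain ⟨⟨e, K, hK, hKe⟩, k⟩ := i
  have := hK.bddAbove_image ((σ.continuousOn_iteratedFDeriv e k).mono hKe).norm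
  rwa [image_eq_range] at this

theorem contDiffAt_coeff (σ : SmoothDensity 𝕜 n M) (e : Chart n M) {x} (hx : x ∈ e.1.target) :
    ContDiffAt ℝ ∞ (σ.coeff e) x :=
  (σ.contDiffOn_coeff e).contDiffAt (e.1.open_target.mem_nhds hx)

/-- The seminorms `sup_{x ∈ K} ‖Dᵏ(coeff e)(x)‖` which define the `C^∞` topology on the space of
smooth densities. -/
noncomputable def seminormFamily (𝕜 : Type*) [RCLike 𝕜] (n : ℕ) (M : Type*) [TopologicalSpace M]
    [ChartedSpace (EuclideanSpace ℝ (Fin n)) M] :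
    SeminormFamily 𝕜 (SmoothDensity 𝕜 n M) (SeminormIndex n M) := fun i ↦
  Seminorm.of (fun σ ↦ ⨆ x : i.1.2.1, ‖iteratedFDeriv ℝ i.2 (σ.coeff i.1.1) x‖)
    (fun σ τ ↦ by
      refine Real.iSup_le (fun x ↦ ?_) (add_nonneg (Real.iSup_nonneg fun _ ↦ norm_nonneg _)
        (Real.iSup_nonneg fun _ ↦ norm_nonneg _))
      have hx := i.1.2.2.2 x.2
      have h1 : iteratedFDeriv ℝ i.2 ((σ + τ).coeff i.1.1) x =
          iteratedFDeriv ℝ i.2 (σ.coeff i.1.1) x + iteratedFDeriv ℝ i.2 (τ.coeff i.1.1) x :=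
        iteratedFDeriv_add_apply ((σ.contDiffAt_coeff _ hx).of_le (mod_cast le_top))
          ((τ.contDiffAt_coeff _ hx).of_le (mod_cast le_top))
      rw [h1]
      exact (norm_add_le _ _).trans (add_le_add (le_ciSup (σ.bddAbove_iteratedFDeriv i) x)
        (le_ciSup (τ.bddAbove_iteratedFDeriv i) x)))
    (fun c σ ↦ by
      rw [Real.mul_iSup_of_nonneg (norm_nonneg c)]
      congr 1
      funext x
      have hx := i.1.2.2.2 x.2
      have h1 : iteratedFDeriv ℝ i.2 ((c • σ).coeff i.1.1) x =
          c • iteratedFDeriv ℝ i.2 (σ.coeff i.1.1) x := by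
        rw [show (c • σ).coeff i.1.1 = c • σ.coeff i.1.1 from rfl]
        exact iteratedFDeriv_const_smul_apply
          ((σ.contDiffAt_coeff _ hx).of_le (mod_cast le_top))
      rw [h1, norm_smul])

theorem seminormFamily_apply (i : SeminormIndex n M) (σ : SmoothDensity 𝕜 n M) :
    seminormFamily 𝕜 n M i σ = ⨆ x : i.1.2.1, ‖iteratedFDeriv ℝ i.2 (σ.coeff i.1.1) x‖ := rfl

/-- The `C^∞` topology. -/
noncomputable instance : TopologicalSpace (SmoothDensity 𝕜 n M) :=
  (seminormFamily 𝕜 n M).moduleFilterBasis.topology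

theorem withSeminorms : WithSeminorms (seminormFamily 𝕜 n M) := ⟨rfl⟩

instance : IsTopologicalAddGroup (SmoothDensity 𝕜 n M) := withSeminorms.topologicalAddGroup
instance : ContinuousSMul 𝕜 (SmoothDensity 𝕜 n M) := withSeminorms.continuousSMul

end SmoothDensity

theorem exists_bound_smul {V A F : Type*} [NormedAddCommGroup V] [NormedSpace ℝ V]
    [NormedField A] [NormedAlgebra ℝ A] [NormedAddCommGroup F] [NormedSpace ℝ F] [NormedSpace A F]
    [IsScalarTower ℝ A F] {U K : Set V} (hU : IsOpen U) (hK : IsCompact K) (hKU : K ⊆ U)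
    {a : V → A} (ha : ContDiffOn ℝ ∞ a U) (k : ℕ) :
    ∃ C : ℝ, 0 ≤ C ∧ ∀ h : V → F, ContDiffOn ℝ ∞ h U → ∀ x ∈ K,
      ‖iteratedFDeriv ℝ k (fun y ↦ a y • h y) x‖ ≤
        C * ∑ j ∈ Finset.range (k + 1), ‖iteratedFDeriv ℝ j h x‖ := by
  have hb : ∀ i : ℕ, ∃ C, ∀ x ∈ K, ‖iteratedFDerivWithin ℝ i a U x‖ ≤ C := fun i ↦
    hK.exists_bound_of_continuousOn
      ((ha.continuousOn_iteratedFDerivWithin (mod_cast le_top) hU.uniqueDiffOn).mono hKU)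
  choose B hB using hb
  refine ⟨∑ i ∈ Finset.range (k + 1), (k.choose i : ℝ) * |B i|,
    Finset.sum_nonneg fun i _ ↦ by positivity, fun h hh x hx ↦ ?_⟩
  rw [← iteratedFDerivWithin_of_isOpen k hU (hKU hx)]
  refine (norm_iteratedFDerivWithin_smul_le ha hh hU.uniqueDiffOn (hKU hx)
    (mod_cast le_top)).trans ?_
  rw [Finset.sum_mul]
  refine Finset.sum_le_sum fun i hi ↦ ?_
  gcongr
  · exact (hB i x hx).trans (le_abs_self _)
  · rw [iteratedFDerivWithin_of_isOpen _ hU (hKU hx)]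
    exact Finset.single_le_sum (f := fun j ↦ ‖iteratedFDeriv ℝ j h x‖)
      (fun j _ ↦ norm_nonneg _) (Finset.mem_range.2 (by omega))

theorem exists_bound_comp {V W F : Type*} [NormedAddCommGroup V] [NormedSpace ℝ V]
    [NormedAddCommGroup W] [NormedSpace ℝ W] [NormedAddCommGroup F] [NormedSpace ℝ F]
    {U K : Set V} (hU : IsOpen U) (hK : IsCompact K) (hKU : K ⊆ U)
    {g : V → W} (hg : ContDiffOn ℝ ∞ g U) (k : ℕ) :
    ∃ C : ℝ, 0 ≤ C ∧ ∀ h : W → F, ContDiff ℝ ∞ h → ∀ B : ℝ,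
      (∀ i ≤ k, ∀ y, ‖iteratedFDeriv ℝ i h y‖ ≤ B) → ∀ x ∈ K,
      ‖iteratedFDeriv ℝ k (fun y ↦ h (g y)) x‖ ≤ C * B := by
  have hb : ∀ i : ℕ, ∃ C, ∀ x ∈ K, ‖iteratedFDerivWithin ℝ i g U x‖ ≤ C := fun i ↦
    hK.exists_bound_of_continuousOn
      ((hg.continuousOn_iteratedFDerivWithin (mod_cast le_top) hU.uniqueDiffOn).mono hKU)
  choose D hD using hb
  set E : ℝ := 1 + ∑ i ∈ Finset.range (k + 1), |D i| with hE
  have hE1 : 1 ≤ E := le_add_of_nonneg_right (Finset.sum_nonneg fun i _ ↦ abs_nonneg _)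
  refine ⟨k.factorial * E ^ k, by positivity, fun h hh B hB x hx ↦ ?_⟩
  rw [← iteratedFDerivWithin_of_isOpen k hU (hKU hx)]
  have := norm_iteratedFDerivWithin_comp_le (N := ∞) (n := k) (C := B) (D := E) (x := x)
    hh.contDiffOn hg (mod_cast le_top) uniqueDiffOn_univ hU.uniqueDiffOn (mapsTo_univ _ _) (hKU hx)
    (fun i hi ↦ by rw [iteratedFDerivWithin_univ]; exact hB i hi _)
    (fun i hi hik ↦ by
      refine ((hD i x hx).trans (le_abs_self _)).trans ?_
      refine le_trans ?_ (le_self_pow₀ hE1 (by omega))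
      have := Finset.single_le_sum (f := fun j ↦ |D j|) (s := Finset.range (k + 1))
        (fun j _ ↦ abs_nonneg _) (Finset.mem_range.2 (by omega : i < k + 1))
      linarith)
  calc _ ≤ k.factorial * B * E ^ k := this
    _ = _ := by ring

theorem norm_iteratedFDeriv_fderiv_apply_le {V F : Type*} [NormedAddCommGroup V] [NormedSpace ℝ V]
    [NormedAddCommGroup F] [NormedSpace ℝ F] {h : V → F} {x : V} (hh : ContDiffAt ℝ ∞ h x)
    (v : V) (k : ℕ) :
    ‖iteratedFDeriv ℝ k (fun y ↦ fderiv ℝ h y v) x‖ ≤ ‖v‖ * ‖iteratedFDeriv ℝ (k + 1) h x‖ := by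
  rw [← norm_iteratedFDeriv_fderiv]
  exact norm_iteratedFDeriv_clm_apply_const (hh.fderiv_right (m := ∞) (by norm_cast))
    (mod_cast le_top)

namespace SmoothDensity

variable {𝕜 : Type*} [RCLike 𝕜] {n : ℕ} {M : Type*} [TopologicalSpace M]
  [ChartedSpace (EuclideanSpace ℝ (Fin n)) M]

theorem norm_iteratedFDeriv_le_seminorm (σ : SmoothDensity 𝕜 n M) (i : SeminormIndex n M)
    {x : EuclideanSpace ℝ (Fin n)} (hx : x ∈ i.1.2.1) :
    ‖iteratedFDeriv ℝ i.2 (σ.coeff i.1.1) x‖ ≤ seminormFamily 𝕜 n M i σ :=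
  le_ciSup (σ.bddAbove_iteratedFDeriv i) ⟨x, hx⟩

theorem continuous_of_bound (T : SmoothDensity 𝕜 n M →ₗ[𝕜] SmoothDensity 𝕜 n M)
    (hT : ∀ (e : Chart n M) (K : Set (EuclideanSpace ℝ (Fin n))), IsCompact K → K ⊆ e.1.target →
      ∀ k : ℕ, ∃ C : ℝ, 0 ≤ C ∧ ∃ N : ℕ, ∀ σ, ∀ x ∈ K,
        ‖iteratedFDeriv ℝ k ((T σ).coeff e) x‖ ≤
          C * ∑ j ∈ Finset.range N, ‖iteratedFDeriv ℝ j (σ.coeff e) x‖) : Continuous T := by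
  classical
  refine withSeminorms.continuous_of_isBounded withSeminorms T
    (Seminorm.IsBounded.of_real ?_)
  rintro ⟨⟨e, K, hK, hKe⟩, k⟩
  obtain ⟨C, hC, N, h⟩ := hT e K hK hKe k
  refine ⟨(Finset.range N).image fun j ↦ (⟨⟨e, K, hK, hKe⟩, j⟩ : SeminormIndex n M), C * N,
    fun σ ↦ ?_⟩
  rw [seminormFamily_apply]
  refine Real.iSup_le (fun x ↦ (h σ x x.2).trans ?_) (by positivity)
  rw [mul_assoc]
  gcongr
  calc _ ≤ ∑ j ∈ Finset.range N, (((Finset.range N).image fun j ↦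
        (⟨⟨e, K, hK, hKe⟩, j⟩ : SeminormIndex n M)).sup (seminormFamily 𝕜 n M)) σ := by
        refine Finset.sum_le_sum fun j hj ↦ ?_
        refine (σ.norm_iteratedFDeriv_le_seminorm ⟨⟨e, K, hK, hKe⟩, j⟩ x.2).trans ?_
        exact Seminorm.le_def.1 (Finset.le_sup (Finset.mem_image_of_mem _ hj)) σ
    _ = _ := by simp

theorem contDiffOn_comp_symm [IsManifold (𝓡 n) ∞ M] {F : Type*} [NormedAddCommGroup F]
    [NormedSpace ℝ F] (f : C^∞⟮𝓡 n, M; 𝓘(ℝ, F), F⟯) (e : Chart n M) :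
    ContDiffOn ℝ ∞ (fun x ↦ f (e.1.symm x)) e.1.target := by
  rw [← contMDiffOn_iff_contDiffOn]
  exact f.contMDiff.comp_contMDiffOn (contMDiffOn_symm_of_mem_maximalAtlas e.2)

/-- Multiplication of smooth densities by a smooth function, as a linear map. -/
noncomputable def mulLinear [IsManifold (𝓡 n) ∞ M] (f : C^∞⟮𝓡 n, M; 𝓘(ℝ, 𝕜), 𝕜⟯) :
    SmoothDensity 𝕜 n M →ₗ[𝕜] SmoothDensity 𝕜 n M where
  toFun σ :=
    { coeff := fun e x ↦ f (e.1.symm x) * σ.coeff e x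
      contDiffOn_coeff := fun e ↦ (contDiffOn_comp_symm f e).mul (σ.contDiffOn_coeff e)
      coeff_transition := fun e e' x hx hx' ↦ by
        rw [σ.coeff_transition e e' x hx hx', e'.1.left_inv hx', mul_smul_comm]
      coeff_eq_zero := fun e x hx ↦ by rw [σ.coeff_eq_zero e x hx, mul_zero] }
  map_add' σ τ := by ext e x; exact mul_add _ _ _
  map_smul' c σ := by ext e x; exact mul_left_comm _ _ _

/-- Multiplication of smooth densities by a smooth function, as a continuous linear map. -/
noncomputable def mul [IsManifold (𝓡 n) ∞ M] (f : C^∞⟮𝓡 n, M; 𝓘(ℝ, 𝕜), 𝕜⟯) :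
    SmoothDensity 𝕜 n M →L[𝕜] SmoothDensity 𝕜 n M where
  toLinearMap := mulLinear f
  cont := by
    refine continuous_of_bound (mulLinear f) fun e K hK hKe k ↦ ?_
    obtain ⟨C, hC, h⟩ := exists_bound_smul (F := 𝕜) e.1.open_target hK hKe
      (contDiffOn_comp_symm f e) k
    exact ⟨C, hC, k + 1, fun σ x hx ↦ h _ (σ.contDiffOn_coeff e) x hx⟩

theorem contDiffOn_vectorCoeff_smul [IsManifold (𝓡 n) ∞ M]
    (X : Cₛ^∞⟮𝓡 n; EuclideanSpace ℝ (Fin n), (TangentSpace (𝓡 n) : M → Type _)⟯)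
    (σ : SmoothDensity 𝕜 n M) (e : Chart n M) (i : Fin n) :
    ContDiffOn ℝ ∞ (fun y ↦ vectorCoeff e X y i • σ.coeff e y) e.1.target :=
  (contDiffOn_euclidean.1 (contDiffOn_vectorCoeff e X) i).smul (σ.contDiffOn_coeff e)

/-- The transpose of the derivation `X : C^∞(M) → C^∞(M)`, as a linear map on smooth densities:
`h |dx| ↦ -∑ᵢ ∂ᵢ(Xⁱ h) |dx|` in every chart, that is, minus the Lie derivative along `X`. -/
noncomputable def lieTransposeLinear [IsManifold (𝓡 n) ∞ M]
    (X : Cₛ^∞⟮𝓡 n; EuclideanSpace ℝ (Fin n), (TangentSpace (𝓡 n) : M → Type _)⟯) :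
    SmoothDensity 𝕜 n M →ₗ[𝕜] SmoothDensity 𝕜 n M where
  toFun σ :=
    { coeff := fun e ↦ e.1.target.indicator fun x ↦
        -∑ i, fderiv ℝ (fun y ↦ vectorCoeff e X y i • σ.coeff e y) x (EuclideanSpace.single i 1)
      contDiffOn_coeff := fun e ↦ by
        refine ContDiffOn.congr ?_ fun x hx ↦ indicator_of_mem hx _
        refine (ContDiffOn.sum fun i _ ↦ ?_).neg
        exact ((contDiffOn_vectorCoeff_smul X σ e i).fderiv_of_isOpen e.1.open_target
          (m := ∞) (by norm_cast)).clm_apply contDiffOn_const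
      coeff_transition := fun e e' x hx hx' ↦ by
        have hx'' := e'.1.map_source hx'
        have hkx : e'.1.symm (e'.1 (e.1.symm x)) ∈ e.1.source := by
          rw [e'.1.left_inv hx']; exact e.1.map_target hx
        rw [indicator_of_mem hx, indicator_of_mem hx'', smul_neg, neg_inj]
        refine divergence_transform (k := fun y ↦ e.1 (e'.1.symm y))
          (contDiffAt_transition e e' hx hx')
          ((contDiffAt_transition e' e hx'' hkx).differentiableAt (by simp)) ?_ ?_
          (((contDiffOn_vectorCoeff e X).contDiffAt
            (e.1.open_target.mem_nhds hx)).differentiableAt (by simp))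
          (((contDiffOn_vectorCoeff e' X).contDiffAt
            (e'.1.open_target.mem_nhds hx'')).differentiableAt (by simp))
          ((σ.contDiffAt_coeff e' hx'').differentiableAt (by simp)) ?_ ?_
        · filter_upwards [eventually_mem_source e e' hx hx'] with y hy
          rw [e'.1.left_inv hy.2, e.1.right_inv hy.1]
        · filter_upwards [eventually_mem_source e' e hx'' hkx] with y hy
          rw [e.1.left_inv hy.2, e'.1.right_inv hy.1]
        · filter_upwards [eventually_mem_source e e' hx hx'] with y hy
          exact vectorCoeff_transition e e' X hy.1 hy.2
        · filter_upwards [eventually_mem_source e e' hx hx'] with y hy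
          exact σ.coeff_transition e e' y hy.1 hy.2
      coeff_eq_zero := fun e x hx ↦ indicator_of_notMem hx _ }
  map_add' σ τ := by
    ext e x
    by_cases hx : x ∈ e.1.target
    · simp only [indicator_of_mem hx, add_coeff, smul_add]
      rw [← neg_add, ← Finset.sum_add_distrib, neg_inj]
      refine Finset.sum_congr rfl fun i _ ↦ ?_
      rw [fderiv_fun_add]
      · rfl
      · exact (((contDiffOn_vectorCoeff_smul X σ e i).contDiffAt
          (e.1.open_target.mem_nhds hx)).differentiableAt (by simp))
      · exact (((contDiffOn_vectorCoeff_smul X τ e i).contDiffAt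
          (e.1.open_target.mem_nhds hx)).differentiableAt (by simp))
    · simp [indicator_of_notMem hx]
  map_smul' c σ := by
    ext e x
    by_cases hx : x ∈ e.1.target
    · simp only [indicator_of_mem hx, smul_coeff, RingHom.id_apply]
      rw [mul_neg, Finset.mul_sum, neg_inj]
      refine Finset.sum_congr rfl fun i _ ↦ ?_
      simp_rw [← mul_smul_comm]
      rw [fderiv_const_mul]
      · rfl
      · exact (((contDiffOn_vectorCoeff_smul X σ e i).contDiffAt
          (e.1.open_target.mem_nhds hx)).differentiableAt (by simp))
    · simp [indicator_of_notMem hx]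

/-- The transpose of the derivation `X : C^∞(M) → C^∞(M)`, as a continuous linear map on smooth
densities. -/
noncomputable def lieTranspose [IsManifold (𝓡 n) ∞ M]
    (X : Cₛ^∞⟮𝓡 n; EuclideanSpace ℝ (Fin n), (TangentSpace (𝓡 n) : M → Type _)⟯) :
    SmoothDensity 𝕜 n M →L[𝕜] SmoothDensity 𝕜 n M where
  toLinearMap := lieTransposeLinear X
  cont := by
    refine continuous_of_bound (lieTransposeLinear X) fun e K hK hKe k ↦ ?_
    have hb := fun i ↦ exists_bound_smul (F := 𝕜) e.1.open_target hK hKe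
      (contDiffOn_euclidean.1 (contDiffOn_vectorCoeff e X) i) (k + 1)
    choose C hC h using hb
    refine ⟨∑ i, C i, Finset.sum_nonneg fun i _ ↦ hC i, k + 1 + 1, fun σ x hx ↦ ?_⟩
    have hxe := hKe hx
    have h1 : (e.1.target.indicator fun x ↦
        -∑ i, fderiv ℝ (fun y ↦ vectorCoeff e X y i • σ.coeff e y) x (EuclideanSpace.single i 1))
        =ᶠ[𝓝 x] -fun x ↦
          ∑ i, fderiv ℝ (fun y ↦ vectorCoeff e X y i • σ.coeff e y) x (EuclideanSpace.single i 1) := by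
      filter_upwards [e.1.open_target.mem_nhds hxe] with y hy
      rw [indicator_of_mem hy]; rfl
    have hs := fun i ↦ ((contDiffOn_vectorCoeff_smul X σ e i).contDiffAt
          (e.1.open_target.mem_nhds hxe))
    simp only [lieTransposeLinear, LinearMap.coe_mk, AddHom.coe_mk]
    rw [(h1.iteratedFDeriv ℝ k).self_of_nhds, iteratedFDeriv_neg_apply, norm_neg,
      iteratedFDeriv_fun_sum_apply, Finset.sum_mul]
    · refine (norm_sum_le _ _).trans (Finset.sum_le_sum fun i _ ↦ ?_)
      refine (norm_iteratedFDeriv_fderiv_apply_le (hs i) _ k).trans ?_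
      rw [PiLp.norm_single, norm_one, one_mul]
      exact h i _ (σ.contDiffOn_coeff e) x hx
    · intro i _
      exact (((hs i).fderiv_right (m := ∞) (by norm_cast)).clm_apply contDiffAt_const).of_le
        (mod_cast le_top)

section ChartDensity

variable [IsManifold (𝓡 n) ∞ M]

/-- The coefficient of the density `φ · (ψ ∘ e) |de|` in the chart `e'`. -/
noncomputable def chartDensityFun (e : Chart n M) (φ : C^∞⟮𝓡 n, M; 𝓘(ℝ), ℝ⟯) (ψ : EuclideanSpace ℝ (Fin n) → ℝ)
    (e' : Chart n M) (x : EuclideanSpace ℝ (Fin n)) : ℝ :=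
  |(fderiv ℝ (fun y ↦ e.1 (e'.1.symm y)) x).det| * φ (e'.1.symm x) * ψ (e.1 (e'.1.symm x))

theorem chartDensityFun_eventuallyEq_zero {e : Chart n M} {φ : C^∞⟮𝓡 n, M; 𝓘(ℝ), ℝ⟯}
    (ψ : EuclideanSpace ℝ (Fin n) → ℝ) (e' : Chart n M) {x : EuclideanSpace ℝ (Fin n)}
    (hx : x ∈ e'.1.target) (hx' : e'.1.symm x ∉ tsupport φ) :
    chartDensityFun e φ ψ e' =ᶠ[𝓝 x] fun _ ↦ 0 := by
  have := (e'.1.continuousAt_symm hx).eventually_mem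
    ((isClosed_tsupport φ).isOpen_compl.mem_nhds hx')
  filter_upwards [this] with y hy
  simp [chartDensityFun, image_eq_zero_of_notMem_tsupport hy]

theorem isOpen_overlap (e e' : Chart n M) :
    IsOpen (e'.1.target ∩ e'.1.symm ⁻¹' e.1.source) :=
  e'.1.symm.isOpen_inter_preimage e.1.open_source

theorem contDiffOn_transition (e e' : Chart n M) :
    ContDiffOn ℝ ∞ (fun y ↦ e.1 (e'.1.symm y)) (e'.1.target ∩ e'.1.symm ⁻¹' e.1.source) :=
  fun _ hx ↦ (contDiffAt_transition e' e hx.1 hx.2).contDiffWithinAt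

theorem det_transition_mul (e e' e'' : Chart n M) {x : EuclideanSpace ℝ (Fin n)}
    (hx : x ∈ e.1.target) (hx' : e.1.symm x ∈ e'.1.source) (hx'' : e.1.symm x ∈ e''.1.source) :
    (fderiv ℝ (fun y ↦ e''.1 (e.1.symm y)) x).det =
      (fderiv ℝ (fun y ↦ e''.1 (e'.1.symm y)) (e'.1 (e.1.symm x))).det *
        (fderiv ℝ (fun y ↦ e'.1 (e.1.symm y)) x).det := by
  have h1 := ((contDiffAt_transition e e' hx hx').differentiableAt (by simp)).hasFDerivAt
  have h2 := ((contDiffAt_transition e' e'' (e'.1.map_source hx')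
    (by rwa [e'.1.left_inv hx'])).differentiableAt (by simp)).hasFDerivAt
  have h3 := (h2.comp x h1).congr_of_eventuallyEq (f₁ := fun y ↦ e''.1 (e.1.symm y)) (by
    filter_upwards [eventually_mem_source e e' hx hx'] with y hy
    simp [e'.1.left_inv hy.2])
  rw [h3.fderiv, ContinuousLinearMap.det, ContinuousLinearMap.toLinearMap_comp,
    LinearMap.det_comp]

theorem det_transition_ne_zero (e e' : Chart n M) {x : EuclideanSpace ℝ (Fin n)}
    (hx : x ∈ e.1.target) (hx' : e.1.symm x ∈ e'.1.source) :
    (fderiv ℝ (fun y ↦ e'.1 (e.1.symm y)) x).det ≠ 0 := by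
  have h := det_transition_mul e e' e hx hx' (e.1.map_target hx)
  have h1 : HasFDerivAt (fun y ↦ e.1 (e.1.symm y)) (.id ℝ _) x :=
    (hasFDerivAt_id x).congr_of_eventuallyEq (by
      filter_upwards [e.1.open_target.mem_nhds hx] with y hy
      simp [e.1.right_inv hy])
  rw [h1.fderiv] at h
  intro h0
  rw [h0, mul_zero] at h
  simp [ContinuousLinearMap.det] at h

theorem contDiffOn_chartDensity_factor (e : Chart n M) (φ : C^∞⟮𝓡 n, M; 𝓘(ℝ), ℝ⟯)
    (e' : Chart n M) :
    ContDiffOn ℝ ∞ (fun x ↦ |(fderiv ℝ (fun y ↦ e.1 (e'.1.symm y)) x).det| * φ (e'.1.symm x))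
      (e'.1.target ∩ e'.1.symm ⁻¹' e.1.source) := by
  intro x hx
  refine ContDiffAt.contDiffWithinAt (ContDiffAt.mul ?_ ?_)
  · exact (contDiff_det.contDiffAt.comp x ((contDiffAt_transition e' e hx.1 hx.2).fderiv_right
      (m := ∞) (by norm_cast))).abs (det_transition_ne_zero e' e hx.1 hx.2)
  · exact (contDiffOn_comp_symm φ e').contDiffAt (e'.1.open_target.mem_nhds hx.1)

theorem contDiffOn_chartDensityFun {e : Chart n M} {φ : C^∞⟮𝓡 n, M; 𝓘(ℝ), ℝ⟯}
    (hφ : tsupport φ ⊆ e.1.source) {ψ : EuclideanSpace ℝ (Fin n) → ℝ} (hψ : ContDiff ℝ ∞ ψ)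
    (e' : Chart n M) : ContDiffOn ℝ ∞ (chartDensityFun e φ ψ e') e'.1.target := by
  intro x hx
  by_cases hx' : e'.1.symm x ∈ e.1.source
  · have h := ((contDiffOn_chartDensity_factor e φ e').contDiffAt
      ((isOpen_overlap e e').mem_nhds ⟨hx, hx'⟩)).mul
      (hψ.contDiffAt.comp x (contDiffAt_transition e' e hx hx'))
    exact h.contDiffWithinAt
  · exact (contDiffAt_const.congr_of_eventuallyEq
      (chartDensityFun_eventuallyEq_zero ψ e' hx fun h ↦ hx' (hφ h))).contDiffWithinAt

theorem chartDensityFun_transition {e : Chart n M} {φ : C^∞⟮𝓡 n, M; 𝓘(ℝ), ℝ⟯}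
    (hφ : tsupport φ ⊆ e.1.source) (ψ : EuclideanSpace ℝ (Fin n) → ℝ) (e₁ e₂ : Chart n M)
    {x : EuclideanSpace ℝ (Fin n)} (hx : x ∈ e₁.1.target) (hx' : e₁.1.symm x ∈ e₂.1.source) :
    chartDensityFun e φ ψ e₁ x = |(fderiv ℝ (fun y ↦ e₂.1 (e₁.1.symm y)) x).det| *
      chartDensityFun e φ ψ e₂ (e₂.1 (e₁.1.symm x)) := by
  unfold chartDensityFun
  rw [e₂.1.left_inv hx']
  by_cases hxe : e₁.1.symm x ∈ e.1.source
  · rw [det_transition_mul e₁ e₂ e hx hx' hxe, abs_mul]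
    ring
  · rw [image_eq_zero_of_notMem_tsupport fun h ↦ hxe (hφ h)]
    ring

theorem exists_bound_chartDensityFun {e : Chart n M} {φ : C^∞⟮𝓡 n, M; 𝓘(ℝ), ℝ⟯}
    (hφ : tsupport φ ⊆ e.1.source) (e' : Chart n M) {K : Set (EuclideanSpace ℝ (Fin n))}
    (hK : IsCompact K) (hKe : K ⊆ e'.1.target) (k : ℕ) :
    ∃ C : ℝ, 0 ≤ C ∧ ∀ ψ : EuclideanSpace ℝ (Fin n) → ℝ, ContDiff ℝ ∞ ψ → ∀ B : ℝ, 0 ≤ B →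
      (∀ i ≤ k, ∀ y, ‖iteratedFDeriv ℝ i ψ y‖ ≤ B) → ∀ x ∈ K,
      ‖iteratedFDeriv ℝ k (chartDensityFun e φ ψ e') x‖ ≤ C * B := by
  have hU := isOpen_overlap e e'
  set U := e'.1.target ∩ e'.1.symm ⁻¹' e.1.source
  set K' := K ∩ e'.1.symm ⁻¹' tsupport φ with hK'
  have hK'c : IsCompact K' := by
    refine hK.of_isClosed_subset ?_ inter_subset_left
    exact (e'.1.continuousOn_symm.mono hKe).preimage_isClosed_of_isClosed hK.isClosed
      (isClosed_tsupport φ)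
  have hK'U : K' ⊆ U := fun x hx ↦ ⟨hKe hx.1, hφ hx.2⟩
  obtain ⟨C₁, hC₁, h₁⟩ := exists_bound_smul (F := ℝ) hU hK'c hK'U
    (contDiffOn_chartDensity_factor e φ e') k
  have hc := fun j ↦ exists_bound_comp (F := ℝ) hU hK'c hK'U (contDiffOn_transition e e') j
  choose C₂ hC₂ h₂ using hc
  have hS : 0 ≤ ∑ j ∈ Finset.range (k + 1), C₂ j := Finset.sum_nonneg fun j _ ↦ hC₂ j
  refine ⟨C₁ * ∑ j ∈ Finset.range (k + 1), C₂ j, by positivity, fun ψ hψ B hB0 hB x hx ↦ ?_⟩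
  by_cases hxφ : e'.1.symm x ∈ tsupport φ
  · refine (h₁ (fun y ↦ ψ (e.1 (e'.1.symm y)))
      (hψ.comp_contDiffOn (contDiffOn_transition e e')) x ⟨hx, hxφ⟩).trans ?_
    rw [mul_assoc, Finset.sum_mul]
    gcongr with j hj
    exact h₂ j ψ hψ B (fun i hi y ↦ hB i (hi.trans (by simpa [Nat.lt_succ_iff] using hj)) y) x ⟨hx, hxφ⟩
  · rw [((chartDensityFun_eventuallyEq_zero ψ e' (hKe hx) hxφ).iteratedFDeriv ℝ k).self_of_nhds]
    have : iteratedFDeriv ℝ k (fun _ : EuclideanSpace ℝ (Fin n) ↦ (0 : ℝ)) x = 0 := by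
      simp
    rw [this, norm_zero]
    positivity

instance : RingHomIsometric (algebraMap ℝ 𝕜) := ⟨fun {x} ↦ norm_algebraMap' 𝕜 x⟩

theorem contDiff_algebraMap : ContDiff ℝ ∞ (algebraMap ℝ 𝕜) := (RCLike.ofRealCLM (K := 𝕜)).contDiff

/-- The smooth density `φ · (ψ ∘ e) |de|` on `M` (zero outside the domain of the chart `e`), as a
function of the Schwartz function `ψ`. -/
noncomputable def ofChartLinear (𝕜 : Type*) [RCLike 𝕜] (e : Chart n M) (φ : C^∞⟮𝓡 n, M; 𝓘(ℝ), ℝ⟯)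
    (hφ : tsupport φ ⊆ e.1.source) :
    𝓢(EuclideanSpace ℝ (Fin n), ℝ) →ₛₗ[algebraMap ℝ 𝕜] SmoothDensity 𝕜 n M where
  toFun ψ :=
    { coeff := fun e' ↦ e'.1.target.indicator fun x ↦ algebraMap ℝ 𝕜 (chartDensityFun e φ ψ e' x)
      contDiffOn_coeff := fun e' ↦ by
        refine ContDiffOn.congr ?_ fun x hx ↦ indicator_of_mem hx _
        exact contDiff_algebraMap.comp_contDiffOn (contDiffOn_chartDensityFun hφ (ψ.smooth _) e')
      coeff_transition := fun e₁ e₂ x hx hx' ↦ by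
        rw [indicator_of_mem hx, indicator_of_mem (e₂.1.map_source hx'),
          chartDensityFun_transition hφ ψ e₁ e₂ hx hx', map_mul, Algebra.smul_def]
      coeff_eq_zero := fun e' x hx ↦ indicator_of_notMem hx _ }
  map_add' ψ ψ' := by
    ext e' x
    by_cases hx : x ∈ e'.1.target
    · simp [indicator_of_mem hx, chartDensityFun, mul_add]
    · simp [indicator_of_notMem hx]
  map_smul' c ψ := by
    ext e' x
    by_cases hx : x ∈ e'.1.target
    · simp [indicator_of_mem hx, chartDensityFun]; ring
    · simp [indicator_of_notMem hx]

/-- The smooth density `φ · (ψ ∘ e) |de|` on `M` (zero outside the domain of the chart `e`), as a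
continuous function of the Schwartz function `ψ`. -/
noncomputable def ofChart (𝕜 : Type*) [RCLike 𝕜] (e : Chart n M) (φ : C^∞⟮𝓡 n, M; 𝓘(ℝ), ℝ⟯)
    (hφ : tsupport φ ⊆ e.1.source) :
    𝓢(EuclideanSpace ℝ (Fin n), ℝ) →SL[algebraMap ℝ 𝕜] SmoothDensity 𝕜 n M where
  toLinearMap := ofChartLinear 𝕜 e φ hφ
  cont := by
    refine (schwartz_withSeminorms ℝ _ _).continuous_of_isBounded withSeminorms
      (ofChartLinear 𝕜 e φ hφ) (Seminorm.IsBounded.of_real ?_)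
    rintro ⟨⟨e', K, hK, hKe⟩, k⟩
    obtain ⟨C, hC, h⟩ := exists_bound_chartDensityFun hφ e' hK hKe k
    refine ⟨(Finset.range (k + 1)).image fun j ↦ (0, j), C, fun ψ ↦ ?_⟩
    rw [seminormFamily_apply]
    refine Real.iSup_le (fun x ↦ ?_) (by positivity)
    refine le_trans (le_of_eq ?_) (h ψ (ψ.smooth _) _ (by positivity) (fun i hi y ↦ ?_) x x.2)
    · have hx := hKe x.2
      have h1 : (e'.1.target.indicator fun x ↦ algebraMap ℝ 𝕜 (chartDensityFun e φ ψ e' x))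
          =ᶠ[𝓝 x.1] (RCLike.ofRealLI (K := 𝕜)) ∘ (chartDensityFun e φ ψ e') := by
        filter_upwards [e'.1.open_target.mem_nhds hx] with y hy
        rw [indicator_of_mem hy]; rfl
      simp only [ofChartLinear, LinearMap.coe_mk, AddHom.coe_mk]
      rw [(h1.iteratedFDeriv ℝ k).self_of_nhds]
      exact (RCLike.ofRealLI (K := 𝕜)).norm_iteratedFDeriv_comp_left
        (((contDiffOn_chartDensityFun hφ (ψ.smooth _) e').contDiffAt
          (e'.1.open_target.mem_nhds hx))) (mod_cast le_top)
    · have h2 := ψ.le_seminorm ℝ 0 i y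
      rw [pow_zero, one_mul] at h2
      refine h2.trans ?_
      exact Seminorm.le_def.1 (Finset.le_sup (f := schwartzSeminormFamily ℝ _ _) (b := (0, i))
        (Finset.mem_image_of_mem _ (Finset.mem_range.2 (by omega)))) ψ

end ChartDensity

end SmoothDensity
/-! ### Distributions and differential operators -/

section Distributions

variable (𝕜 : Type*) [RCLike 𝕜] (n : ℕ) (M : Type*) [TopologicalSpace M]
  [ChartedSpace (EuclideanSpace ℝ (Fin n)) M]

/-- The space `C^{-∞}(M)` of distributions on a compact manifold `M`, which is the dual of the space
of smooth densities (with its strong topology). -/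
abbrev DistributionSpace : Type _ := SmoothDensity 𝕜 n M →L[𝕜] 𝕜

/-- The smooth vector fields on `M`. -/
abbrev SmoothVectorField [IsManifold (𝓡 n) ∞ M] : Type _ :=
  Cₛ^∞⟮𝓡 n; EuclideanSpace ℝ (Fin n), (TangentSpace (𝓡 n) : M → Type _)⟯

variable {𝕜 n M}

/-- The chart `e` of `M` is adapted to `L`, with `k` normal coordinates: in the domain of `e`, the
set `L` is given by the vanishing of the first `k` coordinates. -/
def IsAdaptedChart (k : ℕ) (L : Set M) (e : Chart n M) : Prop :=
  ∀ q ∈ e.1.source, q ∈ L ↔ ∀ i : Fin n, (i : ℕ) < k → e.1 q i = 0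

variable (n) in
/-- The set `L` is a regular (that is, embedded) submanifold of `M` of codimension `k`, and it is a
closed subset of `M`. -/
structure IsClosedSubmanifold (k : ℕ) (L : Set M) : Prop where
  codim_le : k ≤ n
  isClosed : IsClosed L
  exists_chart : ∀ p ∈ L, ∃ e : Chart n M, p ∈ e.1.source ∧ IsAdaptedChart k L e

variable [IsManifold (𝓡 n) ∞ M]

/-- The vector field `X` is tangent to the submanifold `L` of codimension `k`: at the points of `L`,
its first `k` components in every adapted chart vanish. -/
def IsTangentTo (k : ℕ) (L : Set M) (X : SmoothVectorField n M) : Prop :=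
  ∀ e : Chart n M, IsAdaptedChart k L e → ∀ p ∈ L, p ∈ e.1.source →
    ∀ i : Fin n, (i : ℕ) < k → vectorCoeff e X (e.1 p) i = 0

/-- Multiplication of distributions by a smooth function `f`: `⟨f u, σ⟩ = ⟨u, f σ⟩`. -/
noncomputable def mulOp (f : C^∞⟮𝓡 n, M; 𝓘(ℝ, 𝕜), 𝕜⟯) :
    Module.End 𝕜 (DistributionSpace 𝕜 n M) where
  toFun u := u.comp (SmoothDensity.mul f)
  map_add' _ _ := rfl
  map_smul' _ _ := rfl

/-- The derivative of distributions along a smooth vector field `X`: `⟨X u, σ⟩ = ⟨u, Xᵗ σ⟩`. -/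
noncomputable def lieOp (X : SmoothVectorField n M) :
    Module.End 𝕜 (DistributionSpace 𝕜 n M) where
  toFun u := u.comp (SmoothDensity.lieTranspose X)
  map_add' _ _ := rfl
  map_smul' _ _ := rfl

variable (𝕜 n) in
/-- The algebra `Diff(M, L)` of differential operators which is generated by the smooth functions on
`M` and the smooth vector fields on `M` tangent to `L`. A differential operator is identified with
its action on distributions, of which its action on smooth functions is the restriction. -/
noncomputable def diffOps (k : ℕ) (L : Set M) :
    Subalgebra 𝕜 (Module.End 𝕜 (DistributionSpace 𝕜 n M)) :=
  Algebra.adjoin 𝕜 (range mulOp ∪ lieOp '' {X | IsTangentTo k L X})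

end Distributions

/-! ### Sobolev spaces -/

/-- A finite atlas of the (compact) manifold `M` with a subordinate smooth partition of unity. -/
structure SobolevAtlas (n : ℕ) (M : Type*) [TopologicalSpace M]
    [ChartedSpace (EuclideanSpace ℝ (Fin n)) M] where
  ι : Type
  [fintype : Fintype ι]
  chart : ι → Chart n M
  partition : SmoothPartitionOfUnity ι (𝓡 n) M univ
  tsupport_subset : ∀ i, tsupport (partition i) ⊆ (chart i).1.source

section Sobolev

variable {𝕜 : Type*} [RCLike 𝕜] {n : ℕ} {M : Type*} [TopologicalSpace M]
  [ChartedSpace (EuclideanSpace ℝ (Fin n)) M] [IsManifold (𝓡 n) ∞ M]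

theorem rclike_map_mul (a b : 𝕜) :
    RCLike.map 𝕜 ℂ (a * b) = RCLike.map 𝕜 ℂ a * RCLike.map 𝕜 ℂ b := by
  rcases RCLike.I_mul_I (K := 𝕜) with h | h
  · have h0 : ∀ z : 𝕜, RCLike.im z = 0 := fun z ↦ by
      have := RCLike.mul_im (RCLike.I : 𝕜) z
      have h2 := RCLike.mul_im_I_ax z
      rw [h] at h2; simpa using h2.symm
    apply Complex.ext <;> simp [h0]
  · apply Complex.ext <;> simp

theorem rclike_map_algebraMap (r : ℝ) : RCLike.map 𝕜 ℂ (algebraMap ℝ 𝕜 r) = r := by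
  apply Complex.ext <;> simp

/-- The push-forward to `ℝⁿ`, by the chart `e`, of the product of the distribution `u` with a smooth
function `φ` supported in the domain of `e`. It is a complex tempered distribution:
`⟨e_*(φ u), ψ⟩ = ⟨u, φ · (ψ ∘ e) |de|⟩` for real Schwartz functions `ψ`, and this is extended by
complex linearity. -/
noncomputable def localize (u : DistributionSpace 𝕜 n M) (e : Chart n M)
    (φ : C^∞⟮𝓡 n, M; 𝓘(ℝ), ℝ⟯) (hφ : tsupport φ ⊆ e.1.source) :
    𝓢'(EuclideanSpace ℝ (Fin n), ℂ) where
  toFun ψ :=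
    RCLike.map 𝕜 ℂ (u (SmoothDensity.ofChart 𝕜 e φ hφ (SchwartzMap.postcompCLM Complex.reCLM ψ))) +
    Complex.I *
      RCLike.map 𝕜 ℂ
        (u (SmoothDensity.ofChart 𝕜 e φ hφ (SchwartzMap.postcompCLM Complex.imCLM ψ)))
  map_add' ψ ψ' := by simp only [map_add]; ring
  map_smul' c ψ := by
    have hre : SchwartzMap.postcompCLM Complex.reCLM (c • ψ) =
        c.re • SchwartzMap.postcompCLM Complex.reCLM ψ -
          c.im • SchwartzMap.postcompCLM Complex.imCLM ψ := by
      ext x; simp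
    have him : SchwartzMap.postcompCLM Complex.imCLM (c • ψ) =
        c.re • SchwartzMap.postcompCLM Complex.imCLM ψ +
          c.im • SchwartzMap.postcompCLM Complex.reCLM ψ := by
      ext x; simp
    simp only [hre, him, map_add, map_sub, map_smulₛₗ, smul_eq_mul, rclike_map_mul,
      RingHom.id_apply, rclike_map_algebraMap]
    conv_rhs => rw [← Complex.re_add_im c]
    linear_combination (-(c.im : ℂ) * RCLike.map 𝕜 ℂ (u (SmoothDensity.ofChart 𝕜 e φ hφ
      (SchwartzMap.postcompCLM Complex.imCLM ψ)))) * Complex.I_mul_I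
  cont := by
    refine Continuous.add ?_ (continuous_const.mul ?_)
    · exact (RCLike.map 𝕜 ℂ).continuous.comp (u.continuous.comp
        ((SmoothDensity.ofChart 𝕜 e φ hφ).continuous.comp (ContinuousLinearMap.continuous _)))
    · exact (RCLike.map 𝕜 ℂ).continuous.comp (u.continuous.comp
        ((SmoothDensity.ofChart 𝕜 e φ hφ).continuous.comp (ContinuousLinearMap.continuous _)))

theorem localize_add (u v : DistributionSpace 𝕜 n M) (e : Chart n M)
    (φ : C^∞⟮𝓡 n, M; 𝓘(ℝ), ℝ⟯) (hφ : tsupport φ ⊆ e.1.source) :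
    localize (u + v) e φ hφ = localize u e φ hφ + localize v e φ hφ := by
  ext ψ
  change RCLike.map 𝕜 ℂ (u _ + v _) + Complex.I * RCLike.map 𝕜 ℂ (u _ + v _) =
    (RCLike.map 𝕜 ℂ (u _) + Complex.I * RCLike.map 𝕜 ℂ (u _)) +
      (RCLike.map 𝕜 ℂ (v _) + Complex.I * RCLike.map 𝕜 ℂ (v _))
  simp only [map_add]
  ring

theorem localize_smul (c : 𝕜) (u : DistributionSpace 𝕜 n M) (e : Chart n M)
    (φ : C^∞⟮𝓡 n, M; 𝓘(ℝ), ℝ⟯) (hφ : tsupport φ ⊆ e.1.source) :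
    localize (c • u) e φ hφ = RCLike.map 𝕜 ℂ c • localize u e φ hφ := by
  ext ψ
  change RCLike.map 𝕜 ℂ (c * u _) + Complex.I * RCLike.map 𝕜 ℂ (c * u _) =
    RCLike.map 𝕜 ℂ c * (RCLike.map 𝕜 ℂ (u _) + Complex.I * RCLike.map 𝕜 ℂ (u _))
  simp only [rclike_map_mul]
  ring

theorem localize_zero (e : Chart n M) (φ : C^∞⟮𝓡 n, M; 𝓘(ℝ), ℝ⟯)
    (hφ : tsupport φ ⊆ e.1.source) :
    localize (0 : DistributionSpace 𝕜 n M) e φ hφ = 0 := by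
  have h := localize_add (0 : DistributionSpace 𝕜 n M) 0 e φ hφ
  rw [add_zero] at h
  exact left_eq_add.1 h

variable (𝕜) in
/-- The Sobolev space `H^s(M)`, as a subspace of the space of distributions: the pieces `ρᵢ u` of
`u`, read in the charts, belong to `H^s(ℝⁿ)`. -/
noncomputable def sobolevSubmodule (A : SobolevAtlas n M) (s : ℝ) :
    Submodule 𝕜 (DistributionSpace 𝕜 n M) where
  carrier := {u | ∀ i, TemperedDistribution.MemSobolev s 2
    (localize u (A.chart i) (A.partition i) (A.tsupport_subset i))}
  add_mem' hu hv i := by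
    rw [localize_add]
    exact (hu i).add (hv i)
  zero_mem' i := by
    rw [localize_zero]
    exact TemperedDistribution.memSobolev_fun_zero _ _ s 2
  smul_mem' c u hu i := by
    rw [localize_smul]
    exact (hu i).smul _

variable (𝕜) in
/-- The Sobolev space `H^s(M)`. It is a type of its own, since it does not carry the subspace
topology from the space of distributions. -/
def SobolevSpace (A : SobolevAtlas n M) (s : ℝ) : Type _ := ↥(sobolevSubmodule 𝕜 A s)

namespace SobolevSpace

variable {A : SobolevAtlas n M} {s : ℝ}

noncomputable instance : AddCommGroup (SobolevSpace 𝕜 A s) :=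
  inferInstanceAs (AddCommGroup ↥(sobolevSubmodule 𝕜 A s))

noncomputable instance : Module 𝕜 (SobolevSpace 𝕜 A s) :=
  inferInstanceAs (Module 𝕜 ↥(sobolevSubmodule 𝕜 A s))

/-- The `L²` function `(1 + |D|²)^{s/2} e_*(ρᵢ u)`, where `e` is the `i`-th chart. Its `L²` norm is
the norm of `e_*(ρᵢ u)` in `H^s(ℝⁿ)`. -/
noncomputable def besselComponent (i : A.ι) (u : SobolevSpace 𝕜 A s) :
    Lp ℂ 2 (volume : Measure (EuclideanSpace ℝ (Fin n))) :=
  (u.2 i).choose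

theorem besselComponent_spec (i : A.ι) (u : SobolevSpace 𝕜 A s) :
    TemperedDistribution.besselPotential (EuclideanSpace ℝ (Fin n)) ℂ s
      (localize u.1 (A.chart i) (A.partition i) (A.tsupport_subset i)) =
        (besselComponent i u : 𝓢'(EuclideanSpace ℝ (Fin n), ℂ)) :=
  (u.2 i).choose_spec

/-- The (Hilbertable) topology of `H^s(M)`, which is defined by the norm
`(∑ᵢ ‖e_*(ρᵢ u)‖²)^{1/2}` with the norms of `H^s(ℝⁿ)` under the sum. -/
noncomputable instance : TopologicalSpace (SobolevSpace 𝕜 A s) :=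
  TopologicalSpace.induced (fun u i ↦ besselComponent i u) Pi.topologicalSpace

end SobolevSpace

/-! ### The spaces `I^{(s)}(M, L)` -/

variable (𝕜) in
/-- The space `I^{(s)}(M, L)` of the distributions `u` such that `Diff(M, L) u ⊂ H^s(M)`, as a
subspace of the space of distributions. -/
noncomputable def conormalSubmodule (A : SobolevAtlas n M) (k : ℕ) (L : Set M) (s : ℝ) :
    Submodule 𝕜 (DistributionSpace 𝕜 n M) where
  carrier := {u | ∀ P ∈ diffOps 𝕜 n k L, P u ∈ sobolevSubmodule 𝕜 A s}
  add_mem' hu hv P hP := by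
    rw [map_add]
    exact add_mem (hu P hP) (hv P hP)
  zero_mem' P hP := by
    rw [map_zero]
    exact zero_mem _
  smul_mem' c u hu P hP := by
    rw [map_smul]
    exact Submodule.smul_mem _ c (hu P hP)

variable (𝕜) in
/-- The space `I^{(s)}(M, L)`. It is a type of its own, since it does not carry the subspace topology
from the space of distributions. -/
def ConormalSpace (A : SobolevAtlas n M) (k : ℕ) (L : Set M) (s : ℝ) : Type _ :=
  ↥(conormalSubmodule 𝕜 A k L s)

namespace ConormalSpace

variable {A : SobolevAtlas n M} {k : ℕ} {L : Set M} {s : ℝ}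

noncomputable instance : AddCommGroup (ConormalSpace 𝕜 A k L s) :=
  inferInstanceAs (AddCommGroup ↥(conormalSubmodule 𝕜 A k L s))

noncomputable instance : Module 𝕜 (ConormalSpace 𝕜 A k L s) :=
  inferInstanceAs (Module 𝕜 ↥(conormalSubmodule 𝕜 A k L s))

/-- The map `P : I^{(s)}(M, L) → H^s(M)`, for `P` in `Diff(M, L)`. -/
noncomputable def applyOp (P : diffOps 𝕜 n k L) (u : ConormalSpace 𝕜 A k L s) :
    SobolevSpace 𝕜 A s :=
  ⟨P.1 u.1, u.2 P.1 P.2⟩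

/-- The projective topology given by the maps `P : I^{(s)}(M, L) → H^s(M)`, for `P` in
`Diff(M, L)`. -/
noncomputable instance : TopologicalSpace (ConormalSpace 𝕜 A k L s) :=
  ⨅ P : diffOps 𝕜 n k L, TopologicalSpace.induced (applyOp P) inferInstance

end ConormalSpace

end Sobolev

/-! ### Totally reflexive Fréchet spaces -/

section LocallyConvex

variable (𝕜 : Type*) [RCLike 𝕜] (E : Type*) [AddCommGroup E] [Module 𝕜 E] [TopologicalSpace E]

/-- `E` is a Fréchet space: a locally convex topological vector space which is metrizable (so
Hausdorff) and complete. -/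
structure IsFrechetSpace : Prop where
  isTopologicalAddGroup : IsTopologicalAddGroup E
  continuousSMul : ContinuousSMul 𝕜 E
  polynormableSpace : PolynormableSpace 𝕜 E
  metrizableSpace : TopologicalSpace.MetrizableSpace E
  completeSpace : @CompleteSpace E (IsTopologicalAddGroup.rightUniformSpace E)

/-- `E` is reflexive: the canonical map `x ↦ (f ↦ f x)` is an isomorphism of topological vector
spaces from `E` onto its bidual, where the dual and the bidual carry the strong topologies. -/
def IsReflexive : Prop :=
  ∃ J : E ≃L[𝕜] ((E →L[𝕜] 𝕜) →L[𝕜] 𝕜), ∀ (x : E) (f : E →L[𝕜] 𝕜), J x f = f x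

/-- `E` is totally reflexive: every quotient of `E` by a closed subspace is reflexive. -/
def IsTotallyReflexive : Prop :=
  ∀ N : Submodule 𝕜 E, IsClosed (N : Set E) → IsReflexive 𝕜 (E ⧸ N)

end LocallyConvex

end ConormalDistributions

namespace ConormalDistributions

/-! ### Fréchet spaces with a sequence of Hilbertian seminorms -/

/-! The proof has an abstract half, which shows that a Fréchet space defined by an increasing
sequence of Hilbertian seminorms (seminorms with the parallelogram law) is totally reflexive, and a
concrete half, which shows that `I^{(s)}(M, L)` is such a space.

Abstract half. A continuous functional `φ` on the strong dual of such a space `E` is bounded on the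
functionals that are small on some bounded set `B`. With small enough weights `w m`, the set `B`
lies in the unit ball of the space `H` of vectors with `∑ (w m * p m x) ^ 2 < ∞`, which is a Hilbert
space because `E` is complete and the parallelogram law survives summation (`exists_hilbertSpace`).
Then `φ` is dominated by the norm of the restriction of functionals to `H`, and Hahn–Banach with the
Riesz theorem represents `φ` by a vector of `H` (`exists_eq_eval`). So the canonical map is
bijective; Banach–Steinhaus makes it continuous, and polars of seminorm balls make its inverse
continuous (`isReflexive_of_isHilbertian`). Quotients need no new argument: quotient seminorms are
again Hilbertian, and a quotient of a Fréchet space by a closed subspace is again complete and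
Hausdorff.

Concrete half. The seminorms `u ↦ ‖J^s e_*(ρᵢ P u)‖` in `L²`, with `J^s` the Bessel potential, are
Hilbertian, but there are uncountably many operators `P`. The fields tangent to `L` are finitely
generated over the smooth functions (`exists_generators`, from Hadamard's lemma and a partition of
unity). By the Leibniz rule every `P` is then a finite sum of terms `f Y^l`, with `Y^l` a word in
the generators (`mem_span_of_mem_diffOps`). Multiplication by `f` is bounded on `H^s`
(`exists_besselPotential_smulLeftCLM`, from the inequalities of Peetre and Young), so the countably
many words already define the topology (`withSeminorms_wordSeminorm`).

Completeness of `I^{(s)}(M, L)` comes from that of `H^s(M)`, where a limit is reassembled from its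
pieces in the charts. Since the operators act by transposition, they respect pointwise limits of
distributions, so the limit of `Y^l u_r` is `Y^l` of the limit of `u_r`. -/

theorem sqrt_tsum_add_sq_le {f g : ℕ → ℝ} (hf : ∀ m, 0 ≤ f m) (hg : ∀ m, 0 ≤ g m)
    (hfs : Summable fun m ↦ f m ^ 2) (hgs : Summable fun m ↦ g m ^ 2) :
    (Summable fun m ↦ (f m + g m) ^ 2) ∧
      √(∑' m, (f m + g m) ^ 2) ≤ √(∑' m, f m ^ 2) + √(∑' m, g m ^ 2) := by
  have h := Real.Lp_add_le_tsum_of_nonneg (p := 2) one_le_two hf hg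
    (by simpa using hfs) (by simpa using hgs)
  simpa [Real.sqrt_eq_rpow] using h

universe u

/-- The seminorm `p` comes from a (semi-)inner product. -/
def IsHilbertian {𝕜 E : Type*} [NormedField 𝕜] [AddCommGroup E] [Module 𝕜 E]
    (p : Seminorm 𝕜 E) : Prop :=
  ∀ x y, p (x + y) ^ 2 + p (x - y) ^ 2 = 2 * (p x ^ 2 + p y ^ 2)

section WeightedSpace

variable {𝕜 : Type*} {E : Type u} [RCLike 𝕜] [AddCommGroup E] [Module 𝕜 E]
  (p : SeminormFamily 𝕜 E ℕ) (w : ℕ → ℝ)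

theorem summable_weighted_add (hw : ∀ m, 0 < w m) {x y : E}
    (hx : Summable fun m ↦ (w m * p m x) ^ 2) (hy : Summable fun m ↦ (w m * p m y) ^ 2) :
    (Summable fun m ↦ (w m * p m (x + y)) ^ 2) ∧
      √(∑' m, (w m * p m (x + y)) ^ 2) ≤
        √(∑' m, (w m * p m x) ^ 2) + √(∑' m, (w m * p m y) ^ 2) := by
  have h0 : ∀ z m, 0 ≤ w m * p m z := fun z m ↦ mul_nonneg (hw m).le (apply_nonneg _ _)
  obtain ⟨h1, h2⟩ := sqrt_tsum_add_sq_le (h0 x) (h0 y) hx hy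
  have h3 : ∀ m, (w m * p m (x + y)) ^ 2 ≤ (w m * p m x + w m * p m y) ^ 2 := fun m ↦ by
    have := map_add_le_add (p m) x y
    have h4 := h0 (x + y) m
    rw [← mul_add]
    gcongr
    exact (hw m).le
  have h4 := h1.of_nonneg_of_le (fun m ↦ sq_nonneg _) h3
  exact ⟨h4, (Real.sqrt_le_sqrt (h4.tsum_le_tsum h3 h1)).trans h2⟩

/-- The vectors `x` with `∑ (w m * p m x) ^ 2 < ∞`. -/
def weightedSubmodule (hw : ∀ m, 0 < w m) : Submodule 𝕜 E where
  carrier := {x | Summable fun m ↦ (w m * p m x) ^ 2}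
  add_mem' hx hy := (summable_weighted_add p w hw hx hy).1
  zero_mem' := by simp [summable_zero]
  smul_mem' c x hx := by
    have : (fun m ↦ (w m * p m (c • x)) ^ 2) = fun m ↦ ‖c‖ ^ 2 * (w m * p m x) ^ 2 := by
      funext m; rw [map_smul_eq_mul]; ring
    simp only [mem_ofPred_eq, this]
    exact hx.mul_left _

/-- The space of the vectors `x` with `∑ (w m * p m x) ^ 2 < ∞`, which carries its own norm. -/
def WeightedSpace (hw : ∀ m, 0 < w m) : Type u := ↥(weightedSubmodule p w hw)

instance (hw : ∀ m, 0 < w m) : AddCommGroup (WeightedSpace p w hw) :=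
  inferInstanceAs (AddCommGroup ↥(weightedSubmodule p w hw))

instance (hw : ∀ m, 0 < w m) : Module 𝕜 (WeightedSpace p w hw) :=
  inferInstanceAs (Module 𝕜 ↥(weightedSubmodule p w hw))

/-- Definiteness is the only point that uses more than Minkowski's inequality: all weights are
positive and the seminorms separate points. -/
theorem weighted_core (hw : ∀ m, 0 < w m) (hsep : ∀ x, (∀ m, p m x = 0) → x = 0) :
    let _ : Norm (WeightedSpace p w hw) := ⟨fun x ↦ √(∑' m, (w m * p m x.1) ^ 2)⟩
    NormedSpace.Core 𝕜 (WeightedSpace p w hw) := by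
  let _ : Norm (WeightedSpace p w hw) := ⟨fun x ↦ √(∑' m, (w m * p m x.1) ^ 2)⟩
  refine ⟨⟨fun x ↦ Real.sqrt_nonneg _, fun c x ↦ ?_,
    fun x y ↦ (summable_weighted_add p w hw x.2 y.2).2⟩, fun x ↦ ⟨fun h ↦ ?_, ?_⟩⟩
  · have : (fun m ↦ (w m * p m (c • x.1)) ^ 2) = fun m ↦ ‖c‖ ^ 2 * (w m * p m x.1) ^ 2 := by
      funext m; rw [map_smul_eq_mul]; ring
    change √(∑' m, (w m * p m (c • x.1)) ^ 2) = ‖c‖ * √(∑' m, (w m * p m x.1) ^ 2)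
    rw [this, tsum_mul_left, Real.sqrt_mul (sq_nonneg _), Real.sqrt_sq (norm_nonneg _)]
  · have h1 := (Real.sqrt_eq_zero (tsum_nonneg fun m ↦ sq_nonneg _)).1 h
    have hx : Summable fun m ↦ (w m * p m x.1) ^ 2 := x.2
    have h2 := (hx.hasSum_iff.2 h1)
    rw [hasSum_zero_iff_of_nonneg (fun m ↦ sq_nonneg _)] at h2
    refine Subtype.ext (hsep x.1 fun m ↦ ?_)
    have h3 := congrFun h2 m
    simpa [(hw m).ne'] using h3
  · rintro rfl
    change √(∑' m, (w m * p m (0 : E)) ^ 2) = 0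
    simp

theorem cauchySeq_iff_seminorm {E : Type*} [AddCommGroup E] [Module 𝕜 E] [UniformSpace E]
    [IsUniformAddGroup E] {κ : Type*} {p : SeminormFamily 𝕜 E κ} (hp : WithSeminorms p)
    {x : ℕ → E} : CauchySeq x ↔ ∀ k, ∀ ε > 0, ∃ N, ∀ i ≥ N, ∀ j ≥ N, p k (x i - x j) < ε := by
  have h1 : CauchySeq x ↔ Tendsto (fun q : ℕ × ℕ ↦ x q.2 - x q.1) atTop (𝓝 0) := by
    rw [cauchySeq_iff_tendsto, uniformity_eq_comap_nhds_zero, tendsto_comap_iff]; rfl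
  rw [h1, hp.tendsto_nhds]
  refine forall_congr' fun k ↦ forall₂_congr fun ε hε ↦ ?_
  rw [eventually_atTop_prod_self']
  simp only [sub_zero]
  exact exists_congr fun N ↦ ⟨fun h i hi j hj ↦ h j hj i hi, fun h i hi j hj ↦ h j hj i hi⟩

/-- The vectors of a complete space whose weighted sum of squares of Hilbertian seminorms is finite
form a Hilbert space. -/
theorem exists_hilbertSpace [UniformSpace E] [IsUniformAddGroup E] [CompleteSpace E] [T2Space E]
    (hp : WithSeminorms p) (hpar : ∀ m, IsHilbertian (p m)) (hw : ∀ m, 0 < w m) :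
    ∃ (H : Type u) (_ : NormedAddCommGroup H) (_ : InnerProductSpace 𝕜 H) (_ : CompleteSpace H)
      (ι : H →ₗ[𝕜] E), (∀ m h, w m * p m (ι h) ≤ ‖h‖) ∧
      ∀ x, (Summable fun m ↦ (w m * p m x) ^ 2) → ∑' m, (w m * p m x) ^ 2 ≤ 1 →
        ∃ h, ι h = x ∧ ‖h‖ ≤ 1 := by
  have hsep : ∀ x, (∀ m, p m x = 0) → x = 0 := fun x hx ↦ by
    by_contra h
    obtain ⟨m, hm⟩ := hp.separating_of_T1 x h
    exact hm (hx m)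
  let _ : Norm (WeightedSpace p w hw) := ⟨fun x ↦ √(∑' m, (w m * p m x.1) ^ 2)⟩
  have core := weighted_core p w hw hsep
  let _ : NormedAddCommGroup (WeightedSpace p w hw) := NormedAddCommGroup.ofCore core
  let _ : NormedSpace 𝕜 (WeightedSpace p w hw) := NormedSpace.ofCore core
  have hn : ∀ x : WeightedSpace p w hw, ‖x‖ * ‖x‖ = ∑' m, (w m * p m x.1) ^ 2 :=
    fun x ↦ Real.mul_self_sqrt (tsum_nonneg fun m ↦ sq_nonneg _)
  have hs : ∀ x : WeightedSpace p w hw, Summable fun m ↦ (w m * p m x.1) ^ 2 := fun x ↦ x.2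
  have hle : ∀ m (x : WeightedSpace p w hw), w m * p m x.1 ≤ ‖x‖ := fun m x ↦ by
    refine Real.le_sqrt_of_sq_le ?_
    exact (hs x).le_tsum m fun _ _ ↦ sq_nonneg _
  -- The parallelogram law holds term by term, hence for the sum, and the Jordan–von Neumann theorem
  -- supplies the inner product.
  have hparN : ∀ x y : WeightedSpace p w hw,
      ‖x + y‖ * ‖x + y‖ + ‖x - y‖ * ‖x - y‖ = 2 * (‖x‖ * ‖x‖ + ‖y‖ * ‖y‖) := fun x y ↦ by
    simp only [hn]
    rw [← (hs (x + y)).tsum_add (hs (x - y)), ← (hs x).tsum_add (hs y), ← tsum_mul_left]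
    refine tsum_congr fun m ↦ ?_
    have := hpar m x.1 y.1
    change (w m * p m (x.1 + y.1)) ^ 2 + (w m * p m (x.1 - y.1)) ^ 2 =
      2 * ((w m * p m x.1) ^ 2 + (w m * p m y.1) ^ 2)
    linear_combination w m ^ 2 * this
  let _ : InnerProductSpace 𝕜 (WeightedSpace p w hw) := InnerProductSpace.ofNorm 𝕜 hparN
  have hcomp : CompleteSpace (WeightedSpace p w hw) := by
    refine UniformSpace.complete_of_cauchySeq_tendsto fun u hu ↦ ?_
    have hu' : CauchySeq fun i ↦ (u i).1 := by
      rw [cauchySeq_iff_seminorm hp]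
      intro m ε hε
      obtain ⟨N, hN⟩ := Metric.cauchySeq_iff.1 hu (w m * ε) (mul_pos (hw m) hε)
      refine ⟨N, fun i hi j hj ↦ ?_⟩
      have h1 := hN i hi j hj
      rw [dist_eq_norm] at h1
      exact lt_of_mul_lt_mul_left ((hle m (u i - u j)).trans_lt h1) (hw m).le
    obtain ⟨x, hx⟩ := cauchySeq_tendsto_of_complete hu'
    -- Each seminorm is continuous on `E`, so bounds on finite partial sums pass to the limit in
    -- `j`. This upgrades the limit found in `E` to a limit in the stronger norm.
    have hfin : ∀ ε > 0, ∃ N, ∀ i ≥ N, ∀ s : Finset ℕ,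
        ∑ m ∈ s, (w m * p m ((u i).1 - x)) ^ 2 ≤ ε ^ 2 := by
      intro ε hε
      obtain ⟨N, hN⟩ := Metric.cauchySeq_iff.1 hu ε hε
      refine ⟨N, fun i hi s ↦ ?_⟩
      have h1 : Tendsto (fun j ↦ ∑ m ∈ s, (w m * p m ((u i).1 - (u j).1)) ^ 2) atTop
          (𝓝 (∑ m ∈ s, (w m * p m ((u i).1 - x)) ^ 2)) := by
        refine tendsto_finsetSum _ fun m _ ↦ ((Tendsto.const_mul _ ?_).pow 2)
        exact ((hp.continuous_seminorm m).tendsto _).comp (tendsto_const_nhds.sub hx)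
      refine le_of_tendsto h1 ?_
      filter_upwards [eventually_ge_atTop N] with j hj
      have h2 := hN i hi j hj
      rw [dist_eq_norm] at h2
      refine ((hs (u i - u j)).sum_le_tsum s fun _ _ ↦ sq_nonneg _).trans ?_
      rw [← hn, sq]
      gcongr
    have hmem : x ∈ weightedSubmodule p w hw := by
      obtain ⟨N, hN⟩ := hfin 1 one_pos
      have : (u N).1 - x ∈ weightedSubmodule p w hw :=
        summable_of_sum_le (fun m ↦ sq_nonneg _) (hN N le_rfl)
      have h2 := sub_mem (u N).2 this
      rwa [sub_sub_cancel] at h2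
    let z : WeightedSpace p w hw := ⟨x, hmem⟩
    refine ⟨z, ?_⟩
    rw [tendsto_iff_norm_sub_tendsto_zero, Metric.tendsto_atTop]
    intro ε hε
    obtain ⟨N, hN⟩ := hfin (ε / 2) (half_pos hε)
    refine ⟨N, fun i hi ↦ ?_⟩
    rw [Real.dist_eq, sub_zero, abs_norm]
    refine lt_of_le_of_lt ?_ (half_lt_self hε)
    refine Real.sqrt_le_iff.2 ⟨(half_pos hε).le, ?_⟩
    exact (hs (u i - z)).tsum_le_of_sum_le (hN i hi)
  exact ⟨WeightedSpace p w hw, inferInstance, inferInstance, hcomp,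
    (weightedSubmodule p w hw).subtype, hle,
    fun x hx h1 ↦ ⟨⟨x, hx⟩, rfl, Real.sqrt_le_one.2 h1⟩⟩

end WeightedSpace

/-- A linear functional dominated by the norm of a linear map `R` factors through `R`. -/
theorem exists_strongDual_of_norm_le {𝕜 V D : Type*} [RCLike 𝕜] [AddCommGroup V] [Module 𝕜 V]
    [SeminormedAddCommGroup D] [NormedSpace 𝕜 D]
    (R : V →ₗ[𝕜] D) (φ : V →ₗ[𝕜] 𝕜) (C : ℝ) (h : ∀ f, ‖φ f‖ ≤ C * ‖R f‖) :
    ∃ G : StrongDual 𝕜 D, ∀ f, G (R f) = φ f := by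
  have hker : LinearMap.ker R ≤ LinearMap.ker φ := fun f hf ↦ by
    have := h f
    rw [LinearMap.mem_ker.1 hf, norm_zero, mul_zero] at this
    exact norm_le_zero_iff.1 this
  let g₀ : LinearMap.range R →ₗ[𝕜] 𝕜 :=
    ((LinearMap.ker R).liftQ φ hker) ∘ₗ R.quotKerEquivRange.symm.toLinearMap
  have hg₀ : ∀ f, g₀ ⟨R f, LinearMap.mem_range_self R f⟩ = φ f := fun f ↦ by
    simp only [g₀, LinearMap.comp_apply, LinearEquiv.coe_coe]
    erw [LinearMap.quotKerEquivRange_symm_apply_image R f (LinearMap.mem_range_self R f)]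
    simp
  have hb : ∀ y, ‖g₀ y‖ ≤ C * ‖y‖ := by
    rintro ⟨_, f, rfl⟩
    rw [hg₀]
    exact h f
  -- Hahn–Banach extends the functional from the range of `R` to all of `D`.
  obtain ⟨G, hG, -⟩ := exists_extension_norm_eq (LinearMap.range R) (g₀.mkContinuous C hb)
  exact ⟨G, fun f ↦ (hG ⟨R f, LinearMap.mem_range_self R f⟩).trans (hg₀ f)⟩

/-- A linear functional on a space `V` dominated by the norm of a linear map `R` into the dual of
a Hilbert space is evaluation of `R` at a vector. -/
theorem exists_eq_apply_of_norm_le {𝕜 V H : Type*} [RCLike 𝕜] [AddCommGroup V] [Module 𝕜 V]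
    [NormedAddCommGroup H] [InnerProductSpace 𝕜 H] [CompleteSpace H]
    (R : V →ₗ[𝕜] StrongDual 𝕜 H) (φ : V →ₗ[𝕜] 𝕜) (C : ℝ) (h : ∀ f, ‖φ f‖ ≤ C * ‖R f‖) :
    ∃ z : H, ∀ f, φ f = R f z := by
  obtain ⟨G, hGR⟩ := exists_strongDual_of_norm_le R φ C h
  -- The Riesz map `toDual` is conjugate-linear; the outer conjugation makes `T₀` linear, so that it
  -- is represented by a vector in turn.
  let T₀ : H →ₗ[𝕜] 𝕜 :=
    { toFun := fun y ↦ starRingEnd 𝕜 (G (InnerProductSpace.toDual 𝕜 H y))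
      map_add' := fun y y' ↦ by simp
      map_smul' := fun c y ↦ by
        rw [map_smulₛₗ, map_smul, smul_eq_mul, map_mul, RCLike.conj_conj]; rfl }
  let T : StrongDual 𝕜 H := T₀.mkContinuous ‖G‖ fun y ↦ by
    refine (RCLike.norm_conj _).trans_le ((G.le_opNorm _).trans ?_)
    rw [LinearIsometryEquiv.norm_map]
  obtain ⟨z, hz⟩ := (InnerProductSpace.toDual 𝕜 H).surjective T
  refine ⟨z, fun f ↦ ?_⟩
  obtain ⟨y, hy⟩ := (InnerProductSpace.toDual 𝕜 H).surjective (R f)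
  have h1 : inner 𝕜 z y = starRingEnd 𝕜 (G (InnerProductSpace.toDual 𝕜 H y)) := by
    rw [← InnerProductSpace.toDual_apply_apply, hz]; rfl
  rw [← hGR, ← hy, InnerProductSpace.toDual_apply_apply, ← inner_conj_symm, h1, RCLike.conj_conj]

/-! ### Reflexivity of Fréchet spaces with Hilbertian seminorms -/

section Reflexive

variable {𝕜 : Type*} {E : Type u} [RCLike 𝕜] [AddCommGroup E] [Module 𝕜 E]
  {p : SeminormFamily 𝕜 E ℕ}

/-- Continuous functionals on the strong dual of a Fréchet space with Hilbertian seminorms are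
evaluations. -/
theorem exists_eq_eval [UniformSpace E] [IsUniformAddGroup E] [CompleteSpace E] [T2Space E]
    (hp : WithSeminorms p) (hpar : ∀ m, IsHilbertian (p m)) (φ : (E →L[𝕜] 𝕜) →L[𝕜] 𝕜) :
    ∃ x, ∀ f, φ f = f x := by
  have h0 : {f : E →L[𝕜] 𝕜 | ‖φ f‖ < 1} ∈ 𝓝 0 := by
    have := φ.continuous.norm.tendsto 0
    rw [map_zero, norm_zero] at this
    exact this.eventually (gt_mem_nhds one_pos)
  obtain ⟨⟨B, V⟩, ⟨hB, hV⟩, hBV⟩ := ContinuousLinearMap.hasBasis_nhds_zero.mem_iff.1 h0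
  obtain ⟨ε, hε, hεV⟩ := Metric.mem_nhds_iff.1 hV
  choose r hr hrB using (hp.isVonNBounded_iff_seminorm_bounded.1 hB)
  -- The weights make `B` a subset of the unit ball of a Hilbert space.
  let w : ℕ → ℝ := fun m ↦ √(1 / 2 / 2 ^ m) / r m
  have hw : ∀ m, 0 < w m := fun m ↦ div_pos (Real.sqrt_pos.2 (by positivity)) (hr m)
  obtain ⟨H, _, _, _, ι, hι, hball⟩ := exists_hilbertSpace p w hp hpar hw
  have hBH : ∀ x ∈ B, ∃ h, ι h = x ∧ ‖h‖ ≤ 1 := by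
    intro x hx
    -- On `B` one has `p m x < r m`, and the bounds `1 / 2 / 2 ^ m` add up to exactly `1`, the
    -- radius of the ball.
    have hle : ∀ m, (w m * p m x) ^ 2 ≤ 1 / 2 / 2 ^ m := fun m ↦ by
      have h1 : w m * p m x ≤ √(1 / 2 / 2 ^ m) := by
        calc w m * p m x ≤ w m * r m := by
              have := hw m
              gcongr
              exact (hrB m x hx).le
          _ = _ := by simp only [w]; field_simp [(hr m).ne']
      calc (w m * p m x) ^ 2 ≤ √(1 / 2 / 2 ^ m) ^ 2 := by
            have := hw m
            gcongr
        _ = _ := Real.sq_sqrt (by positivity)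
    have hs : Summable fun m ↦ (w m * p m x) ^ 2 :=
      (summable_geometric_two' 1).of_nonneg_of_le (fun m ↦ sq_nonneg _) hle
    exact hball x hs ((hs.tsum_le_tsum hle (summable_geometric_two' 1)).trans_eq
      (tsum_geometric_two' 1))
  have hιc : ∀ f : E →L[𝕜] 𝕜, ∃ C, ∀ h, ‖f (ι h)‖ ≤ C * ‖h‖ := by
    intro f
    obtain ⟨s, C, -, hC⟩ := Seminorm.bound_of_continuous hp (f.toSeminorm) f.continuous.norm
    refine ⟨C * ∑ m ∈ s, (w m)⁻¹, fun h ↦ ?_⟩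
    have h1 := hC (ι h)
    refine h1.trans ?_
    have h2 : s.sup p (ι h) ≤ ∑ m ∈ s, p m (ι h) := by
      have := Seminorm.le_def.1 (Seminorm.finset_sup_le_sum p s) (ι h)
      simpa using this
    simp only [smul_apply, NNReal.smul_def, smul_eq_mul]
    rw [mul_assoc, Finset.sum_mul]
    gcongr
    refine h2.trans (Finset.sum_le_sum fun m _ ↦ ?_)
    rw [inv_mul_eq_div, le_div_iff₀ (hw m), mul_comm]
    exact hι m h
  choose C hC using hιc
  let R : (E →L[𝕜] 𝕜) →ₗ[𝕜] StrongDual 𝕜 H :=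
    { toFun := fun f ↦ (f.toLinearMap ∘ₗ ι).mkContinuous (C f) (hC f)
      map_add' := fun f g ↦ by ext h; simp
      map_smul' := fun c f ↦ by ext h; simp }
  -- A functional whose restriction to `H` has norm below `ε` is below `ε` on the whole of `B`,
  -- because `B` lies in the image of the unit ball.
  have hRB : ∀ f, ‖R f‖ < ε → ‖φ f‖ < 1 := by
    intro f hf
    refine hBV fun x hx ↦ hεV ?_
    obtain ⟨h, rfl, h1⟩ := hBH x hx
    rw [mem_ball_zero_iff]
    calc ‖f (ι h)‖ = ‖R f h‖ := rfl
      _ ≤ ‖R f‖ * ‖h‖ := (R f).le_opNorm h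
      _ ≤ ‖R f‖ * 1 := by gcongr
      _ < ε := by rwa [mul_one]
  have hφ : ∀ f, ‖φ f‖ ≤ ε⁻¹ * ‖R f‖ := by
    intro f
    refine le_of_forall_pos_le_add fun δ hδ ↦ ?_
    -- The bound follows by homogeneity; the summand `δ` keeps the scaling factor positive even when
    -- `R f = 0`.
    set t : ℝ := ε⁻¹ * ‖R f‖ + δ with ht
    have htpos : 0 < t := by positivity
    have h1 : ‖R (((t : 𝕜)⁻¹) • f)‖ < ε := by
      rw [map_smul, norm_smul, norm_inv, RCLike.norm_ofReal, abs_of_pos htpos, inv_mul_eq_div,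
        div_lt_iff₀ htpos, ht, mul_add, mul_inv_cancel_left₀ hε.ne']
      exact lt_add_of_pos_right _ (by positivity)
    have h2 := hRB _ h1
    rw [map_smul, norm_smul, norm_inv, RCLike.norm_ofReal, abs_of_pos htpos, inv_mul_eq_div,
        div_lt_iff₀ htpos, one_mul] at h2
    exact h2.le
  obtain ⟨z, hz⟩ := exists_eq_apply_of_norm_le R φ.toLinearMap ε⁻¹ hφ
  exact ⟨ι z, hz⟩

/-- Hahn–Banach in the seminormed space that `E` becomes under `q` alone; continuity for the
original topology plays no part here. -/
theorem exists_dual_le_seminorm (q : Seminorm 𝕜 E) (x : E) :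
    ∃ f : E →ₗ[𝕜] 𝕜, (∀ y, ‖f y‖ ≤ q y) ∧ ‖f x‖ = q x := by
  let _ : SeminormedAddCommGroup E := q.toAddGroupSeminorm.toSeminormedAddCommGroup
  let _ : NormedSpace 𝕜 E := ⟨fun c y ↦ (map_smul_eq_mul q c y).le⟩
  obtain ⟨g, hg, hgx⟩ := exists_dual_vector'' 𝕜 x
  refine ⟨g.toLinearMap, fun y ↦ (g.le_of_opNorm_le hg y).trans_eq (one_mul _), ?_⟩
  change ‖g x‖ = q x
  rw [hgx, RCLike.norm_ofReal]
  exact abs_of_nonneg (apply_nonneg q x)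

/-- The Hilbertian property enters only through surjectivity (`exists_eq_eval`). Injectivity and the
two continuity statements hold for any Fréchet space. -/
theorem isReflexive_of_isHilbertian [UniformSpace E] [IsUniformAddGroup E] [CompleteSpace E]
    [T2Space E] (hp : WithSeminorms p) (hpar : ∀ m, IsHilbertian (p m)) : IsReflexive 𝕜 E := by
  have := hp.continuousSMul
  have := hp.toPolynormableSpace
  have := hp.firstCountableTopology
  have : (uniformity E).IsCountablyGenerated := IsUniformAddGroup.uniformity_countably_generated
  let ev : E → ((E →L[𝕜] 𝕜) →L[𝕜] 𝕜) := fun x ↦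
    { toFun := fun f ↦ f x
      map_add' := fun _ _ ↦ rfl
      map_smul' := fun _ _ ↦ rfl
      cont := continuous_eval_const x }
  let J : E →ₗ[𝕜] ((E →L[𝕜] 𝕜) →L[𝕜] 𝕜) :=
    { toFun := ev
      map_add' := fun x y ↦ by ext f; exact map_add f x y
      map_smul' := fun c x ↦ by ext f; exact map_smul f c x }
  have hHB : ∀ m x, ∃ f : E →L[𝕜] 𝕜, (∀ y, ‖f y‖ ≤ p m y) ∧ ‖f x‖ = p m x := by
    intro m x
    obtain ⟨f, hf, hfx⟩ := exists_dual_le_seminorm (p m) x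
    exact ⟨⟨f, hp.continuous_normedSpace_rng 𝕜 f ⟨{m}, 1, fun y ↦ by simpa using hf y⟩⟩, hf, hfx⟩
  have hJinj : Function.Injective J := by
    refine (injective_iff_map_eq_zero J).2 fun x hx ↦ ?_
    by_contra h
    obtain ⟨m, hm⟩ := hp.separating_of_T1 x h
    obtain ⟨f, -, hf⟩ := hHB m x
    rw [← hf] at hm
    have h2 : f x = 0 := DFunLike.congr_fun hx f
    simp [h2] at hm
  have hJsurj : Function.Surjective J := fun φ ↦ by
    obtain ⟨x, hx⟩ := exists_eq_eval hp hpar φ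
    exact ⟨x, by ext f; exact (hx f).symm⟩
  let e := LinearEquiv.ofBijective J ⟨hJinj, hJsurj⟩
  refine ⟨⟨e, ?_, ?_⟩, fun x f ↦ rfl⟩
  · change Continuous J
    have : ContinuousAdd ((E →L[𝕜] 𝕜) →L[𝕜] 𝕜) :=
      (inferInstance : IsTopologicalAddGroup ((E →L[𝕜] 𝕜) →L[𝕜] 𝕜)).toContinuousAdd
    refine continuous_of_continuousAt_zero J.toAddMonoidHom ?_
    change ContinuousAt J 0
    rw [ContinuousAt, map_zero, ContinuousLinearMap.hasBasis_nhds_zero.tendsto_right_iff]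
    rintro ⟨S, V⟩ ⟨hS, hV⟩
    -- A strongly bounded set of functionals is pointwise bounded, and a complete space with
    -- countably generated uniformity is barrelled, so the set is equicontinuous.
    have heq : UniformEquicontinuous (DFunLike.coe ∘ (fun f : S ↦ (f : E →L[𝕜] 𝕜))) := by
      refine PolynormableSpace.banach_steinhaus fun x ↦ ?_
      have := hS.image (ev x)
      rwa [image_eq_range] at this
    obtain ⟨ε, hε, hεV⟩ := Metric.mem_nhds_iff.1 hV
    filter_upwards [heq.equicontinuous 0 _ (Metric.dist_mem_uniformity hε)] with x hx f hf
    refine hεV ?_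
    have h2 := hx ⟨f, hf⟩
    change dist (f x) 0 < ε
    rw [dist_comm]
    simpa using h2
  · change Continuous e.symm
    have : ContinuousAdd ((E →L[𝕜] 𝕜) →L[𝕜] 𝕜) :=
      (inferInstance : IsTopologicalAddGroup ((E →L[𝕜] 𝕜) →L[𝕜] 𝕜)).toContinuousAdd
    refine continuous_of_continuousAt_zero e.symm.toAddMonoidHom ?_
    change ContinuousAt e.symm 0
    rw [ContinuousAt, map_zero, hp.tendsto_nhds]
    intro m ε hε
    -- The polar of the unit ball of `p m` is strongly bounded, so being small on it is a
    -- neighbourhood condition in the bidual. By Hahn–Banach, `p m x` is attained as `‖f x‖` for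
    -- some `f` in this polar.
    have hS : Bornology.IsVonNBounded 𝕜 {f : E →L[𝕜] 𝕜 | ∀ y, ‖f y‖ ≤ p m y} := by
      refine ContinuousLinearMap.isVonNBounded_iff.2 fun s hs ↦ ?_
      obtain ⟨r, -, hr⟩ := hp.isVonNBounded_iff_seminorm_bounded.1 hs m
      refine NormedSpace.isVonNBounded_of_isBounded 𝕜 (isBounded_iff_forall_norm_le.2 ⟨r, ?_⟩)
      rintro _ ⟨f, hf, y, hy, rfl⟩
      exact (hf y).trans (hr y hy).le
    filter_upwards [ContinuousLinearMap.hasBasis_nhds_zero.mem_of_mem (i := (_, Metric.ball 0 ε))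
      ⟨hS, Metric.ball_mem_nhds 0 hε⟩] with Φ hΦ
    obtain ⟨f, hf, hfx⟩ := hHB m (e.symm Φ)
    have h1 : f (e.symm Φ) = Φ f := DFunLike.congr_fun (e.apply_symm_apply Φ) f
    rw [sub_zero, ← hfx, h1]
    simpa using hΦ f hf

end Reflexive

/-! ### Quotients by closed subspaces -/

section Quotient

variable {𝕜 E : Type*} [RCLike 𝕜] [AddCommGroup E] [Module 𝕜 E]

theorem exists_mkQ_eq_lt (p : Seminorm 𝕜 E) (N : Submodule 𝕜 E) (x : E ⧸ N) {δ : ℝ} (hδ : 0 < δ) :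
    ∃ y, N.mkQ y = x ∧ p y < sInf (p '' {y | N.mkQ y = x}) + δ := by
  have hne : (p '' {y | N.mkQ y = x}).Nonempty := by
    obtain ⟨y, hy⟩ := N.mkQ_surjective x
    exact ⟨_, y, hy, rfl⟩
  obtain ⟨_, ⟨y, hy, rfl⟩, h⟩ := exists_lt_of_csInf_lt hne (lt_add_of_pos_right _ hδ)
  exact ⟨y, hy, h⟩

theorem sInf_mkQ_le (p : Seminorm 𝕜 E) (N : Submodule 𝕜 E) (y : E) :
    sInf (p '' {z | N.mkQ z = N.mkQ y}) ≤ p y :=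
  csInf_le ⟨0, by rintro _ ⟨z, -, rfl⟩; exact apply_nonneg p z⟩ ⟨y, rfl, rfl⟩

/-- The quotient seminorm. -/
noncomputable def quotientSeminorm (p : Seminorm 𝕜 E) (N : Submodule 𝕜 E) : Seminorm 𝕜 (E ⧸ N) :=
  Seminorm.ofSMulLE (fun x ↦ sInf (p '' {y | N.mkQ y = x}))
    (by
      refine le_antisymm ?_ (Real.sInf_nonneg ?_)
      · simpa using sInf_mkQ_le p N 0
      · rintro _ ⟨z, -, rfl⟩; exact apply_nonneg p z)
    (fun x y ↦ by
      refine le_of_forall_pos_le_add fun δ hδ ↦ ?_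
      obtain ⟨a, rfl, ha⟩ := exists_mkQ_eq_lt p N x (half_pos hδ)
      obtain ⟨b, rfl, hb⟩ := exists_mkQ_eq_lt p N y (half_pos hδ)
      have h1 := sInf_mkQ_le p N (a + b)
      have h2 := map_add_le_add p a b
      rw [map_add] at h1
      linarith)
    (fun c x ↦ by
      refine le_of_forall_pos_le_add fun δ hδ ↦ ?_
      obtain ⟨a, rfl, ha⟩ := exists_mkQ_eq_lt p N x (δ := δ / (‖c‖ + 1)) (by positivity)
      have h1 := sInf_mkQ_le p N (c • a)
      rw [map_smul, map_smul_eq_mul] at h1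
      refine h1.trans ((mul_le_mul_of_nonneg_left ha.le (norm_nonneg c)).trans ?_)
      rw [mul_add]
      gcongr
      rw [mul_div_assoc', div_le_iff₀ (by positivity)]
      nlinarith [norm_nonneg c])

theorem exists_lt_quotientSeminorm (p : Seminorm 𝕜 E) (N : Submodule 𝕜 E) (x : E ⧸ N) {δ : ℝ}
    (hδ : 0 < δ) : ∃ y, N.mkQ y = x ∧ p y < quotientSeminorm p N x + δ :=
  exists_mkQ_eq_lt p N x hδ

theorem quotientSeminorm_mkQ_le (p : Seminorm 𝕜 E) (N : Submodule 𝕜 E) (y : E) :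
    quotientSeminorm p N (N.mkQ y) ≤ p y :=
  sInf_mkQ_le p N y

/-- No minimizer or orthogonal complement is needed. The inequality `≤` in the parallelogram law
passes to infima through near-minimizers, and `≤` applied to `x + y` and `x - y` gives the reverse
inequality. -/
theorem IsHilbertian.quotientSeminorm {p : Seminorm 𝕜 E} (hp : IsHilbertian p)
    (N : Submodule 𝕜 E) : IsHilbertian (quotientSeminorm p N) := by
  set q := ConormalDistributions.quotientSeminorm p N
  have key : ∀ x y, q (x + y) ^ 2 + q (x - y) ^ 2 ≤ 2 * (q x ^ 2 + q y ^ 2) := by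
    intro x y
    have h1 : ∀ δ > 0, q (x + y) ^ 2 + q (x - y) ^ 2 ≤ 2 * ((q x + δ) ^ 2 + (q y + δ) ^ 2) := by
      intro δ hδ
      obtain ⟨a, rfl, ha⟩ := exists_lt_quotientSeminorm p N x hδ
      obtain ⟨b, rfl, hb⟩ := exists_lt_quotientSeminorm p N y hδ
      rw [← map_add, ← map_sub]
      calc _ ≤ p (a + b) ^ 2 + p (a - b) ^ 2 := by
            gcongr
            · exact quotientSeminorm_mkQ_le p N _
            · exact quotientSeminorm_mkQ_le p N _
        _ = 2 * (p a ^ 2 + p b ^ 2) := hp a b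
        _ ≤ _ := by gcongr
    have h2 : Tendsto (fun δ : ℝ ↦ 2 * ((q x + δ) ^ 2 + (q y + δ) ^ 2)) (𝓝[>] 0)
        (𝓝 (2 * ((q x + 0) ^ 2 + (q y + 0) ^ 2))) := by
      refine Tendsto.mono_left ?_ nhdsWithin_le_nhds
      exact Continuous.tendsto (by fun_prop) 0
    rw [add_zero, add_zero] at h2
    exact ge_of_tendsto h2 (eventually_mem_nhdsWithin.mono h1)
  intro x y
  refine le_antisymm (key x y) ?_
  have h := key (x + y) (x - y)
  have h2 : ∀ z, q (z + z) = 2 * q z := fun z ↦ by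
    rw [← two_smul 𝕜 z, map_smul_eq_mul, RCLike.norm_ofNat]
  rw [add_add_sub_cancel, add_sub_sub_cancel, h2, h2] at h
  nlinarith

/-- Monotonicity matters because the quotient seminorm of a supremum may exceed the supremum of the
quotient seminorms. In an increasing sequence, a finite supremum is dominated by a single member. -/
theorem withSeminorms_quotient [TopologicalSpace E] {p : SeminormFamily 𝕜 E ℕ}
    (hp : WithSeminorms p) (hmono : Monotone p) (N : Submodule 𝕜 E) :
    WithSeminorms (fun m ↦ quotientSeminorm (p m) N : SeminormFamily 𝕜 (E ⧸ N) ℕ) := by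
  have := hp.topologicalAddGroup
  have h0 : 𝓝 (0 : E ⧸ N) = map N.mkQ (𝓝 0) := QuotientAddGroup.nhds_eq N.toAddSubgroup 0
  rw [SeminormFamily.withSeminorms_iff_nhds_eq_iInf]
  refine le_antisymm (le_iInf fun m ↦ ?_) fun U hU ↦ ?_
  · rw [← tendsto_iff_comap, h0, tendsto_map'_iff]
    refine squeeze_zero (fun x ↦ apply_nonneg _ _) (fun x ↦ quotientSeminorm_mkQ_le (p m) N x) ?_
    simpa using (hp.continuous_seminorm m).tendsto 0
  · rw [h0, mem_map, hp.hasBasis_zero_ball.mem_iff] at hU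
    obtain ⟨⟨s, r⟩, hr, hU⟩ := hU
    obtain ⟨M, hM⟩ := s.bddAbove
    have hsM : s.sup p ≤ p M := Finset.sup_le fun m hm ↦ hmono (hM hm)
    refine mem_iInf_of_mem M (mem_comap.2 ⟨Iio r, Iio_mem_nhds hr, fun x hx ↦ ?_⟩)
    obtain ⟨y, rfl, hy⟩ := exists_lt_quotientSeminorm (p M) N x (sub_pos.2 hx)
    refine hU ?_
    rw [Seminorm.mem_ball_zero]
    exact (hsM y).trans_lt (hy.trans_eq (add_sub_cancel _ _))

/-- A Fréchet space whose topology is defined by an increasing sequence of Hilbertian seminorms is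
totally reflexive. -/
theorem isTotallyReflexive_of_isHilbertian [UniformSpace E] [IsUniformAddGroup E] [CompleteSpace E]
    {p : SeminormFamily 𝕜 E ℕ} (hp : WithSeminorms p) (hmono : Monotone p)
    (hpar : ∀ m, IsHilbertian (p m)) : IsTotallyReflexive 𝕜 E := by
  intro N hN
  have hq := withSeminorms_quotient hp hmono N
  have := hp.firstCountableTopology
  let _ : UniformSpace (E ⧸ N) := IsTopologicalAddGroup.rightUniformSpace (E ⧸ N)
  have : IsUniformAddGroup (E ⧸ N) := isUniformAddGroup_of_addCommGroup
  -- A quotient of a complete topological group is complete here thanks to first countability.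
  have : CompleteSpace (E ⧸ N) := QuotientAddGroup.completeSpace_right E N.toAddSubgroup
  have : T2Space (E ⧸ N) := by
    have : IsClosed (N.toAddSubgroup : Set E) := hN
    exact (inferInstance : T2Space (E ⧸ N.toAddSubgroup))
  exact isReflexive_of_isHilbertian hq fun m ↦ (hpar m).quotientSeminorm N

end Quotient

/-! ### Multiplication by Schwartz functions on Sobolev spaces of `ℝⁿ` -/

section Young

open scoped ENNReal

/-- Young's inequality for `L¹ * L² → L²`. -/
theorem lintegral_lintegral_mul_sub_sq_le {G : Type*} [AddCommGroup G] [MeasurableSpace G]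
    [MeasurableAdd₂ G] [MeasurableNeg G] (μ : Measure G) [SFinite μ] [μ.IsAddLeftInvariant]
    [μ.IsAddRightInvariant] {k F : G → ℝ≥0∞} (hk : Measurable k) (hF : Measurable F) :
    ∫⁻ x, (∫⁻ t, k t * F (x - t) ∂μ) ^ 2 ∂μ ≤ (∫⁻ t, k t ∂μ) ^ 2 * ∫⁻ x, F x ^ 2 ∂μ := by
  have hsub : Measurable fun q : G × G ↦ q.1 - q.2 := by
    simp_rw [sub_eq_add_neg]
    exact measurable_fst.add measurable_snd.neg
  have h1 : ∀ x, (∫⁻ t, k t * F (x - t) ∂μ) ^ 2 ≤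
      (∫⁻ t, k t ∂μ) * ∫⁻ t, k t * F (x - t) ^ 2 ∂μ := by
    intro x
    have hFx : Measurable fun t ↦ F (x - t) :=
      hF.comp (hsub.comp (measurable_const.prodMk measurable_id))
    -- Cauchy–Schwarz after the splitting `k = k ^ (1 / 2) * k ^ (1 / 2)`, that is, with respect to
    -- the measure `k μ`.
    have h := ENNReal.lintegral_mul_le_Lp_mul_Lq μ Real.HolderConjugate.two_two
      (f := fun t ↦ k t ^ (1 / 2 : ℝ)) (g := fun t ↦ k t ^ (1 / 2 : ℝ) * F (x - t))
      (hk.pow_const _).aemeasurable ((hk.pow_const _).mul hFx).aemeasurable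
    have e1 : ∀ t, ((fun t ↦ k t ^ (1 / 2 : ℝ)) * fun t ↦ k t ^ (1 / 2 : ℝ) * F (x - t)) t =
        k t * F (x - t) := fun t ↦ by
      simp only [Pi.mul_apply]
      rw [← mul_assoc, ← ENNReal.rpow_add_of_nonneg _ _ (by norm_num) (by norm_num)]
      norm_num
    have e2 : ∀ t, (k t ^ (1 / 2 : ℝ)) ^ (2 : ℝ) = k t := fun t ↦ by
      rw [← ENNReal.rpow_mul]; norm_num
    have e3 : ∀ t, (k t ^ (1 / 2 : ℝ) * F (x - t)) ^ (2 : ℝ) = k t * F (x - t) ^ 2 := fun t ↦ by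
      rw [ENNReal.mul_rpow_of_nonneg _ _ (by norm_num), e2, ENNReal.rpow_two]
    simp only [e1, e2, e3] at h
    refine (pow_le_pow_left' h 2).trans_eq ?_
    rw [mul_pow, ← ENNReal.rpow_natCast, ← ENNReal.rpow_natCast, ← ENNReal.rpow_mul,
      ← ENNReal.rpow_mul]
    norm_num
  calc _ ≤ ∫⁻ x, (∫⁻ t, k t ∂μ) * ∫⁻ t, k t * F (x - t) ^ 2 ∂μ ∂μ := lintegral_mono h1
    _ = (∫⁻ t, k t ∂μ) * ∫⁻ t, ∫⁻ x, k t * F (x - t) ^ 2 ∂μ ∂μ := by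
      have hm : Measurable (Function.uncurry fun x t ↦ k t * F (x - t) ^ 2) :=
        (hk.comp measurable_snd).mul ((hF.comp hsub).pow_const 2)
      have hm' : Measurable fun x ↦ ∫⁻ t, k t * F (x - t) ^ 2 ∂μ := hm.lintegral_prod_right'
      rw [lintegral_const_mul _ hm', lintegral_lintegral_swap hm.aemeasurable]
    _ = (∫⁻ t, k t ∂μ) * ∫⁻ t, k t * ∫⁻ x, F x ^ 2 ∂μ ∂μ := by
      congr 1
      refine lintegral_congr fun t ↦ ?_
      have hm : Measurable fun x ↦ F (x - t) ^ 2 :=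
        (hF.comp (hsub.comp (measurable_id.prodMk measurable_const))).pow_const 2
      rw [lintegral_const_mul _ hm,
        lintegral_sub_right_eq_self (fun x ↦ F x ^ 2) t]
    _ = _ := by
      rw [lintegral_mul_const _ hk, sq, mul_assoc]

end Young

section Multiplication

open FourierTransform

/-- Peetre's inequality. -/
theorem one_add_norm_sq_rpow_le {E : Type*} [SeminormedAddCommGroup E] (s : ℝ) (x y : E) :
    (1 + ‖x‖ ^ 2) ^ (s / 2) ≤
      2 ^ (|s| / 2) * (1 + ‖x - y‖ ^ 2) ^ (|s| / 2) * (1 + ‖y‖ ^ 2) ^ (s / 2) := by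
  have h0 : ∀ a b : E, 1 + ‖a‖ ^ 2 ≤ 2 * (1 + ‖a - b‖ ^ 2) * (1 + ‖b‖ ^ 2) := fun a b ↦ by
    have h := norm_add_le (a - b) b
    rw [sub_add_cancel] at h
    have h2 : ‖a‖ ^ 2 ≤ (‖a - b‖ + ‖b‖) ^ 2 := by gcongr
    nlinarith [sq_nonneg (‖a - b‖ - ‖b‖), mul_nonneg (sq_nonneg ‖a - b‖) (sq_nonneg ‖b‖)]
  rcases le_total 0 s with hs | hs
  · rw [abs_of_nonneg hs, ← Real.mul_rpow (by positivity) (by positivity),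
      ← Real.mul_rpow (by positivity) (by positivity)]
    exact Real.rpow_le_rpow (by positivity) (h0 x y) (by linarith)
  · rw [abs_of_nonpos hs]
    -- For `s ≤ 0` the roles of `x` and `y` are exchanged, the power `-s / 2 ≥ 0` is taken, and the
    -- two negative powers are moved across the inequality.
    have h1 := Real.rpow_le_rpow (by positivity) (h0 y x) (show 0 ≤ -s / 2 by linarith)
    rw [Real.mul_rpow (by positivity) (by positivity),
      Real.mul_rpow (by positivity) (by positivity), norm_sub_rev] at h1
    rw [neg_div] at h1 ⊢
    rw [Real.rpow_neg (x := 1 + ‖x‖ ^ 2) (by positivity),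
      Real.rpow_neg (x := 1 + ‖y‖ ^ 2) (by positivity)] at h1
    have hx : 0 < (1 + ‖x‖ ^ 2) ^ (s / 2) := by positivity
    have hy : 0 < (1 + ‖y‖ ^ 2) ^ (s / 2) := by positivity
    rw [← div_eq_mul_inv, le_div_iff₀ hx, inv_mul_le_iff₀ hy] at h1
    rw [mul_comm]
    exact h1

variable {E : Type*} [NormedAddCommGroup E] [InnerProductSpace ℝ E]

/-- The symbol of the Bessel potential. -/
noncomputable def besselSymbol (E : Type*) [NormedAddCommGroup E] (s : ℝ) : E → ℂ :=
  fun x ↦ ((1 + ‖x‖ ^ 2) ^ (s / 2) : ℝ)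

theorem hasTemperateGrowth_besselSymbol (s : ℝ) : (besselSymbol E s).HasTemperateGrowth := by
  unfold besselSymbol; fun_prop

variable [FiniteDimensional ℝ E] [MeasurableSpace E] [BorelSpace E]

/-- Deduced from the theorem on the transform of a convolution: the square of the Fourier transform
is the reflection `x ↦ -x`, so the inverse transform of `𝓕 g * 𝓕 h` is `g h`. -/
theorem fourier_pairing_mul (g h : 𝓢(E, ℂ)) :
    𝓕 (SchwartzMap.pairing (ContinuousLinearMap.mul ℂ ℂ) g h) =
      SchwartzMap.convolution (ContinuousLinearMap.mul ℂ ℂ) (𝓕 g) (𝓕 h) := by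
  have key : ∀ (f : 𝓢(E, ℂ)) x, 𝓕 (𝓕 f) (-x) = f x := fun f x ↦ by
    have := SchwartzMap.fourierInv_apply_eq (𝓕 f)
    rw [fourierInv_fourier_eq] at this
    conv_rhs => rw [this]
    rfl
  have h1 : 𝓕⁻ (SchwartzMap.convolution (ContinuousLinearMap.mul ℂ ℂ) (𝓕 g) (𝓕 h)) =
      SchwartzMap.pairing (ContinuousLinearMap.mul ℂ ℂ) g h := by
    ext x
    rw [SchwartzMap.fourierInv_apply_eq]
    change 𝓕 (SchwartzMap.convolution (ContinuousLinearMap.mul ℂ ℂ) (𝓕 g) (𝓕 h)) (-x) = _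
    rw [SchwartzMap.fourier_convolution, SchwartzMap.pairing_apply_apply, key, key]
    rfl
  rw [← h1, fourier_fourierInv_eq]

/-- The operator `J^s g J^{-s}` on Schwartz functions, where `J^s` is the Bessel potential. -/
noncomputable def conjMul (s : ℝ) (g : 𝓢(E, ℂ)) : 𝓢(E, ℂ) →L[ℂ] 𝓢(E, ℂ) :=
  SchwartzMap.fourierMultiplierCLM ℂ (besselSymbol E s) ∘L
    SchwartzMap.smulLeftCLM ℂ (g : E → ℂ) ∘L
      SchwartzMap.fourierMultiplierCLM ℂ (besselSymbol E (-s))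

open scoped ENNReal

/-- With `⟨x⟩ = (1 + ‖x‖ ^ 2) ^ (1 / 2)`, the operator acts in frequency through `⟨x⟩^s ĝ(t) ⟨x -
t⟩^(-s) ψ̂(x - t)`, integrated in `t`. Peetre's inequality bounds the two weights by a multiple of
`⟨t⟩^|s|`, which is absorbed into `ĝ`; what remains is a convolution. -/
theorem enorm_fourier_conjMul_le (s : ℝ) (g ψ : 𝓢(E, ℂ)) (x : E) :
    ‖𝓕 (conjMul s g ψ) x‖ₑ ≤ ∫⁻ t, ENNReal.ofReal (2 ^ (|s| / 2)) *
      ‖SchwartzMap.smulLeftCLM ℂ (besselSymbol E |s|) (𝓕 g) t‖ₑ * ‖𝓕 ψ (x - t)‖ₑ := by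
  have hsym := hasTemperateGrowth_besselSymbol (E := E)
  set h := SchwartzMap.fourierMultiplierCLM ℂ (besselSymbol E (-s)) ψ with hh
  have h1 : 𝓕 (conjMul s g ψ) = SchwartzMap.smulLeftCLM ℂ (besselSymbol E s)
      (𝓕 (SchwartzMap.pairing (ContinuousLinearMap.mul ℂ ℂ) g h)) := by
    simp only [conjMul, ContinuousLinearMap.comp_apply]
    rw [SchwartzMap.fourierMultiplierCLM_apply, fourier_fourierInv_eq, ← hh]
    congr 2
    ext y
    rw [SchwartzMap.smulLeftCLM_apply_apply g.hasTemperateGrowth]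
    rfl
  have h2 : 𝓕 h = SchwartzMap.smulLeftCLM ℂ (besselSymbol E (-s)) (𝓕 ψ) := by
    rw [hh, SchwartzMap.fourierMultiplierCLM_apply, fourier_fourierInv_eq]
  rw [h1, SchwartzMap.smulLeftCLM_apply_apply (hsym s), fourier_pairing_mul,
    SchwartzMap.convolution_apply, enorm_smul, convolution_def, h2]
  refine (mul_le_mul_right (enorm_integral_le_lintegral_enorm _) _).trans ?_
  rw [← lintegral_const_mul']
  · refine lintegral_mono fun t ↦ ?_
    rw [SchwartzMap.smulLeftCLM_apply_apply (hsym _), SchwartzMap.smulLeftCLM_apply_apply (hsym _)]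
    simp only [ContinuousLinearMap.mul_apply', smul_eq_mul]
    rw [← ofReal_norm, ← ofReal_norm, ← ofReal_norm,
      ← ofReal_norm, ← ENNReal.ofReal_mul (by positivity),
      ← ENNReal.ofReal_mul (by positivity), ← ENNReal.ofReal_mul (by positivity)]
    refine ENNReal.ofReal_le_ofReal ?_
    have hp := one_add_norm_sq_rpow_le s x (x - t)
    rw [sub_sub_cancel] at hp
    have hb : ∀ r (y : E), ‖besselSymbol E r y‖ = (1 + ‖y‖ ^ 2) ^ (r / 2) := fun r y ↦ by
      rw [besselSymbol, Complex.norm_real, Real.norm_of_nonneg (by positivity)]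
    simp only [norm_mul, hb]
    have e : (1 + ‖x - t‖ ^ 2) ^ (s / 2) * (1 + ‖x - t‖ ^ 2) ^ (-s / 2) = 1 := by
      rw [← Real.rpow_add (by positivity), neg_div, add_neg_cancel, Real.rpow_zero]
    calc _ ≤ (2 ^ (|s| / 2) * (1 + ‖t‖ ^ 2) ^ (|s| / 2) * (1 + ‖x - t‖ ^ 2) ^ (s / 2)) *
          (‖𝓕 g t‖ * ((1 + ‖x - t‖ ^ 2) ^ (-s / 2) * ‖𝓕 ψ (x - t)‖)) := by gcongr
      _ = 2 ^ (|s| / 2) * ((1 + ‖t‖ ^ 2) ^ (|s| / 2) * ‖𝓕 g t‖) * ‖𝓕 ψ (x - t)‖ *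
          ((1 + ‖x - t‖ ^ 2) ^ (s / 2) * (1 + ‖x - t‖ ^ 2) ^ (-s / 2)) := by ring
      _ = _ := by rw [e, mul_one]
  · exact enorm_ne_top

theorem norm_toLp_eq_eLpNorm_fourier (φ : 𝓢(E, ℂ)) :
    ‖φ.toLp 2 volume‖ = (eLpNorm (⇑(𝓕 φ : 𝓢(E, ℂ))) 2 volume).toReal := by
  rw [← Lp.norm_fourier_eq, SchwartzMap.toLp_fourier_eq, SchwartzMap.norm_toLp]

theorem eLpNorm_two_eq_lintegral {f : E → ℂ} :
    eLpNorm f 2 volume = (∫⁻ x, ‖f x‖ₑ ^ 2) ^ (1 / 2 : ℝ) := by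
  rw [eLpNorm_eq_lintegral_rpow_enorm_toReal (by norm_num) (by norm_num)]
  simp

theorem eLpNorm_two_le_of_enorm_le_lintegral {k : E → ℝ≥0∞} (hk : Measurable k) {f h : E → ℂ}
    (hh : Continuous h) (hf : ∀ x, ‖f x‖ₑ ≤ ∫⁻ t, k t * ‖h (x - t)‖ₑ) :
    eLpNorm f 2 volume ≤ (∫⁻ t, k t) * eLpNorm h 2 volume := by
  have hy := lintegral_lintegral_mul_sub_sq_le volume hk
    (F := fun y ↦ ‖h y‖ₑ) hh.enorm.measurable
  rw [eLpNorm_two_eq_lintegral, eLpNorm_two_eq_lintegral]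
  calc _ ≤ ((∫⁻ t, k t) ^ 2 * ∫⁻ x, ‖h x‖ₑ ^ 2) ^ (1 / 2 : ℝ) := by
        refine ENNReal.rpow_le_rpow ?_ (by norm_num)
        refine le_trans (lintegral_mono fun x ↦ ?_) hy
        exact pow_le_pow_left' (hf x) 2
    _ = _ := by
      rw [ENNReal.mul_rpow_of_nonneg _ _ (by norm_num), ← ENNReal.rpow_natCast, ← ENNReal.rpow_mul]
      norm_num

/-- The convolution kernel is a constant times the absolute value of the Schwartz function `⟨t⟩^|s|
ĝ(t)`, hence integrable. Young's inequality bounds the operator in frequency, and Plancherel's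
theorem carries the bound back. -/
theorem exists_norm_conjMul_le (s : ℝ) (g : 𝓢(E, ℂ)) :
    ∃ C : ℝ, ∀ ψ : 𝓢(E, ℂ), ‖(conjMul s g ψ).toLp 2 volume‖ ≤ C * ‖ψ.toLp 2 volume‖ := by
  obtain ⟨k, hkm, hK, h⟩ : ∃ k : E → ℝ≥0∞, Measurable k ∧ ∫⁻ t, k t ≠ ⊤ ∧
      ∀ (ψ : 𝓢(E, ℂ)) x, ‖𝓕 (conjMul s g ψ) x‖ₑ ≤ ∫⁻ t, k t * ‖𝓕 ψ (x - t)‖ₑ := by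
    refine ⟨_, ?_, ?_, enorm_fourier_conjMul_le s g⟩
    · exact measurable_const.mul (SchwartzMap.continuous _).enorm.measurable
    · rw [lintegral_const_mul' _ _ ENNReal.ofReal_ne_top]
      exact ENNReal.mul_ne_top ENNReal.ofReal_ne_top
        (SchwartzMap.integrable _).hasFiniteIntegral.ne
  refine ⟨(∫⁻ t, k t).toReal, fun ψ ↦ ?_⟩
  rw [norm_toLp_eq_eLpNorm_fourier, norm_toLp_eq_eLpNorm_fourier, ← ENNReal.toReal_mul]
  refine ENNReal.toReal_mono
    (ENNReal.mul_ne_top hK (SchwartzMap.eLpNorm_lt_top (𝓕 ψ : 𝓢(E, ℂ)) 2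
      (volume : Measure E)).ne) ?_
  exact eLpNorm_two_le_of_enorm_le_lintegral hkm (𝓕 ψ : 𝓢(E, ℂ)).continuous (h ψ)

/-- This links the `L²` bound, proved on Schwartz functions, with Bessel potentials of
distributions, so that the bound can be extended by density. -/
theorem toTemperedDistribution_conjMul (s : ℝ) (g ψ : 𝓢(E, ℂ)) :
    (conjMul s g ψ : 𝓢'(E, ℂ)) = TemperedDistribution.besselPotential E ℂ s
      (TemperedDistribution.smulLeftCLM ℂ (g : E → ℂ)
        (TemperedDistribution.besselPotential E ℂ (-s) (ψ : 𝓢'(E, ℂ)))) := by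
  have hmul : ∀ φ : 𝓢(E, ℂ), TemperedDistribution.smulLeftCLM ℂ (g : E → ℂ) (φ : 𝓢'(E, ℂ)) =
      (SchwartzMap.smulLeftCLM ℂ (g : E → ℂ) φ : 𝓢'(E, ℂ)) := fun φ ↦ by
    ext u
    simp [SchwartzMap.smulLeftCLM_apply_apply g.hasTemperateGrowth, mul_left_comm, mul_assoc]
  change _ = TemperedDistribution.fourierMultiplierCLM ℂ (besselSymbol E s)
    (TemperedDistribution.smulLeftCLM ℂ (g : E → ℂ)
      (TemperedDistribution.fourierMultiplierCLM ℂ (besselSymbol E (-s)) (ψ : 𝓢'(E, ℂ))))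
  rw [TemperedDistribution.fourierMultiplierCLM_toTemperedDistributionCLM_eq
    (hasTemperateGrowth_besselSymbol _), hmul,
    TemperedDistribution.fourierMultiplierCLM_toTemperedDistributionCLM_eq
    (hasTemperateGrowth_besselSymbol _)]
  rfl

/-- Multiplication by a Schwartz function is bounded on the Sobolev space `H^s`. -/
theorem exists_besselPotential_smulLeftCLM (s : ℝ) (g : 𝓢(E, ℂ)) :
    ∃ C : ℝ, ∀ (T : 𝓢'(E, ℂ)) (f : Lp ℂ 2 (volume : Measure E)),
      TemperedDistribution.besselPotential E ℂ s T = (f : 𝓢'(E, ℂ)) →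
      ∃ f' : Lp ℂ 2 (volume : Measure E),
        TemperedDistribution.besselPotential E ℂ s
          (TemperedDistribution.smulLeftCLM ℂ (g : E → ℂ) T) = (f' : 𝓢'(E, ℂ)) ∧
        ‖f'‖ ≤ C * ‖f‖ := by
  obtain ⟨C, hC⟩ := exists_norm_conjMul_le s g
  refine ⟨C, fun T f hT ↦ ?_⟩
  have hT' : T = TemperedDistribution.besselPotential E ℂ (-s) (f : 𝓢'(E, ℂ)) :=
    ((TemperedDistribution.besselPotential_neg_apply_eq_iff s _ _).2 hT).symm
  -- Schwartz functions approximate `f` in `L²`; the bound makes their images under `conjMul s g` a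
  -- Cauchy sequence, whose limit is the required `f'`.
  have hdense : f ∈ closure (range (SchwartzMap.toLpCLM ℝ ℂ 2 (volume : Measure E))) :=
    SchwartzMap.denseRange_toLpCLM ENNReal.ofNat_ne_top f
  obtain ⟨x, hx, hxf⟩ := mem_closure_iff_seq_limit.1 hdense
  choose ψ hψ using hx
  obtain rfl : (fun m ↦ (ψ m).toLp 2 volume) = x := funext hψ
  have hlin : ∀ m l, (conjMul s g (ψ m)).toLp 2 volume - (conjMul s g (ψ l)).toLp 2 volume =
      (conjMul s g (ψ m - ψ l)).toLp 2 (volume : Measure E) := fun m l ↦ by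
    rw [map_sub]
    exact (map_sub (SchwartzMap.toLpCLM ℝ ℂ 2 (volume : Measure E)) _ _).symm
  have hlin' : ∀ m l, (ψ m).toLp 2 volume - (ψ l).toLp 2 volume =
      (ψ m - ψ l).toLp 2 (volume : Measure E) := fun m l ↦
    (map_sub (SchwartzMap.toLpCLM ℝ ℂ 2 (volume : Measure E)) _ _).symm
  have hcauchy : CauchySeq fun m ↦ (conjMul s g (ψ m)).toLp 2 (volume : Measure E) := by
    rw [Metric.cauchySeq_iff]
    intro ε hε
    obtain ⟨N, hN⟩ := Metric.cauchySeq_iff.1 hxf.cauchySeq (ε / (|C| + 1)) (by positivity)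
    refine ⟨N, fun m hm l hl ↦ ?_⟩
    have h1 := hN m hm l hl
    rw [dist_eq_norm, hlin', lt_div_iff₀ (by positivity)] at h1
    rw [dist_eq_norm, hlin]
    refine ((hC _).trans ?_).trans_lt h1
    rw [mul_comm]
    gcongr
    linarith [le_abs_self C]
  obtain ⟨f', hf'⟩ := cauchySeq_tendsto_of_complete hcauchy
  refine ⟨f', ?_, le_of_tendsto_of_tendsto hf'.norm (hxf.norm.const_mul C)
    (Eventually.of_forall fun m ↦ hC (ψ m))⟩
  have h1 : Tendsto (fun m ↦ (((conjMul s g (ψ m)).toLp 2 (volume : Measure E) :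
      Lp ℂ 2 (volume : Measure E)) : 𝓢'(E, ℂ))) atTop (𝓝 (f' : 𝓢'(E, ℂ))) :=
    ((Lp.toTemperedDistributionCLM ℂ (volume : Measure E) 2).continuous.tendsto f').comp hf'
  have h2 : Tendsto (fun m ↦ (((ψ m).toLp 2 (volume : Measure E) :
      Lp ℂ 2 (volume : Measure E)) : 𝓢'(E, ℂ))) atTop (𝓝 (f : 𝓢'(E, ℂ))) :=
    ((Lp.toTemperedDistributionCLM ℂ (volume : Measure E) 2).continuous.tendsto f).comp hxf
  have h3 := ((TemperedDistribution.besselPotential E ℂ s ∘L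
    TemperedDistribution.smulLeftCLM ℂ (g : E → ℂ) ∘L
      TemperedDistribution.besselPotential E ℂ (-s)).continuous.tendsto (f : 𝓢'(E, ℂ))).comp h2
  simp only [Function.comp_def, ContinuousLinearMap.comp_apply, ← hT'] at h3
  -- Both sides are limits of the same sequence of tempered distributions.
  refine tendsto_nhds_unique h3 ?_
  refine h1.congr fun m ↦ ?_
  rw [Lp.toTemperedDistribution_toLp_eq, Lp.toTemperedDistribution_toLp_eq]
  exact toTemperedDistribution_conjMul s g (ψ m)

end Multiplication

/-! ### Cutoff functions and densities read in a chart -/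

section Cutoff

variable {n : ℕ} {M : Type*} [TopologicalSpace M] [ChartedSpace (EuclideanSpace ℝ (Fin n)) M]

/-- An intermediate open set `V` with closure in `U` is inserted because the closed support of `χ`,
and not only its nonvanishing set, must lie in `U`. -/
theorem exists_cutoff [IsManifold (𝓡 n) ∞ M] [T2Space M] [CompactSpace M] {s U : Set M}
    (hs : IsClosed s)
    (hU : IsOpen U) (hsU : s ⊆ U) :
    ∃ χ : C^∞⟮𝓡 n, M; 𝓘(ℝ), ℝ⟯, tsupport χ ⊆ U ∧ ∀ x ∈ s, χ x = 1 := by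
  obtain ⟨V, hV, hsV, hVU⟩ := normal_exists_closure_subset hs hU hsU
  obtain ⟨χ, h0, h1, -⟩ := exists_contMDiffMap_zero_one_of_isClosed (𝓡 n) (n := ⊤)
    hV.isClosed_compl hs (disjoint_compl_left_iff_subset.2 hsV)
  refine ⟨χ, (closure_mono fun x hx ↦ ?_).trans hVU, h1⟩
  by_contra hxV
  exact hx (h0 hxV)

variable {G : Type*} [NormedAddCommGroup G] [NormedSpace ℝ G]

/-- The function `(χ ∘ e⁻¹) · F`, extended by zero from the target of the chart `e`. -/
noncomputable def cutoffFun (e : Chart n M) (χ : C^∞⟮𝓡 n, M; 𝓘(ℝ), ℝ⟯)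
    (F : EuclideanSpace ℝ (Fin n) → G) : EuclideanSpace ℝ (Fin n) → G :=
  e.1.target.indicator fun x ↦ χ (e.1.symm x) • F x

theorem cutoffFun_eq_zero {e : Chart n M} {χ : C^∞⟮𝓡 n, M; 𝓘(ℝ), ℝ⟯}
    {F : EuclideanSpace ℝ (Fin n) → G} {x : EuclideanSpace ℝ (Fin n)}
    (hx : x ∉ e.1 '' tsupport χ) : cutoffFun e χ F x = 0 := by
  by_cases hxe : x ∈ e.1.target
  · have : χ (e.1.symm x) = 0 :=
      image_eq_zero_of_notMem_tsupport fun h ↦ hx ⟨_, h, e.1.right_inv hxe⟩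
    rw [cutoffFun, indicator_of_mem hxe, this, zero_smul]
  · rw [cutoffFun, indicator_of_notMem hxe]

theorem cutoffFun_apply_chart (e : Chart n M) {χ : C^∞⟮𝓡 n, M; 𝓘(ℝ), ℝ⟯}
    (F : EuclideanSpace ℝ (Fin n) → G) {p : M} (hp : p ∈ e.1.source) :
    cutoffFun e χ F (e.1 p) = χ p • F (e.1 p) := by
  rw [cutoffFun, indicator_of_mem (e.1.map_source hp), e.1.left_inv hp]

theorem image_tsupport_subset {e : Chart n M} {χ : C^∞⟮𝓡 n, M; 𝓘(ℝ), ℝ⟯}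
    (hχ : tsupport χ ⊆ e.1.source) : e.1 '' tsupport χ ⊆ e.1.target :=
  (image_mono hχ).trans e.1.image_source_eq_target.subset

theorem cutoffFun_eventuallyEq {e : Chart n M} {χ : C^∞⟮𝓡 n, M; 𝓘(ℝ), ℝ⟯}
    (F : EuclideanSpace ℝ (Fin n) → G) {x : EuclideanSpace ℝ (Fin n)} (hx : x ∈ e.1.target) :
    cutoffFun e χ F =ᶠ[𝓝 x] fun x ↦ χ (e.1.symm x) • F x := by
  filter_upwards [e.1.open_target.mem_nhds hx] with y hy
  exact indicator_of_mem hy _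

variable [CompactSpace M]

theorem isCompact_image_tsupport {e : Chart n M} {χ : C^∞⟮𝓡 n, M; 𝓘(ℝ), ℝ⟯}
    (hχ : tsupport χ ⊆ e.1.source) : IsCompact (e.1 '' tsupport χ) :=
  (isClosed_tsupport χ).isCompact.image_of_continuousOn (e.1.continuousOn.mono hχ)

theorem cutoffFun_eventuallyEq_zero {e : Chart n M} {χ : C^∞⟮𝓡 n, M; 𝓘(ℝ), ℝ⟯}
    (hχ : tsupport χ ⊆ e.1.source) (F : EuclideanSpace ℝ (Fin n) → G)
    {x : EuclideanSpace ℝ (Fin n)} (hx : x ∉ e.1 '' tsupport χ) :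
    cutoffFun e χ F =ᶠ[𝓝 x] fun _ ↦ 0 := by
  filter_upwards [(isCompact_image_tsupport hχ).isClosed.isOpen_compl.mem_nhds hx] with y hy
  exact cutoffFun_eq_zero hy

theorem hasCompactSupport_cutoffFun {e : Chart n M} {χ : C^∞⟮𝓡 n, M; 𝓘(ℝ), ℝ⟯}
    (hχ : tsupport χ ⊆ e.1.source) (F : EuclideanSpace ℝ (Fin n) → G) :
    HasCompactSupport (cutoffFun e χ F) :=
  HasCompactSupport.intro (isCompact_image_tsupport hχ) fun _ hx ↦ cutoffFun_eq_zero hx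

variable [IsManifold (𝓡 n) ∞ M]

theorem contDiff_cutoffFun {e : Chart n M} {χ : C^∞⟮𝓡 n, M; 𝓘(ℝ), ℝ⟯}
    (hχ : tsupport χ ⊆ e.1.source) {F : EuclideanSpace ℝ (Fin n) → G}
    (hF : ContDiffOn ℝ ∞ F e.1.target) : ContDiff ℝ ∞ (cutoffFun e χ F) := by
  refine contDiff_iff_contDiffAt.2 fun x ↦ ?_
  by_cases hx : x ∈ e.1.target
  · exact ((((SmoothDensity.contDiffOn_comp_symm χ e).smul hF).contDiffAt
      (e.1.open_target.mem_nhds hx))).congr_of_eventuallyEq (cutoffFun_eventuallyEq F hx)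
  · exact contDiffAt_const.congr_of_eventuallyEq
      (cutoffFun_eventuallyEq_zero hχ F fun h ↦ hx (image_tsupport_subset hχ h))

/-- The function `(χ ∘ e⁻¹) · F`, extended by zero, as a Schwartz function. -/
noncomputable def cutoffSchwartz (e : Chart n M) (χ : C^∞⟮𝓡 n, M; 𝓘(ℝ), ℝ⟯)
    (hχ : tsupport χ ⊆ e.1.source) (F : EuclideanSpace ℝ (Fin n) → G)
    (hF : ContDiffOn ℝ ∞ F e.1.target) : 𝓢(EuclideanSpace ℝ (Fin n), G) :=
  (hasCompactSupport_cutoffFun hχ F).toSchwartzMap (contDiff_cutoffFun hχ hF)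

variable {𝕜 : Type*} [RCLike 𝕜]

/-- The coefficient of a smooth density in a chart `e`, cut off by a smooth function supported in
the domain of `e`, as a Schwartz function. -/
noncomputable def localCoeffLinear (e : Chart n M) (χ : C^∞⟮𝓡 n, M; 𝓘(ℝ), ℝ⟯)
    (hχ : tsupport χ ⊆ e.1.source) :
    SmoothDensity 𝕜 n M →ₗ[𝕜] 𝓢(EuclideanSpace ℝ (Fin n), 𝕜) where
  toFun σ := cutoffSchwartz e χ hχ (σ.coeff e) (σ.contDiffOn_coeff e)
  map_add' σ τ := by
    ext x
    by_cases hx : x ∈ e.1.target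
    · simp [cutoffSchwartz, cutoffFun, indicator_of_mem hx]
    · simp [cutoffSchwartz, cutoffFun, indicator_of_notMem hx]
  map_smul' c σ := by
    ext x
    by_cases hx : x ∈ e.1.target
    · simp [cutoffSchwartz, cutoffFun, indicator_of_mem hx]
    · simp [cutoffSchwartz, cutoffFun, indicator_of_notMem hx]

/-- The coefficient of a smooth density in a chart `e`, cut off by a smooth function supported in
the domain of `e`, as a continuous linear map to the Schwartz space. -/
noncomputable def localCoeff (e : Chart n M) (χ : C^∞⟮𝓡 n, M; 𝓘(ℝ), ℝ⟯)
    (hχ : tsupport χ ⊆ e.1.source) :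
    SmoothDensity 𝕜 n M →L[𝕜] 𝓢(EuclideanSpace ℝ (Fin n), 𝕜) where
  toLinearMap := localCoeffLinear e χ hχ
  cont := by
    classical
    refine SmoothDensity.withSeminorms.continuous_of_isBounded (schwartz_withSeminorms 𝕜 _ _)
      (localCoeffLinear e χ hχ) (Seminorm.IsBounded.of_real ?_)
    rintro ⟨k, l⟩
    have hK := isCompact_image_tsupport hχ
    have hKe := image_tsupport_subset hχ
    obtain ⟨C, hC, h⟩ := exists_bound_smul (F := 𝕜) e.1.open_target hK hKe
      (SmoothDensity.contDiffOn_comp_symm χ e) l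
    obtain ⟨R, hR⟩ := hK.exists_bound_of_continuousOn (f := fun x ↦ x) continuousOn_id
    set N : Finset (SmoothDensity.SeminormIndex n M) :=
      (Finset.range (l + 1)).image fun j ↦ (⟨⟨e, _, hK, hKe⟩, j⟩ : SmoothDensity.SeminormIndex n M)
    refine ⟨N, |R| ^ k * (C * (l + 1)), fun σ ↦ ?_⟩
    refine SchwartzMap.seminorm_le_bound 𝕜 k l _ (by positivity) fun x ↦ ?_
    -- On this compact set the Schwartz weight `‖x‖ ^ k` is at most `|R| ^ k`; off it the function
    -- vanishes near `x`, and so do its derivatives.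
    by_cases hx : x ∈ e.1 '' tsupport χ
    · have h1 : ‖x‖ ≤ |R| := (hR x hx).trans (le_abs_self R)
      rw [mul_assoc]
      gcongr
      change ‖iteratedFDeriv ℝ l (cutoffFun e χ (σ.coeff e)) x‖ ≤ _
      rw [((cutoffFun_eventuallyEq (σ.coeff e) (hKe hx)).iteratedFDeriv ℝ l).self_of_nhds]
      refine (h _ (σ.contDiffOn_coeff e) x hx).trans ?_
      rw [mul_assoc]
      gcongr
      calc _ ≤ ∑ j ∈ Finset.range (l + 1), (N.sup (SmoothDensity.seminormFamily 𝕜 n M)) σ := by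
            refine Finset.sum_le_sum fun j hj ↦ ?_
            refine (σ.norm_iteratedFDeriv_le_seminorm ⟨⟨e, _, hK, hKe⟩, j⟩ hx).trans ?_
            exact Seminorm.le_def.1 (Finset.le_sup (Finset.mem_image_of_mem _ hj)) σ
        _ = _ := by simp
    · change ‖x‖ ^ k * ‖iteratedFDeriv ℝ l (cutoffFun e χ (σ.coeff e)) x‖ ≤ _
      rw [((cutoffFun_eventuallyEq_zero hχ (σ.coeff e) hx).iteratedFDeriv ℝ l).self_of_nhds]
      have : iteratedFDeriv ℝ l (fun _ : EuclideanSpace ℝ (Fin n) ↦ (0 : 𝕜)) x = 0 := by simp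
      rw [this, norm_zero, mul_zero]
      positivity

theorem localCoeff_apply_chart (e : Chart n M) (χ : C^∞⟮𝓡 n, M; 𝓘(ℝ), ℝ⟯)
    (hχ : tsupport χ ⊆ e.1.source) (σ : SmoothDensity 𝕜 n M) {p : M} (hp : p ∈ e.1.source) :
    localCoeff e χ hχ σ (e.1 p) = χ p • σ.coeff e (e.1 p) :=
  cutoffFun_apply_chart e _ hp

end Cutoff

/-! ### Localization tested on `𝕜`-valued functions -/

section Localize

variable {𝕜 : Type*} [RCLike 𝕜] {n : ℕ} {M : Type*} [TopologicalSpace M]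
  [ChartedSpace (EuclideanSpace ℝ (Fin n)) M] [IsManifold (𝓡 n) ∞ M]

/-- The smooth density `φ · (ψ ∘ e) |de|`, for a `𝕜`-valued Schwartz function `ψ`. -/
noncomputable def ofChartRCLike (e : Chart n M) (φ : C^∞⟮𝓡 n, M; 𝓘(ℝ), ℝ⟯)
    (hφ : tsupport φ ⊆ e.1.source) (ψ : 𝓢(EuclideanSpace ℝ (Fin n), 𝕜)) : SmoothDensity 𝕜 n M :=
  SmoothDensity.ofChart 𝕜 e φ hφ (SchwartzMap.postcompCLM (RCLike.reCLM (K := 𝕜)) ψ) +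
    (RCLike.I : 𝕜) •
      SmoothDensity.ofChart 𝕜 e φ hφ (SchwartzMap.postcompCLM (RCLike.imCLM (K := 𝕜)) ψ)

theorem ofChart_coeff (e : Chart n M) (φ : C^∞⟮𝓡 n, M; 𝓘(ℝ), ℝ⟯)
    (hφ : tsupport φ ⊆ e.1.source) (ψ : 𝓢(EuclideanSpace ℝ (Fin n), ℝ)) (e' : Chart n M)
    {x : EuclideanSpace ℝ (Fin n)} (hx : x ∈ e'.1.target) :
    (SmoothDensity.ofChart 𝕜 e φ hφ ψ).coeff e' x =
      ((SmoothDensity.chartDensityFun e φ ψ e' x : ℝ) : 𝕜) :=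
by
  change e'.1.target.indicator
    (fun x ↦ algebraMap ℝ 𝕜 (SmoothDensity.chartDensityFun e φ ψ e' x)) x = _
  exact indicator_of_mem hx _

theorem ofChartRCLike_coeff (e : Chart n M) (φ : C^∞⟮𝓡 n, M; 𝓘(ℝ), ℝ⟯)
    (hφ : tsupport φ ⊆ e.1.source) (ψ : 𝓢(EuclideanSpace ℝ (Fin n), 𝕜)) (e' : Chart n M)
    {x : EuclideanSpace ℝ (Fin n)} (hx : x ∈ e'.1.target) :
    (ofChartRCLike e φ hφ ψ).coeff e' x =
      ((|(fderiv ℝ (fun y ↦ e.1 (e'.1.symm y)) x).det| * φ (e'.1.symm x) : ℝ) : 𝕜) *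
        ψ (e.1 (e'.1.symm x)) := by
  rw [ofChartRCLike, SmoothDensity.add_coeff, SmoothDensity.smul_coeff, ofChart_coeff _ _ _ _ _ hx,
    ofChart_coeff _ _ _ _ _ hx]
  conv_rhs => rw [← RCLike.re_add_im (ψ (e.1 (e'.1.symm x)))]
  simp only [SmoothDensity.chartDensityFun, SchwartzMap.postcompCLM_apply, RCLike.reCLM_apply,
    RCLike.imCLM_apply, RCLike.ofReal_mul]
  ring

/-- In the real case `I` is `0` in `𝕜` but not in `ℂ`, so the identity needs `w = 0`. In the
application `w` comes from the imaginary part of a test function, which vanishes in that case. -/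
theorem rclike_map_I_mul (z : 𝕜) (w : 𝕜) (h : (RCLike.I : 𝕜) = 0 → w = 0) :
    RCLike.map 𝕜 ℂ (z + RCLike.I * w) = RCLike.map 𝕜 ℂ z + Complex.I * RCLike.map 𝕜 ℂ w := by
  rcases RCLike.I_mul_I (K := 𝕜) with h0 | h0
  · simp [h h0]
  · rw [map_add, rclike_map_mul]
    congr 2
    have h1 : RCLike.im (RCLike.I : 𝕜) = 1 :=
      RCLike.I_eq_zero_or_im_I_eq_one.resolve_left fun h2 ↦ by simp [h2] at h0
    apply Complex.ext <;> simp [h1]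

/-- For `𝕜`-valued test functions the real and imaginary parts in `localize` recombine into the
pairing of `u` with a single density. -/
theorem localize_map_comp (u : DistributionSpace 𝕜 n M) (e : Chart n M)
    (φ : C^∞⟮𝓡 n, M; 𝓘(ℝ), ℝ⟯) (hφ : tsupport φ ⊆ e.1.source)
    (ψ : 𝓢(EuclideanSpace ℝ (Fin n), 𝕜)) :
    localize u e φ hφ (SchwartzMap.postcompCLM (RCLike.map 𝕜 ℂ) ψ) =
      RCLike.map 𝕜 ℂ (u (ofChartRCLike e φ hφ ψ)) := by
  have hre : SchwartzMap.postcompCLM Complex.reCLM (SchwartzMap.postcompCLM (RCLike.map 𝕜 ℂ) ψ) =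
      SchwartzMap.postcompCLM (RCLike.reCLM (K := 𝕜)) ψ := by ext x; simp
  have him : SchwartzMap.postcompCLM Complex.imCLM (SchwartzMap.postcompCLM (RCLike.map 𝕜 ℂ) ψ) =
      SchwartzMap.postcompCLM (RCLike.imCLM (K := 𝕜)) ψ := by ext x; simp
  change RCLike.map 𝕜 ℂ (u _) + Complex.I * RCLike.map 𝕜 ℂ (u _) = _
  rw [hre, him, ofChartRCLike, map_add, map_smul, smul_eq_mul, rclike_map_I_mul]
  intro hI
  have : SchwartzMap.postcompCLM (RCLike.imCLM (K := 𝕜)) ψ = 0 := by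
    ext x
    simpa using RCLike.im_eq_zero hI (ψ x)
  rw [this, map_zero, map_zero]

end Localize

attribute [instance] SobolevAtlas.fintype

/-! ### The Sobolev spaces of the manifold: multiplication, reconstruction, completeness -/

section SobolevEstimates

variable {𝕜 : Type*} [RCLike 𝕜] {n : ℕ} {M : Type*} [TopologicalSpace M]
  [ChartedSpace (EuclideanSpace ℝ (Fin n)) M]

/-- Continuity of the limit is assumed rather than derived from uniform boundedness, since an
explicit formula for the limit is available where this is applied. -/
theorem exists_distribution_of_tendsto {u : ℕ → DistributionSpace 𝕜 n M}
    {w : SmoothDensity 𝕜 n M → 𝕜} (hu : ∀ σ, Tendsto (fun m ↦ u m σ) atTop (𝓝 (w σ)))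
    (hw : Continuous w) :
    ∃ v : DistributionSpace 𝕜 n M, ∀ σ, Tendsto (fun m ↦ u m σ) atTop (𝓝 (v σ)) :=
  ⟨{ toFun := w
     map_add' := fun σ τ ↦ tendsto_nhds_unique (hu (σ + τ))
        (((hu σ).add (hu τ)).congr fun m ↦ (map_add (u m) σ τ).symm)
     map_smul' := fun c σ ↦ tendsto_nhds_unique (hu (c • σ))
        (((hu σ).const_smul c).congr fun m ↦ (map_smul (u m) c σ).symm)
     cont := hw }, hu⟩

variable [IsManifold (𝓡 n) ∞ M]

theorem temperedDistribution_ext_real {T T' : 𝓢'(EuclideanSpace ℝ (Fin n), ℂ)}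
    (h : ∀ ψ : 𝓢(EuclideanSpace ℝ (Fin n), ℝ),
      T (SchwartzMap.postcompCLM Complex.ofRealCLM ψ) =
        T' (SchwartzMap.postcompCLM Complex.ofRealCLM ψ)) : T = T' := by
  ext ψ
  have h1 : ψ = SchwartzMap.postcompCLM Complex.ofRealCLM
      (SchwartzMap.postcompCLM Complex.reCLM ψ) +
      Complex.I • SchwartzMap.postcompCLM Complex.ofRealCLM
        (SchwartzMap.postcompCLM Complex.imCLM ψ) := by
    ext x
    simp [mul_comm Complex.I, Complex.re_add_im]
  rw [h1, map_add, map_add, map_smul, map_smul, h, h]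

theorem postcompCLM_map_ofReal (ψ : 𝓢(EuclideanSpace ℝ (Fin n), ℝ)) :
    SchwartzMap.postcompCLM (RCLike.map 𝕜 ℂ)
      (SchwartzMap.postcompCLM (RCLike.ofRealCLM (K := 𝕜)) ψ) =
    SchwartzMap.postcompCLM Complex.ofRealCLM ψ := by
  ext x
  exact rclike_map_algebraMap (ψ x)

theorem smulLeftCLM_postcompCLM_map {g ψ θ : 𝓢(EuclideanSpace ℝ (Fin n), 𝕜)}
    (h : ∀ x, θ x = g x * ψ x) :
    SchwartzMap.smulLeftCLM ℂ (SchwartzMap.postcompCLM (RCLike.map 𝕜 ℂ) g :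
      EuclideanSpace ℝ (Fin n) → ℂ) (SchwartzMap.postcompCLM (RCLike.map 𝕜 ℂ) ψ) =
      SchwartzMap.postcompCLM (RCLike.map 𝕜 ℂ) θ := by
  ext x
  rw [SchwartzMap.smulLeftCLM_apply_apply (SchwartzMap.hasTemperateGrowth _),
    SchwartzMap.postcompCLM_apply, SchwartzMap.postcompCLM_apply, SchwartzMap.postcompCLM_apply, h,
    rclike_map_mul, smul_eq_mul]

theorem mul_ofChartRCLike (f : C^∞⟮𝓡 n, M; 𝓘(ℝ, 𝕜), 𝕜⟯) (e : Chart n M)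
    (φ : C^∞⟮𝓡 n, M; 𝓘(ℝ), ℝ⟯) (hφ : tsupport φ ⊆ e.1.source)
    {ψ θ : 𝓢(EuclideanSpace ℝ (Fin n), 𝕜)} (h : ∀ p ∈ tsupport φ, θ (e.1 p) = f p * ψ (e.1 p)) :
    SmoothDensity.mul f (ofChartRCLike e φ hφ ψ) = ofChartRCLike e φ hφ θ := by
  ext e' x
  by_cases hx : x ∈ e'.1.target
  · change f (e'.1.symm x) * (ofChartRCLike e φ hφ ψ).coeff e' x = _
    rw [ofChartRCLike_coeff _ _ _ _ _ hx, ofChartRCLike_coeff _ _ _ _ _ hx]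
    by_cases hxs : e'.1.symm x ∈ tsupport φ
    · rw [h _ hxs]
      ring
    · simp [image_eq_zero_of_notMem_tsupport hxs]
  · rw [SmoothDensity.coeff_eq_zero _ _ _ hx, SmoothDensity.coeff_eq_zero _ _ _ hx]

theorem cutoffSchwartz_apply [CompactSpace M] {e : Chart n M} {χ : C^∞⟮𝓡 n, M; 𝓘(ℝ), ℝ⟯}
    {hχ : tsupport χ ⊆ e.1.source} {F : EuclideanSpace ℝ (Fin n) → 𝕜}
    {hF : ContDiffOn ℝ ∞ F e.1.target} (x : EuclideanSpace ℝ (Fin n)) :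
    cutoffSchwartz e χ hχ F hF x = cutoffFun e χ F x := rfl

/-- The function `f ∘ e⁻¹` lives only on the target of the chart. As `χ = 1` on the support of `φ`,
it may be replaced by the Schwartz function `(χ f) ∘ e⁻¹`, to which the estimates on `ℝⁿ` apply. -/
theorem localize_mulOp [CompactSpace M] (u : DistributionSpace 𝕜 n M)
    (f : C^∞⟮𝓡 n, M; 𝓘(ℝ, 𝕜), 𝕜⟯) (e : Chart n M)
    (φ χ : C^∞⟮𝓡 n, M; 𝓘(ℝ), ℝ⟯) (hφ : tsupport φ ⊆ e.1.source)
    (hχ : tsupport χ ⊆ e.1.source) (h1 : ∀ x ∈ tsupport φ, χ x = 1) :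
    localize (mulOp f u) e φ hφ = TemperedDistribution.smulLeftCLM ℂ
      (SchwartzMap.postcompCLM (RCLike.map 𝕜 ℂ) (cutoffSchwartz e χ hχ (fun x ↦ f (e.1.symm x))
        (SmoothDensity.contDiffOn_comp_symm f e)) : EuclideanSpace ℝ (Fin n) → ℂ)
      (localize u e φ hφ) := by
  refine temperedDistribution_ext_real fun ψ ↦ ?_
  obtain ⟨ψ', hψ'⟩ : ∃ ψ' : 𝓢(EuclideanSpace ℝ (Fin n), 𝕜),
    ψ' = SchwartzMap.postcompCLM (RCLike.ofRealCLM (K := 𝕜)) ψ := ⟨_, rfl⟩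
  have h2 : ∀ x, cutoffSchwartz e χ hχ (fun x ↦ f (e.1.symm x) * ψ' x)
        ((SmoothDensity.contDiffOn_comp_symm f e).mul (ψ'.smooth _).contDiffOn) x =
      cutoffSchwartz e χ hχ (fun x ↦ f (e.1.symm x))
        (SmoothDensity.contDiffOn_comp_symm f e) x * ψ' x := fun x ↦ by
    rw [cutoffSchwartz_apply, cutoffSchwartz_apply]
    by_cases hx : x ∈ e.1.target
    · simp [cutoffFun, indicator_of_mem hx]
    · simp [cutoffFun, indicator_of_notMem hx]
  rw [TemperedDistribution.smulLeftCLM_apply_apply, ← postcompCLM_map_ofReal (𝕜 := 𝕜), ← hψ',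
    smulLeftCLM_postcompCLM_map h2, localize_map_comp, localize_map_comp]
  refine congrArg (fun σ ↦ RCLike.map 𝕜 ℂ (u σ)) (mul_ofChartRCLike f e φ hφ fun p hp ↦ ?_)
  rw [cutoffSchwartz_apply, cutoffFun_apply_chart e _ (hφ hp), h1 p hp, e.1.left_inv (hφ hp),
    one_smul]

theorem tendsto_localize_of_tendsto {u : ℕ → DistributionSpace 𝕜 n M} {v : DistributionSpace 𝕜 n M}
    (hu : ∀ σ, Tendsto (fun m ↦ u m σ) atTop (𝓝 (v σ))) (e : Chart n M)
    (φ : C^∞⟮𝓡 n, M; 𝓘(ℝ), ℝ⟯) (hφ : tsupport φ ⊆ e.1.source)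
    (ψ : 𝓢(EuclideanSpace ℝ (Fin n), ℂ)) :
    Tendsto (fun m ↦ localize (u m) e φ hφ ψ) atTop (𝓝 (localize v e φ hφ ψ)) :=
  Tendsto.add (((RCLike.map 𝕜 ℂ).continuous.tendsto _).comp (hu _))
    ((((RCLike.map 𝕜 ℂ).continuous.tendsto _).comp (hu _)).const_mul _)

variable {A : SobolevAtlas n M} {s : ℝ}

/-- The choice behind `besselComponent` is harmless, because an `L²` function is determined by its
tempered distribution. -/
theorem SobolevSpace.besselComponent_eq {i : A.ι} {u : SobolevSpace 𝕜 A s}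
    {f : Lp ℂ 2 (volume : Measure (EuclideanSpace ℝ (Fin n)))}
    (h : TemperedDistribution.besselPotential (EuclideanSpace ℝ (Fin n)) ℂ s
      (localize u.1 (A.chart i) (A.partition i) (A.tsupport_subset i)) =
        (f : 𝓢'(EuclideanSpace ℝ (Fin n), ℂ))) : besselComponent i u = f := by
  have h1 := (besselComponent_spec i u).symm.trans h
  exact LinearMap.ker_eq_bot.1 (Lp.ker_toTemperedDistributionCLM_eq_bot
    (F := ℂ) (μ := (volume : Measure (EuclideanSpace ℝ (Fin n)))) (p := 2)) h1

theorem SobolevSpace.besselComponent_add (i : A.ι) (u v : SobolevSpace 𝕜 A s) :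
    besselComponent i (u + v) = besselComponent i u + besselComponent i v := by
  refine besselComponent_eq ?_
  change TemperedDistribution.besselPotential (EuclideanSpace ℝ (Fin n)) ℂ s
    (localize (u.1 + v.1) _ _ _) = Lp.toTemperedDistributionCLM ℂ volume 2 _
  rw [localize_add, map_add, map_add, besselComponent_spec, besselComponent_spec]
  rfl

theorem SobolevSpace.besselComponent_smul (i : A.ι) (c : 𝕜) (u : SobolevSpace 𝕜 A s) :
    besselComponent i (c • u) = RCLike.map 𝕜 ℂ c • besselComponent i u := by
  refine besselComponent_eq ?_
  change TemperedDistribution.besselPotential (EuclideanSpace ℝ (Fin n)) ℂ s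
    (localize (c • u.1) _ _ _) = Lp.toTemperedDistributionCLM ℂ volume 2 _
  rw [localize_smul, map_smul, map_smul, besselComponent_spec]
  rfl

/-- Convergence in `L²` implies convergence of tempered distributions, and the Bessel potential of
order `-s` is continuous on these. -/
theorem tendsto_localize_apply {u : ℕ → SobolevSpace 𝕜 A s} {i : A.ι}
    {f : Lp ℂ 2 (volume : Measure (EuclideanSpace ℝ (Fin n)))}
    (hf : Tendsto (fun m ↦ SobolevSpace.besselComponent i (u m)) atTop (𝓝 f))
    (ψ : 𝓢(EuclideanSpace ℝ (Fin n), ℂ)) :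
    Tendsto (fun m ↦ localize (u m).1 (A.chart i) (A.partition i) (A.tsupport_subset i) ψ) atTop
      (𝓝 (TemperedDistribution.besselPotential (EuclideanSpace ℝ (Fin n)) ℂ (-s)
        (f : 𝓢'(EuclideanSpace ℝ (Fin n), ℂ)) ψ)) := by
  have h1 := ((PointwiseConvergenceCLM.evalCLM (RingHom.id ℂ) ℂ ψ ∘L
    TemperedDistribution.besselPotential (EuclideanSpace ℝ (Fin n)) ℂ (-s) ∘L
      Lp.toTemperedDistributionCLM ℂ volume 2).continuous.tendsto f).comp hf
  refine h1.congr fun m ↦ ?_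
  have h2 := (TemperedDistribution.besselPotential_neg_apply_eq_iff s _ _).2
    (SobolevSpace.besselComponent_spec i (u m))
  exact DFunLike.congr_fun h2 ψ

variable [CompactSpace M] [T2Space M]

/-- The piece `ρᵢ f u` depends only on `ρᵢ u`, so the estimate stays within one chart. Producing
`f'` instead of assuming that `f u` is in `H^s(M)` yields at once that multiplication preserves
`H^s(M)` and that it is bounded. -/
theorem exists_bound_mulOp (f : C^∞⟮𝓡 n, M; 𝓘(ℝ, 𝕜), 𝕜⟯) (i : A.ι) :
    ∃ C : ℝ, ∀ u : SobolevSpace 𝕜 A s,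
      ∃ f' : Lp ℂ 2 (volume : Measure (EuclideanSpace ℝ (Fin n))),
        TemperedDistribution.besselPotential (EuclideanSpace ℝ (Fin n)) ℂ s
          (localize (mulOp f u.1) (A.chart i) (A.partition i) (A.tsupport_subset i)) =
            (f' : 𝓢'(EuclideanSpace ℝ (Fin n), ℂ)) ∧
        ‖f'‖ ≤ C * ‖SobolevSpace.besselComponent i u‖ := by
  obtain ⟨χ, hχ, h1⟩ := exists_cutoff (n := n) (isClosed_tsupport (A.partition i))
    (A.chart i).1.open_source (A.tsupport_subset i)
  obtain ⟨C, hC⟩ := exists_besselPotential_smulLeftCLM s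
    (SchwartzMap.postcompCLM (RCLike.map 𝕜 ℂ) (cutoffSchwartz (A.chart i) χ hχ
      (fun x ↦ f ((A.chart i).1.symm x)) (SmoothDensity.contDiffOn_comp_symm f (A.chart i))))
  refine ⟨C, fun u ↦ ?_⟩
  obtain ⟨f', h2, h3⟩ := hC _ _ (SobolevSpace.besselComponent_spec i u)
  refine ⟨f', ?_, h3⟩
  rw [← h2]
  exact congrArg _ (localize_mulOp u.1 f _ _ χ _ hχ h1)

theorem mulOp_mem_sobolevSubmodule (f : C^∞⟮𝓡 n, M; 𝓘(ℝ, 𝕜), 𝕜⟯) {u : DistributionSpace 𝕜 n M}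
    (hu : u ∈ sobolevSubmodule 𝕜 A s) : mulOp f u ∈ sobolevSubmodule 𝕜 A s := fun i ↦ by
  obtain ⟨C, hC⟩ := exists_bound_mulOp (A := A) (s := s) f i
  obtain ⟨f', h, -⟩ := hC ⟨u, hu⟩
  exact ⟨f', h⟩

/-- A multiplication operator on the Sobolev space is bounded in each chart. -/
theorem exists_norm_besselComponent_mulOp_le (f : C^∞⟮𝓡 n, M; 𝓘(ℝ, 𝕜), 𝕜⟯) (i : A.ι) :
    ∃ C : ℝ, ∀ u v : SobolevSpace 𝕜 A s, v.1 = mulOp f u.1 →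
      ‖SobolevSpace.besselComponent i v‖ ≤ C * ‖SobolevSpace.besselComponent i u‖ := by
  obtain ⟨C, hC⟩ := exists_bound_mulOp (A := A) (s := s) f i
  refine ⟨C, fun u v huv ↦ ?_⟩
  obtain ⟨f', h, h'⟩ := hC u
  rwa [SobolevSpace.besselComponent_eq (huv ▸ h)]

/-- A distribution is reconstructed from its pieces in the charts. -/
theorem exists_reconstruction (A : SobolevAtlas n M) :
    ∃ Γ : A.ι → SmoothDensity 𝕜 n M → 𝓢(EuclideanSpace ℝ (Fin n), ℂ), (∀ i, Continuous (Γ i)) ∧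
      ∀ (u : DistributionSpace 𝕜 n M) (σ : SmoothDensity 𝕜 n M), RCLike.map 𝕜 ℂ (u σ) =
        ∑ i, localize u (A.chart i) (A.partition i) (A.tsupport_subset i) (Γ i σ) := by
  have hχ := fun i ↦ exists_cutoff (n := n) (isClosed_tsupport (A.partition i))
    (A.chart i).1.open_source (A.tsupport_subset i)
  choose χ hχ h1 using hχ
  -- `Γ i σ` is the coefficient of `σ` in the `i`-th chart, cut off by a function equal to `1` on
  -- the support of `ρᵢ`. Localization multiplies by `ρᵢ`, so the `i`-th term pairs `u` with `ρᵢ σ`,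
  -- and these densities add up to `σ`.
  refine ⟨fun i σ ↦ SchwartzMap.postcompCLM (RCLike.map 𝕜 ℂ) (localCoeff (A.chart i) (χ i) (hχ i) σ),
    fun i ↦ (ContinuousLinearMap.continuous _).comp (ContinuousLinearMap.continuous _),
    fun u σ ↦ ?_⟩
  simp_rw [localize_map_comp, ← map_sum]
  congr 2
  ext e x
  let c : SmoothDensity 𝕜 n M →+ 𝕜 := ⟨⟨fun σ ↦ σ.coeff e x, rfl⟩, fun _ _ ↦ rfl⟩
  change _ = c _
  rw [map_sum]
  change _ = ∑ i, (ofChartRCLike _ _ _ _).coeff e x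
  by_cases hx : x ∈ e.1.target
  · have h2 : ∀ i, (ofChartRCLike (A.chart i) (A.partition i) (A.tsupport_subset i)
        (localCoeff (A.chart i) (χ i) (hχ i) σ)).coeff e x =
        ((A.partition i (e.1.symm x) : ℝ) : 𝕜) * σ.coeff e x := fun i ↦ by
      rw [ofChartRCLike_coeff _ _ _ _ _ hx]
      by_cases hxs : e.1.symm x ∈ tsupport (A.partition i)
      · have hxs' := A.tsupport_subset i hxs
        rw [localCoeff_apply_chart _ _ _ _ hxs', h1 i _ hxs, one_smul,
          σ.coeff_transition e (A.chart i) x hx hxs', RCLike.real_smul_eq_coe_mul]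
        push_cast
        ring
      · simp [image_eq_zero_of_notMem_tsupport hxs]
    simp_rw [h2, ← Finset.sum_mul]
    have h3 := A.partition.sum_eq_one (mem_univ (e.1.symm x))
    rw [finsum_eq_sum_of_fintype] at h3
    rw [← RCLike.ofReal_sum, h3]
    simp
  · simp [SmoothDensity.coeff_eq_zero _ _ _ hx]

theorem rclike_map_map (z : 𝕜) : RCLike.map ℂ 𝕜 (RCLike.map 𝕜 ℂ z) = z := by
  simp

theorem eq_zero_of_besselComponent {u : SobolevSpace 𝕜 A s}
    (h : ∀ i, SobolevSpace.besselComponent i u = 0) : u = 0 := by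
  obtain ⟨Γ, -, hΓ⟩ := exists_reconstruction (𝕜 := 𝕜) A
  refine Subtype.ext (ContinuousLinearMap.ext fun σ ↦ ?_)
  have h1 : ∀ i, localize u.1 (A.chart i) (A.partition i) (A.tsupport_subset i) = 0 := fun i ↦ by
    have h2 := SobolevSpace.besselComponent_spec i u
    rw [h i] at h2
    have h3 : ((0 : Lp ℂ 2 (volume : Measure (EuclideanSpace ℝ (Fin n)))) :
        𝓢'(EuclideanSpace ℝ (Fin n), ℂ)) = 0 :=
      map_zero (Lp.toTemperedDistributionCLM ℂ volume 2)
    rw [h3, ← TemperedDistribution.besselPotential_neg_apply_eq_iff, map_zero] at h2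
    exact h2.symm
  have h2 := hΓ u.1 σ
  simp_rw [h1] at h2
  rw [← rclike_map_map (u.1 σ), h2]
  change RCLike.map ℂ 𝕜 (∑ i, 0) = 0
  simp

/-- This is the completeness of `H^s(M)`. The `L²` limits `f i` give the tempered distributions `T i
= J^{-s} (f i)`, and `exists_reconstruction` assembles them into a distribution `v`, continuous
because the maps `Γ i` are. The pieces of `v` are the `T i` by uniqueness of limits, so no
compatibility between charts has to be checked. Pointwise convergence is recorded too, for use with
transposed operators. -/
theorem exists_tendsto_of_cauchySeq_besselComponent {u : ℕ → SobolevSpace 𝕜 A s}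
    (hu : ∀ i, CauchySeq fun m ↦ SobolevSpace.besselComponent i (u m)) :
    ∃ v : SobolevSpace 𝕜 A s, (∀ σ, Tendsto (fun m ↦ (u m).1 σ) atTop (𝓝 (v.1 σ))) ∧
      ∀ i, Tendsto (fun m ↦ SobolevSpace.besselComponent i (u m)) atTop
        (𝓝 (SobolevSpace.besselComponent i v)) := by
  obtain ⟨Γ, hΓc, hΓ⟩ := exists_reconstruction (𝕜 := 𝕜) A
  choose f hf using fun i ↦ cauchySeq_tendsto_of_complete (hu i)
  set T : A.ι → 𝓢'(EuclideanSpace ℝ (Fin n), ℂ) := fun i ↦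
    TemperedDistribution.besselPotential (EuclideanSpace ℝ (Fin n)) ℂ (-s)
      (f i : 𝓢'(EuclideanSpace ℝ (Fin n), ℂ)) with hT
  have heval : ∀ i ψ, Tendsto (fun m ↦ localize (u m).1 (A.chart i) (A.partition i)
      (A.tsupport_subset i) ψ) atTop (𝓝 (T i ψ)) := fun i ψ ↦ tendsto_localize_apply (hf i) ψ
  have hlim : ∀ σ, Tendsto (fun m ↦ (u m).1 σ) atTop
      (𝓝 (RCLike.map ℂ 𝕜 (∑ i, T i (Γ i σ)))) := fun σ ↦ by
    have h1 := ((RCLike.map ℂ 𝕜).continuous.tendsto _).comp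
      (tendsto_finsetSum Finset.univ fun i _ ↦ heval i (Γ i σ))
    refine h1.congr fun m ↦ ?_
    rw [Function.comp_apply, ← hΓ, rclike_map_map]
  obtain ⟨v, hvlim⟩ := exists_distribution_of_tendsto hlim ((RCLike.map ℂ 𝕜).continuous.comp
    (continuous_finsetSum _ fun i _ ↦ (T i).continuous.comp (hΓc i)))
  have hv : ∀ i, localize v (A.chart i) (A.partition i) (A.tsupport_subset i) = T i := fun i ↦ by
    ext ψ
    exact tendsto_nhds_unique (tendsto_localize_of_tendsto hvlim _ _ _ ψ) (heval i ψ)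
  have hv' : ∀ i, TemperedDistribution.besselPotential (EuclideanSpace ℝ (Fin n)) ℂ s
      (localize v (A.chart i) (A.partition i) (A.tsupport_subset i)) =
        (f i : 𝓢'(EuclideanSpace ℝ (Fin n), ℂ)) := fun i ↦ by
    rw [hv, ← TemperedDistribution.besselPotential_neg_apply_eq_iff]
  obtain ⟨V, rfl⟩ : ∃ V : SobolevSpace 𝕜 A s, V.1 = v := ⟨⟨v, fun i ↦ ⟨f i, hv' i⟩⟩, rfl⟩
  refine ⟨V, hvlim, fun i ↦ ?_⟩
  have h1 : SobolevSpace.besselComponent i V = f i := SobolevSpace.besselComponent_eq (hv' i)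
  rw [h1]
  exact hf i

end SobolevEstimates

/-! ### Hadamard's lemma -/

section Hadamard

open scoped Convolution

/-- The integral is the value at `0` of the convolution of the indicator of `[0, 1]` with `y ↦ b y *
H x (-y)`, and convolution with a smooth compactly supported family depends smoothly on the
parameter. The bump `b` provides the compact support without changing the integrand, being `1` on
`[-1, 1]`. -/
theorem contDiff_integral_Icc {V : Type*} [NormedAddCommGroup V] [NormedSpace ℝ V]
    {H : V → ℝ → ℝ} (hH : ContDiff ℝ ∞ fun q : V × ℝ ↦ H q.1 q.2) :
    ContDiff ℝ ∞ fun x ↦ ∫ t in Icc (0 : ℝ) 1, H x t := by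
  let b : ContDiffBump (0 : ℝ) := ⟨1, 2, one_pos, one_lt_two⟩
  let g : V → ℝ → ℝ := fun x y ↦ b y * H x (-y)
  have hg : ContDiff ℝ ∞ fun q : V × ℝ ↦ g q.1 q.2 :=
    (b.contDiff.comp contDiff_snd).mul (hH.comp (contDiff_fst.prodMk contDiff_snd.neg))
  have h := contDiffOn_convolution_right_with_param (n := ⊤) (μ := volume) (𝕜 := ℝ)
    (f := (Icc (0 : ℝ) 1).indicator fun _ ↦ (1 : ℝ))
    (ContinuousLinearMap.mul ℝ ℝ) (g := g) isOpen_univ (isCompact_closedBall (0 : ℝ) 2)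
    (fun p x _ hx ↦ by
      have : b x = 0 := by
        rw [← Function.notMem_support, b.support_eq]
        exact fun h ↦ hx (Metric.ball_subset_closedBall h)
      simp [g, this])
    ((integrable_indicator_iff measurableSet_Icc).2
      (integrableOn_const (by simp))).locallyIntegrable
    (contDiffOn_univ.2 hg |>.mono (subset_univ _))
  rw [univ_prod_univ, contDiffOn_univ] at h
  have h2 := h.comp (contDiff_id.prodMk (contDiff_const (c := (0 : ℝ))))
  convert! h2 using 1
  funext x
  simp only [Function.comp_apply, id, convolution_def]
  rw [← integral_indicator measurableSet_Icc]
  refine integral_congr_ae (Eventually.of_forall fun t ↦ ?_)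
  by_cases ht : t ∈ Icc (0 : ℝ) 1
  · have : b (0 - t) = 1 := b.one_of_mem_closedBall (by
      rw [Metric.mem_closedBall, dist_zero_right, Real.norm_eq_abs, abs_le]
      exact ⟨by simp; linarith [ht.2], by simp; linarith [ht.1]⟩)
    simp [indicator_of_mem ht, g] at this ⊢
    simp [this]
  · simp [indicator_of_notMem ht]

variable {n : ℕ}

/-- Hadamard's lemma: a smooth function which vanishes where the first `k` coordinates vanish is a
combination of these coordinates with smooth coefficients. -/
theorem exists_eq_sum_coord_mul {k : ℕ} {F : EuclideanSpace ℝ (Fin n) → ℝ} (hF : ContDiff ℝ ∞ F)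
    (h0 : ∀ x : EuclideanSpace ℝ (Fin n), (∀ j : Fin n, (j : ℕ) < k → x j = 0) → F x = 0) :
    ∃ a : Fin n → EuclideanSpace ℝ (Fin n) → ℝ, (∀ j, ContDiff ℝ ∞ (a j)) ∧
      ∀ x, F x = ∑ j : Fin n, (if (j : ℕ) < k then x j else 0) * a j x := by
  -- `Q` is the projection onto the first `k` coordinates.
  let Q : EuclideanSpace ℝ (Fin n) →L[ℝ] EuclideanSpace ℝ (Fin n) :=
    ∑ j : Fin n, if (j : ℕ) < k then
      (EuclideanSpace.proj j : EuclideanSpace ℝ (Fin n) →L[ℝ] ℝ).smulRight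
        (EuclideanSpace.single j (1 : ℝ)) else 0
  have hQ : ∀ x, Q x = ∑ j : Fin n,
      (if (j : ℕ) < k then x j else 0) • EuclideanSpace.single j (1 : ℝ) :=
    fun x ↦ by
      rw [sum_apply]
      refine Finset.sum_congr rfl fun j _ ↦ ?_
      split_ifs <;> simp
  have hQk : ∀ x (j : Fin n), (j : ℕ) < k → Q x j = x j := fun x j hj ↦ by
    rw [hQ, WithLp.ofLp_sum, Finset.sum_apply, Finset.sum_eq_single j]
    · simp [hj]
    · intro c _ hc
      split_ifs <;> simp [hc.symm]
    · simp
  -- The segment from `x - Q x`, where `F` vanishes, to `x`. Integrating the derivative of `F` along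
  -- it, in the direction `Q x`, exhibits the coefficients as averages of partial derivatives.
  let γ : EuclideanSpace ℝ (Fin n) → ℝ → EuclideanSpace ℝ (Fin n) := fun x t ↦ x - Q x + t • Q x
  have hγ : ContDiff ℝ ∞ fun q : EuclideanSpace ℝ (Fin n) × ℝ ↦ γ q.1 q.2 :=
    (contDiff_fst.sub (Q.contDiff.comp contDiff_fst)).add
      (contDiff_snd.smul (Q.contDiff.comp contDiff_fst))
  have hH : ∀ j, ContDiff ℝ ∞ fun q : EuclideanSpace ℝ (Fin n) × ℝ ↦
      fderiv ℝ F (γ q.1 q.2) (EuclideanSpace.single j 1) := fun j ↦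
    ((hF.fderiv_right (m := ∞) (by norm_cast)).comp hγ).clm_apply contDiff_const
  refine ⟨fun j x ↦ ∫ t in Icc (0 : ℝ) 1, fderiv ℝ F (γ x t) (EuclideanSpace.single j 1),
    fun j ↦ contDiff_integral_Icc (hH j), fun x ↦ ?_⟩
  have hd : ∀ t, HasDerivAt (fun t ↦ F (γ x t)) (fderiv ℝ F (γ x t) (Q x)) t := fun t ↦ by
    have h1 : HasDerivAt (γ x) (Q x) t := by
      have h2 := ((hasDerivAt_id t).smul_const (Q x)).const_add (x - Q x)
      rw [one_smul] at h2
      exact h2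
    exact ((hF.differentiable (by simp)) (γ x t)).hasFDerivAt.comp_hasDerivAt t h1
  have hc : ∀ v, Continuous fun t ↦ fderiv ℝ F (γ x t) v := fun v ↦
    ((hF.continuous_fderiv (by simp)).comp
      (hγ.continuous.comp (continuous_const.prodMk continuous_id))).clm_apply continuous_const
  have h1 := intervalIntegral.integral_eq_sub_of_hasDerivAt (a := 0) (b := 1)
    (fun t _ ↦ hd t) ((hc _).intervalIntegrable _ _)
  have h2 : F (γ x 0) = 0 := h0 _ fun j hj ↦ by simp [γ, hQk x j hj]
  have h3 : γ x 1 = x := by simp [γ]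
  rw [h2, h3, sub_zero, intervalIntegral.integral_of_le zero_le_one,
    ← integral_Icc_eq_integral_Ioc] at h1
  rw [← h1]
  simp_rw [hQ, map_sum, map_smul, smul_eq_mul]
  rw [integral_finsetSum]
  · simp_rw [integral_const_mul]
  · intro j _
    exact ((hc _).const_mul _).integrableOn_Icc

end Hadamard

/-! ### Vector fields with prescribed components in a chart -/

section ChartFields

variable {n : ℕ} {M : Type*} [TopologicalSpace M] [ChartedSpace (EuclideanSpace ℝ (Fin n)) M]
  [IsManifold (𝓡 n) ∞ M]

/-- The function `ρ · (F ∘ e)`, where `ρ` is supported in the domain of the chart `e`. -/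
noncomputable def mulChartFun (e : Chart n M) (ρ : C^∞⟮𝓡 n, M; 𝓘(ℝ), ℝ⟯)
    (hρ : tsupport ρ ⊆ e.1.source) (F : EuclideanSpace ℝ (Fin n) → ℝ)
    (hF : ContDiffOn ℝ ∞ F e.1.target) : C^∞⟮𝓡 n, M; 𝓘(ℝ), ℝ⟯ :=
  ⟨fun p ↦ ρ p * F (e.1 p), by
    refine contMDiff_of_tsupport fun p hp ↦ ?_
    have hpe : p ∈ e.1.source := hρ (closure_mono (fun q hq ↦ left_ne_zero_of_mul hq) hp)
    refine ContMDiffAt.mul ρ.contMDiff.contMDiffAt ?_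
    exact ((hF.contDiffAt (e.1.open_target.mem_nhds (e.1.map_source hpe))).contMDiffAt).comp p
      (contMDiffAt_of_mem_maximalAtlas e.2 hpe)⟩

/-- The derivative of the inverse of the chart `e`, as a map from `ℝⁿ` to the tangent space at
`p`. -/
noncomputable def chartPush (e : Chart n M) (p : M) :
    EuclideanSpace ℝ (Fin n) →L[ℝ] TangentSpace (𝓡 n) p :=
  (mfderiv (𝓡 n) (𝓡 n) e.1.symm (e.1 p) :
    TangentSpace (𝓡 n) (e.1 p) →L[ℝ] TangentSpace (𝓡 n) (e.1.symm (e.1 p)))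

theorem chartPush_vectorCoeff (e : Chart n M) (X : SmoothVectorField n M) {p : M}
    (hp : p ∈ e.1.source) : chartPush e p (vectorCoeff e X (e.1 p)) = X p := by
  unfold vectorCoeff chartPush
  have h1 : MDifferentiableAt (𝓡 n) (𝓡 n) e.1 p :=
    (contMDiffAt_of_mem_maximalAtlas e.2 hp).mdifferentiableAt (by simp)
  have h2 : MDifferentiableAt (𝓡 n) (𝓡 n) e.1.symm (e.1 p) :=
    (contMDiffAt_symm_of_mem_maximalAtlas e.2 (e.1.map_source hp)).mdifferentiableAt (by simp)
  have h3 := mfderiv_comp p h2 h1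
  have h4 : e.1.symm ∘ e.1 =ᶠ[𝓝 p] id := by
    filter_upwards [e.1.open_source.mem_nhds hp] with q hq
    exact e.1.left_inv hq
  rw [h4.mfderiv_eq, mfderiv_id] at h3
  rw [e.1.left_inv hp]
  exact (congrArg (fun L ↦ L (X p)) h3).symm

theorem contMDiffOn_chartPush (e : Chart n M)
    {W : EuclideanSpace ℝ (Fin n) → EuclideanSpace ℝ (Fin n)}
    (hW : ContDiffOn ℝ ∞ W e.1.target) :
    ContMDiffOn (𝓡 n) (𝓡 n).tangent ∞
      (fun p ↦ (⟨p, chartPush e p (W (e.1 p))⟩ : TangentBundle (𝓡 n) M)) e.1.source := by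
  have : IsManifold (𝓡 n) 1 M := IsManifold.of_le (n := ∞) (by norm_cast)
  have h1 := (contMDiffOn_symm_of_mem_maximalAtlas e.2).contMDiffOn_tangentMapWithin
    (m := ∞) (by norm_cast) e.1.open_target.uniqueMDiffOn
  have h2 := contMDiffOn_vectorSpace_iff_contDiffOn.2 hW
  have h3 := h1.comp (h2.comp (contMDiffOn_of_mem_maximalAtlas e.2) fun p hp ↦ e.1.map_source hp)
    fun p hp ↦ e.1.map_source hp
  refine h3.congr fun p hp ↦ ?_
  have h4 := mfderivWithin_of_isOpen (I := 𝓡 n) (I' := 𝓡 n) (f := e.1.symm) e.1.open_target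
    (e.1.map_source hp)
  have h5 : ∀ q (v : EuclideanSpace ℝ (Fin n)), q = p →
      (⟨p, v⟩ : TangentBundle (𝓡 n) M) = ⟨q, v⟩ := by rintro q v rfl; rfl
  refine (h5 _ _ (e.1.left_inv hp)).trans ?_
  simp only [Function.comp_apply, tangentMapWithin]
  rw [h4]
  rfl

/-- The vector field on `M` with components `χ · W` in the chart `e` and which is zero outside the
domain of `e`. -/
noncomputable def chartField (e : Chart n M) (χ : C^∞⟮𝓡 n, M; 𝓘(ℝ), ℝ⟯)
    (hχ : tsupport χ ⊆ e.1.source) (W : EuclideanSpace ℝ (Fin n) → EuclideanSpace ℝ (Fin n))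
    (hW : ContDiffOn ℝ ∞ W e.1.target) : SmoothVectorField n M where
  toFun p := χ p • chartPush e p (W (e.1 p))
  contMDiff_toFun :=
    ContMDiffOn.smul_section_of_tsupport χ.contMDiff.contMDiffOn e.1.open_source hχ
      (contMDiffOn_chartPush e hW)

theorem chartField_apply (e : Chart n M) (χ : C^∞⟮𝓡 n, M; 𝓘(ℝ), ℝ⟯)
    (hχ : tsupport χ ⊆ e.1.source) (W : EuclideanSpace ℝ (Fin n) → EuclideanSpace ℝ (Fin n))
    (hW : ContDiffOn ℝ ∞ W e.1.target) (p : M) :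
    chartField e χ hχ W hW p = χ p • chartPush e p (W (e.1 p)) := rfl

theorem vectorCoeff_chartField (e : Chart n M) (χ : C^∞⟮𝓡 n, M; 𝓘(ℝ), ℝ⟯)
    (hχ : tsupport χ ⊆ e.1.source) (W : EuclideanSpace ℝ (Fin n) → EuclideanSpace ℝ (Fin n))
    (hW : ContDiffOn ℝ ∞ W e.1.target) {x : EuclideanSpace ℝ (Fin n)} (hx : x ∈ e.1.target) :
    vectorCoeff e (chartField e χ hχ W hW) x = χ (e.1.symm x) • W x := by
  unfold vectorCoeff
  rw [chartField_apply]
  refine (ContinuousLinearMap.map_smul (mfderiv (𝓡 n) (𝓡 n) e.1 (e.1.symm x)) _ _).trans ?_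
  congr 1
  rw [e.1.right_inv hx]
  have h1 : MDifferentiableAt (𝓡 n) (𝓡 n) e.1.symm x :=
    (contMDiffAt_symm_of_mem_maximalAtlas e.2 hx).mdifferentiableAt (by simp)
  have h2 : MDifferentiableAt (𝓡 n) (𝓡 n) e.1 (e.1.symm x) :=
    (contMDiffAt_of_mem_maximalAtlas e.2 (e.1.map_target hx)).mdifferentiableAt (by simp)
  have h3 := mfderiv_comp x h2 h1
  have h4 : e.1 ∘ e.1.symm =ᶠ[𝓝 x] id := by
    filter_upwards [e.1.open_target.mem_nhds hx] with q hq
    exact e.1.right_inv hq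
  rw [h4.mfderiv_eq, mfderiv_id] at h3
  have h5 := (congrArg (fun L ↦ L (W x)) h3).symm
  unfold chartPush
  rw [e.1.right_inv hx]
  exact h5

end ChartFields

/-! ### Finite generation of the fields tangent to the submanifold -/

section Generators

variable {n : ℕ} {M : Type*} [TopologicalSpace M] [ChartedSpace (EuclideanSpace ℝ (Fin n)) M]
  {k : ℕ} {L : Set M}

/-- The derivative of a change of adapted coordinates preserves the tangent space of `L`. -/
theorem fderiv_transition_adapted {e e' : Chart n M} (he : IsAdaptedChart k L e)
    (he' : IsAdaptedChart k L e') {x v : EuclideanSpace ℝ (Fin n)} (hx : x ∈ e.1.target)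
    (hx' : e.1.symm x ∈ e'.1.source) (hx0 : ∀ i : Fin n, (i : ℕ) < k → x i = 0)
    (hv : ∀ i : Fin n, (i : ℕ) < k → v i = 0) {i : Fin n} (hi : (i : ℕ) < k) :
    fderiv ℝ (fun y ↦ e'.1 (e.1.symm y)) x v i = 0 := by
  have h1 := ((contDiffAt_transition e e' hx hx').differentiableAt (by simp)).hasFDerivAt
  have hγ : HasDerivAt (fun t : ℝ ↦ x + t • v) v 0 := by
    have h2 := ((hasDerivAt_id (0 : ℝ)).smul_const v).const_add x
    rw [one_smul] at h2
    exact h2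
  have h2 : HasDerivAt (fun t : ℝ ↦ e'.1 (e.1.symm (x + t • v)) i)
      (fderiv ℝ (fun y ↦ e'.1 (e.1.symm y)) x v i) 0 :=
    (EuclideanSpace.proj (𝕜 := ℝ) i).hasFDerivAt.comp_hasDerivAt (0 : ℝ)
      (h1.comp_hasDerivAt_of_eq (0 : ℝ) hγ (by simp))
  -- Near `t = 0` the chart `e` sends the line `x + t v` into `L`, where the first `k` coordinates
  -- of `e'` vanish; so the derivative along the line vanishes in these coordinates.
  have h3 : (fun t : ℝ ↦ e'.1 (e.1.symm (x + t • v)) i) =ᶠ[𝓝 0] fun _ ↦ 0 := by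
    have h4 : Tendsto (fun t : ℝ ↦ x + t • v) (𝓝 0) (𝓝 x) := by
      have := hγ.continuousAt.tendsto
      simpa using! this
    filter_upwards [h4.eventually (eventually_mem_source e e' hx hx')] with t ht
    refine (he' _ ht.2).1 ?_ i hi
    refine (he _ (e.1.map_target ht.1)).2 fun j hj ↦ ?_
    rw [e.1.right_inv ht.1]
    simp [hx0 j hj, hv j hj]
  exact h2.unique ((hasDerivAt_const (0 : ℝ) (0 : ℝ)).congr_of_eventuallyEq h3)

variable [IsManifold (𝓡 n) ∞ M]

theorem vectorCoeff_eq_zero {e : Chart n M} {X : SmoothVectorField n M} {p : M}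
    (hp : p ∈ e.1.source) (hX : X p = 0) : vectorCoeff e X (e.1 p) = 0 := by
  unfold vectorCoeff
  rw [e.1.left_inv hp, hX]
  exact map_zero (mfderiv (𝓡 n) (𝓡 n) e.1 p)

theorem isTangentTo_chartField_of_notMem {e : Chart n M} {χ : C^∞⟮𝓡 n, M; 𝓘(ℝ), ℝ⟯}
    {hχ : tsupport χ ⊆ e.1.source} {W : EuclideanSpace ℝ (Fin n) → EuclideanSpace ℝ (Fin n)}
    {hW : ContDiffOn ℝ ∞ W e.1.target} (h : ∀ p ∈ L, χ p = 0) :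
    IsTangentTo k L (chartField e χ hχ W hW) := by
  intro e' _ p hpL hp i _
  rw [vectorCoeff_eq_zero hp]
  · rfl
  · rw [chartField_apply, h p hpL, zero_smul]

/-- Tangency is required in all adapted charts, while the components are known only in `e`. On the
domain of `e` the transition derivative carries the condition over; outside it the field is zero. -/
theorem isTangentTo_chartField {e : Chart n M} (he : IsAdaptedChart k L e)
    {χ : C^∞⟮𝓡 n, M; 𝓘(ℝ), ℝ⟯}
    {hχ : tsupport χ ⊆ e.1.source} {W : EuclideanSpace ℝ (Fin n) → EuclideanSpace ℝ (Fin n)}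
    {hW : ContDiffOn ℝ ∞ W e.1.target}
    (h : ∀ x : EuclideanSpace ℝ (Fin n), (∀ i : Fin n, (i : ℕ) < k → x i = 0) →
      ∀ i : Fin n, (i : ℕ) < k → W x i = 0) :
    IsTangentTo k L (chartField e χ hχ W hW) := by
  intro e' he' p hpL hp i hi
  by_cases hpe : p ∈ e.1.source
  · have hx0 := (he p hpe).1 hpL
    have h1 := vectorCoeff_transition e e' (chartField e χ hχ W hW) (e.1.map_source hpe)
      (by rwa [e.1.left_inv hpe])
    rw [e.1.left_inv hpe] at h1
    rw [h1, vectorCoeff_chartField _ _ _ _ _ (e.1.map_source hpe)]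
    refine fderiv_transition_adapted he he' (e.1.map_source hpe) (by rwa [e.1.left_inv hpe]) hx0
      (fun j hj ↦ ?_) hi
    simp [h _ hx0 j hj]
  · rw [vectorCoeff_eq_zero hp]
    · rfl
    · rw [chartField_apply, image_eq_zero_of_notMem_tsupport fun hps ↦ hpe (hχ hps), zero_smul]

/-- The fields in `Y` generate, over the smooth functions, the products of the fields tangent to `L`
and of the smooth functions supported in `U`. -/
def GeneratesOn (k : ℕ) (L U : Set M) {J : Type} [Fintype J] (Y : J → SmoothVectorField n M) :
    Prop :=
  (∀ j, IsTangentTo k L (Y j)) ∧ ∀ X : SmoothVectorField n M, IsTangentTo k L X →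
    ∀ ρ : C^∞⟮𝓡 n, M; 𝓘(ℝ), ℝ⟯, tsupport ρ ⊆ U →
      ∃ f : J → C^∞⟮𝓡 n, M; 𝓘(ℝ), ℝ⟯, ∀ p, ρ p • X p = ∑ j, f j p • Y j p

theorem eq_sum_single (v : EuclideanSpace ℝ (Fin n)) :
    v = ∑ i, v i • EuclideanSpace.single i (1 : ℝ) := by
  conv_lhs => rw [← (EuclideanSpace.basisFun (Fin n) ℝ).sum_repr v]
  simp

variable [T2Space M] [CompactSpace M]

/-- Away from `L` tangency is no restriction. The cutoff is supported off `L`, so the cut-off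
coordinate fields vanish on `L`, and they are the coordinate fields themselves where `χ = 1`. -/
theorem exists_generatesOn_of_notMem (hL : IsClosed L) {p : M} (hp : p ∉ L) :
    ∃ U : Set M, IsOpen U ∧ p ∈ U ∧ ∃ Y : Fin n → SmoothVectorField n M,
      GeneratesOn k L U Y := by
  let e : Chart n M := ⟨chartAt _ p, IsManifold.chart_mem_maximalAtlas p⟩
  have hpe : p ∈ e.1.source := mem_chart_source _ p
  obtain ⟨V, hV, hpV, hVe⟩ := normal_exists_closure_subset (isClosed_singleton (x := p))
    (e.1.open_source.inter hL.isOpen_compl) (singleton_subset_iff.2 ⟨hpe, hp⟩)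
  obtain ⟨χ, hχ, hχ1⟩ := exists_cutoff (n := n) isClosed_closure
    (e.1.open_source.inter hL.isOpen_compl) hVe
  have hχe := hχ.trans inter_subset_left
  refine ⟨V, hV, hpV rfl, fun i ↦ chartField e χ hχe (fun _ ↦ EuclideanSpace.single i 1)
    contDiffOn_const, fun i ↦ ?_, fun X hX ρ hρ ↦ ?_⟩
  · refine isTangentTo_chartField_of_notMem fun q hq ↦ ?_
    exact image_eq_zero_of_notMem_tsupport fun h ↦ (hχ h).2 hq
  · have hρe : tsupport ρ ⊆ e.1.source := (hρ.trans subset_closure).trans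
      (hVe.trans inter_subset_left)
    refine ⟨fun i ↦ mulChartFun e ρ hρe (fun x ↦ vectorCoeff e X x i)
      (contDiffOn_euclidean.1 (contDiffOn_vectorCoeff e X) i), fun q ↦ ?_⟩
    change _ = ∑ i, (ρ q * vectorCoeff e X (e.1 q) i) •
      χ q • chartPush e q (EuclideanSpace.single i 1)
    by_cases hq : q ∈ tsupport ρ
    · rw [hχ1 q (subset_closure (hρ hq)), ← chartPush_vectorCoeff e X (hρe hq)]
      conv_lhs => rw [eq_sum_single (vectorCoeff e X (e.1 q)), map_sum, Finset.smul_sum]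
      simp_rw [map_smul, one_smul, smul_smul]
    · simp [image_eq_zero_of_notMem_tsupport hq]

end Generators

section Generators

variable {n : ℕ} {M : Type*} [TopologicalSpace M] [ChartedSpace (EuclideanSpace ℝ (Fin n)) M]
  [IsManifold (𝓡 n) ∞ M] {k : ℕ} {L : Set M} [T2Space M] [CompactSpace M]

/-- Near `L` the generators are the cut-off fields `∂ᵢ` for `i ≥ k` and `xⱼ ∂ᵢ` for `i, j < k`. The
normal components of a tangent field vanish where the first `k` coordinates do, so Hadamard's lemma
writes them as combinations of the `xⱼ`. -/
theorem exists_generatesOn_of_isAdaptedChart {e : Chart n M} (he : IsAdaptedChart k L e) {p : M}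
    (hpe : p ∈ e.1.source) :
    ∃ U : Set M, IsOpen U ∧ p ∈ U ∧ ∃ Y : Fin n ⊕ (Fin n × Fin n) → SmoothVectorField n M,
      GeneratesOn k L U Y := by
  obtain ⟨V, hV, hpV, hVe⟩ := normal_exists_closure_subset (isClosed_singleton (x := p))
    e.1.open_source (singleton_subset_iff.2 hpe)
  obtain ⟨χ, hχ, hχ1⟩ := exists_cutoff (n := n) isClosed_closure e.1.open_source hVe
  -- The index sets are padded: the fields for indices outside the ranges `i ≥ k` and `i, j < k` are
  -- zero.
  let W : Fin n ⊕ (Fin n × Fin n) → EuclideanSpace ℝ (Fin n) → EuclideanSpace ℝ (Fin n) :=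
    Sum.elim (fun i _ ↦ if (i : ℕ) < k then 0 else EuclideanSpace.single i 1)
      fun ij x ↦ (if (ij.1 : ℕ) < k then if (ij.2 : ℕ) < k then x ij.2 else 0 else 0) •
        EuclideanSpace.single ij.1 1
  have hW : ∀ l, ContDiff ℝ ∞ (W l) := by
    rintro (i | ⟨i, j⟩)
    · exact contDiff_const
    · have hj : ContDiff ℝ ∞ fun x : EuclideanSpace ℝ (Fin n) ↦ x j :=
        contDiff_euclidean.1 contDiff_id j
      have hc : ContDiff ℝ ∞ fun x : EuclideanSpace ℝ (Fin n) ↦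
          if (i : ℕ) < k then if (j : ℕ) < k then x j else 0 else 0 := by
        split_ifs
        exacts [hj, contDiff_const, contDiff_const]
      exact hc.smul contDiff_const
  refine ⟨V, hV, hpV rfl, fun l ↦ chartField e χ hχ (W l) (hW l).contDiffOn, fun l ↦ ?_,
    fun X hX ρ hρ ↦ ?_⟩
  · refine isTangentTo_chartField he fun x hx i hi ↦ ?_
    rcases l with i' | ⟨i', j'⟩
    · simp only [W, Sum.elim_inl]
      split_ifs with h
      · rfl
      · have : i ≠ i' := fun h' ↦ h (h' ▸ hi)
        simp [this]
    · simp only [W, Sum.elim_inr]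
      split_ifs with h h'
      · simp [hx j' h']
      · simp
      · simp
  · have hρe : tsupport ρ ⊆ e.1.source := (hρ.trans subset_closure).trans hVe
    have hXi := fun i ↦ contDiffOn_euclidean.1 (contDiffOn_vectorCoeff e X) i
    -- Hadamard's lemma needs a function on all of `ℝⁿ`, so the component is first multiplied by
    -- `χ`, which is `1` on the support of `ρ`. For `i ≥ k` the zero coefficients are placeholders,
    -- as the corresponding fields are zero.
    have hH : ∀ i : Fin n, ∃ a : Fin n → EuclideanSpace ℝ (Fin n) → ℝ,
        (∀ j, ContDiff ℝ ∞ (a j)) ∧ ((i : ℕ) < k → ∀ x,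
          cutoffFun e χ (fun x ↦ vectorCoeff e X x i) x =
            ∑ j : Fin n, (if (j : ℕ) < k then x j else 0) * a j x) := fun i ↦ by
      by_cases hi : (i : ℕ) < k
      · obtain ⟨a, ha, h⟩ := exists_eq_sum_coord_mul (k := k) (contDiff_cutoffFun hχ (hXi i))
          fun x hx ↦ by
            by_cases hxe : x ∈ e.1.target
            · have h1 : e.1.symm x ∈ L := (he _ (e.1.map_target hxe)).2 fun j hj ↦ by
                rw [e.1.right_inv hxe]
                exact hx j hj
              have h2 := hX e he _ h1 (e.1.map_target hxe) i hi
              rw [e.1.right_inv hxe] at h2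
              rw [cutoffFun, indicator_of_mem hxe, h2, smul_zero]
            · rw [cutoffFun, indicator_of_notMem hxe]
        exact ⟨a, ha, fun _ ↦ h⟩
      · exact ⟨fun _ _ ↦ 0, fun _ ↦ contDiff_const, fun h ↦ absurd h hi⟩
    choose a ha h using hH
    refine ⟨Sum.elim (fun i ↦ mulChartFun e ρ hρe (fun x ↦ vectorCoeff e X x i) (hXi i))
      fun ij ↦ mulChartFun e ρ hρe (a ij.1 ij.2) (ha ij.1 ij.2).contDiffOn, fun q ↦ ?_⟩
    rw [Fintype.sum_sum_type, Fintype.sum_prod_type, ← Finset.sum_add_distrib]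
    simp only [Sum.elim_inl, Sum.elim_inr, chartField_apply, W]
    change _ = ∑ i, ((ρ q * vectorCoeff e X (e.1 q) i) • χ q • chartPush e q _ +
      ∑ j, (ρ q * a i j (e.1 q)) • χ q • chartPush e q _)
    by_cases hq : q ∈ tsupport ρ
    · have hqe := hρe hq
      have hχq := hχ1 q (subset_closure (hρ hq))
      rw [hχq, ← chartPush_vectorCoeff e X hqe]
      conv_lhs => rw [eq_sum_single (vectorCoeff e X (e.1 q)), map_sum, Finset.smul_sum]
      refine Finset.sum_congr rfl fun i _ ↦ ?_
      simp_rw [map_smul, one_smul, smul_smul]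
      by_cases hi : (i : ℕ) < k
      · have h1 := h i hi (e.1 q)
        rw [cutoffFun_apply_chart e _ hqe, hχq, one_smul] at h1
        simp only [hi, if_true, map_zero, smul_zero, zero_add]
        rw [← Finset.sum_smul, h1, Finset.mul_sum]
        congr 1
        exact Finset.sum_congr rfl fun j _ ↦ by ring
      · simp [hi]
    · simp [image_eq_zero_of_notMem_tsupport hq]

/-- The module of the vector fields tangent to a closed submanifold of a compact manifold is
finitely generated over the smooth functions. -/
theorem exists_generators (hL : IsClosedSubmanifold n k L) :
    ∃ (m : ℕ) (Y : Fin m → SmoothVectorField n M), (∀ j, IsTangentTo k L (Y j)) ∧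
      ∀ X : SmoothVectorField n M, IsTangentTo k L X →
        ∃ f : Fin m → C^∞⟮𝓡 n, M; 𝓘(ℝ), ℝ⟯, ∀ p, X p = ∑ j, f j p • Y j p := by
  have hloc : ∀ p : M, ∃ U : Set M, IsOpen U ∧ p ∈ U ∧ ∃ (J : Type) (_ : Fintype J)
      (Y : J → SmoothVectorField n M), GeneratesOn k L U Y := fun p ↦ by
    by_cases hp : p ∈ L
    · obtain ⟨e, hpe, he⟩ := hL.exists_chart p hp
      obtain ⟨U, hU, hpU, Y, hY⟩ := exists_generatesOn_of_isAdaptedChart he hpe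
      exact ⟨U, hU, hpU, _, _, Y, hY⟩
    · obtain ⟨U, hU, hpU, Y, hY⟩ := exists_generatesOn_of_notMem (n := n) (k := k) hL.isClosed hp
      exact ⟨U, hU, hpU, _, _, Y, hY⟩
  choose U hU hpU J hJ Y hY using hloc
  obtain ⟨t, ht⟩ := isCompact_univ.elim_nhds_subcover U fun p _ ↦ (hU p).mem_nhds (hpU p)
  obtain ⟨ρ, hρ⟩ := SmoothPartitionOfUnity.exists_isSubordinate (𝓡 n) isClosed_univ
    (fun p : t ↦ U p) (fun p ↦ hU p) fun x hx ↦ by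
      obtain ⟨p, hp, hx⟩ := mem_iUnion₂.1 (ht.2 hx)
      exact mem_iUnion.2 ⟨⟨p, hp⟩, hx⟩
  let ε := (Fintype.equivFin (Σ p : t, J p)).symm
  refine ⟨_, fun l ↦ Y (ε l).1 (ε l).2, fun l ↦ (hY _).1 _, fun X hX ↦ ?_⟩
  -- `X` is the sum of the fields `ρ p • X`, each of which is a combination of the local generators
  -- over the cover set of `p`; all these expansions are put together.
  choose f hf using fun p : t ↦ (hY p).2 X hX (ρ p) (hρ p)
  refine ⟨fun l ↦ f (ε l).1 (ε l).2, fun q ↦ ?_⟩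
  rw [ε.sum_comp fun l ↦ f l.1 l.2 q • Y l.1 l.2 q, Fintype.sum_sigma]
  simp_rw [← hf, ← Finset.sum_smul]
  have h1 := ρ.sum_eq_one (mem_univ q)
  rw [finsum_eq_sum_of_fintype] at h1
  rw [h1, one_smul]

end Generators

/-! ### Normal form of the operators in `Diff(M, L)` -/

section Operators

variable {𝕜 : Type*} [RCLike 𝕜] {n : ℕ} {M : Type*} [TopologicalSpace M]
  [ChartedSpace (EuclideanSpace ℝ (Fin n)) M]

variable (𝕜) in
/-- A real smooth function, as a `𝕜`-valued function. -/
noncomputable def ofRealSmooth (f : C^∞⟮𝓡 n, M; 𝓘(ℝ), ℝ⟯) : C^∞⟮𝓡 n, M; 𝓘(ℝ, 𝕜), 𝕜⟯ :=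
  ⟨fun p ↦ (f p : 𝕜), (RCLike.ofRealCLM (K := 𝕜)).contDiff.contMDiff.comp f.contMDiff⟩

/-- The product of two smooth functions. -/
noncomputable def smoothMul (f g : C^∞⟮𝓡 n, M; 𝓘(ℝ, 𝕜), 𝕜⟯) : C^∞⟮𝓡 n, M; 𝓘(ℝ, 𝕜), 𝕜⟯ :=
  ⟨fun p ↦ f p * g p, fun p ↦
    (contDiff_mul (𝕜 := ℝ) (𝔸 := 𝕜)).contMDiff.contMDiffAt.comp p
      (f.contMDiff.prodMk_space g.contMDiff p)⟩

theorem smoothMul_apply (f g : C^∞⟮𝓡 n, M; 𝓘(ℝ, 𝕜), 𝕜⟯) (p : M) :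
    smoothMul f g p = f p * g p := rfl

variable [IsManifold (𝓡 n) ∞ M]

theorem lieTranspose_coeff (X : SmoothVectorField n M) (σ : SmoothDensity 𝕜 n M) (e : Chart n M)
    {x : EuclideanSpace ℝ (Fin n)} (hx : x ∈ e.1.target) :
    (SmoothDensity.lieTranspose X σ).coeff e x = -∑ i, fderiv ℝ
      (fun y ↦ vectorCoeff e X y i • σ.coeff e y) x (EuclideanSpace.single i 1) := by
  change e.1.target.indicator (fun x ↦ -∑ i, fderiv ℝ
      (fun y ↦ vectorCoeff e X y i • σ.coeff e y) x (EuclideanSpace.single i 1)) x = _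
  exact indicator_of_mem hx _

theorem mul_coeff (f : C^∞⟮𝓡 n, M; 𝓘(ℝ, 𝕜), 𝕜⟯) (σ : SmoothDensity 𝕜 n M) (e : Chart n M)
    (x : EuclideanSpace ℝ (Fin n)) :
    (SmoothDensity.mul f σ).coeff e x = f (e.1.symm x) * σ.coeff e x := rfl

theorem differentiableAt_vectorCoeff_smul (X : SmoothVectorField n M) (σ : SmoothDensity 𝕜 n M)
    (e : Chart n M) (i : Fin n) {x : EuclideanSpace ℝ (Fin n)} (hx : x ∈ e.1.target) :
    DifferentiableAt ℝ (fun y ↦ vectorCoeff e X y i • σ.coeff e y) x :=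
  ((SmoothDensity.contDiffOn_vectorCoeff_smul X σ e i).contDiffAt
    (e.1.open_target.mem_nhds hx)).differentiableAt (by simp)

theorem differentiableAt_comp_symm (f : C^∞⟮𝓡 n, M; 𝓘(ℝ, 𝕜), 𝕜⟯) (e : Chart n M)
    {x : EuclideanSpace ℝ (Fin n)} (hx : x ∈ e.1.target) :
    DifferentiableAt ℝ (fun y ↦ f (e.1.symm y)) x :=
  ((SmoothDensity.contDiffOn_comp_symm f e).contDiffAt
    (e.1.open_target.mem_nhds hx)).differentiableAt (by simp)

/-- The value at `x` of the coefficient in the chart `e`. -/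
def coeffHom (e : Chart n M) (x : EuclideanSpace ℝ (Fin n)) : SmoothDensity 𝕜 n M →+ 𝕜 :=
  ⟨⟨fun σ ↦ σ.coeff e x, rfl⟩, fun _ _ ↦ rfl⟩

/-- On densities the transpose of `f Y` is `σ ↦ Yᵗ (f σ)`. The functions `f j` go under the
divergence together with the components of `Y j`, so none of their derivatives appear. -/
theorem lieOp_eq_sum {m : ℕ} {X : SmoothVectorField n M} {Y : Fin m → SmoothVectorField n M}
    {f : Fin m → C^∞⟮𝓡 n, M; 𝓘(ℝ), ℝ⟯} (h : ∀ p, X p = ∑ j, f j p • Y j p) :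
    (lieOp X : Module.End 𝕜 (DistributionSpace 𝕜 n M)) =
      ∑ j, mulOp (ofRealSmooth 𝕜 (f j)) * lieOp (Y j) := by
  have hv : ∀ (e : Chart n M) x, vectorCoeff e X x =
      ∑ j, f j (e.1.symm x) • vectorCoeff e (Y j) x := fun e x ↦ by
    unfold vectorCoeff
    rw [h]
    refine (map_sum (mfderiv (𝓡 n) (𝓡 n) e.1 (e.1.symm x)) _ _).trans ?_
    exact Finset.sum_congr rfl fun j _ ↦
      (mfderiv (𝓡 n) (𝓡 n) e.1 (e.1.symm x)).map_smul _ _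
  have key : ∀ σ : SmoothDensity 𝕜 n M, SmoothDensity.lieTranspose X σ =
      ∑ j, SmoothDensity.lieTranspose (Y j) (SmoothDensity.mul (ofRealSmooth 𝕜 (f j)) σ) := by
    intro σ
    ext e x
    change _ = coeffHom e x _
    rw [map_sum]
    change _ = ∑ j, (SmoothDensity.lieTranspose (Y j) _).coeff e x
    by_cases hx : x ∈ e.1.target
    · simp_rw [lieTranspose_coeff _ _ _ hx]
      rw [Finset.sum_neg_distrib, neg_inj, Finset.sum_comm]
      refine Finset.sum_congr rfl fun i _ ↦ ?_
      rw [← sum_apply, ← fderiv_fun_sum fun j _ ↦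
        differentiableAt_vectorCoeff_smul (Y j) (SmoothDensity.mul _ σ) e i hx]
      congr 2
      funext y
      rw [hv]
      simp only [WithLp.ofLp_sum, Finset.sum_apply, WithLp.ofLp_smul, Pi.smul_apply, Finset.sum_smul]
      refine Finset.sum_congr rfl fun j _ ↦ ?_
      rw [mul_coeff, smul_eq_mul, mul_comm, mul_smul]
      congr 1
      rw [RCLike.real_smul_eq_coe_mul]
      rfl
    · simp [SmoothDensity.coeff_eq_zero _ _ _ hx]
  ext u σ
  change u (SmoothDensity.lieTranspose X σ) = _
  rw [key, map_sum, LinearMap.sum_apply, FunLike.coe_sum, Finset.sum_apply]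
  rfl

/-- The derivative of a smooth function along a vector field. -/
noncomputable def dirDeriv (X : SmoothVectorField n M) (f : C^∞⟮𝓡 n, M; 𝓘(ℝ, 𝕜), 𝕜⟯) (p : M) : 𝕜 :=
  mfderiv (𝓡 n) 𝓘(ℝ, 𝕜) f p (X p)

theorem dirDeriv_eq (X : SmoothVectorField n M) (f : C^∞⟮𝓡 n, M; 𝓘(ℝ, 𝕜), 𝕜⟯) (e : Chart n M)
    {p : M} (hp : p ∈ e.1.source) :
    dirDeriv X f p = fderiv ℝ (fun y ↦ f (e.1.symm y)) (e.1 p) (vectorCoeff e X (e.1 p)) := by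
  have h1 : MDifferentiableAt (𝓡 n) (𝓡 n) e.1 p :=
    (contMDiffAt_of_mem_maximalAtlas e.2 hp).mdifferentiableAt (by simp)
  have h2 : MDifferentiableAt (𝓡 n) 𝓘(ℝ, 𝕜) (fun y ↦ f (e.1.symm y)) (e.1 p) :=
    (differentiableAt_comp_symm f e (e.1.map_source hp)).mdifferentiableAt
  have h3 := mfderiv_comp p h2 h1
  have h4 : (fun y ↦ f (e.1.symm y)) ∘ e.1 =ᶠ[𝓝 p] f := by
    filter_upwards [e.1.open_source.mem_nhds hp] with q hq
    simp [e.1.left_inv hq]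
  rw [h4.mfderiv_eq, mfderiv_eq_fderiv] at h3
  unfold dirDeriv vectorCoeff
  rw [h3, e.1.left_inv hp]
  rfl

theorem contMDiff_dirDeriv (X : SmoothVectorField n M) (f : C^∞⟮𝓡 n, M; 𝓘(ℝ, 𝕜), 𝕜⟯) :
    ContMDiff (𝓡 n) 𝓘(ℝ, 𝕜) ∞ (dirDeriv X f) := by
  intro p
  let e : Chart n M := ⟨chartAt _ p, IsManifold.chart_mem_maximalAtlas p⟩
  have hpe : p ∈ e.1.source := mem_chart_source _ p
  have h1 : ContDiffOn ℝ ∞ (fun x ↦ fderiv ℝ (fun y ↦ f (e.1.symm y)) x (vectorCoeff e X x))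
      e.1.target :=
    ((SmoothDensity.contDiffOn_comp_symm f e).fderiv_of_isOpen e.1.open_target
      (m := ∞) (by norm_cast)).clm_apply (contDiffOn_vectorCoeff e X)
  have h2 := ((h1.contDiffAt (e.1.open_target.mem_nhds (e.1.map_source hpe))).contMDiffAt).comp p
      (contMDiffAt_of_mem_maximalAtlas e.2 hpe)
  refine h2.congr_of_eventuallyEq ?_
  filter_upwards [e.1.open_source.mem_nhds hpe] with q hq
  exact dirDeriv_eq X f e hq

/-- The derivative of a smooth function along a vector field, as a smooth function. -/
noncomputable def dirDerivMap (X : SmoothVectorField n M) (f : C^∞⟮𝓡 n, M; 𝓘(ℝ, 𝕜), 𝕜⟯) :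
    C^∞⟮𝓡 n, M; 𝓘(ℝ, 𝕜), 𝕜⟯ :=
  ⟨dirDeriv X f, contMDiff_dirDeriv X f⟩

/-- The product rule for the divergence, `-f div(h X) = -div(f h X) + (X f) h`, in each chart. -/
theorem lieTranspose_mul (X : SmoothVectorField n M) (f : C^∞⟮𝓡 n, M; 𝓘(ℝ, 𝕜), 𝕜⟯)
    (σ : SmoothDensity 𝕜 n M) :
    SmoothDensity.mul f (SmoothDensity.lieTranspose X σ) =
      SmoothDensity.lieTranspose X (SmoothDensity.mul f σ) +
        SmoothDensity.mul (dirDerivMap X f) σ := by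
  ext e x
  rw [SmoothDensity.add_coeff]
  by_cases hx : x ∈ e.1.target
  · rw [mul_coeff, mul_coeff, lieTranspose_coeff _ _ _ hx, lieTranspose_coeff _ _ _ hx]
    have h1 := fun i ↦ differentiableAt_vectorCoeff_smul X σ e i hx
    have h2 : ∀ i, fderiv ℝ (fun y ↦ vectorCoeff e X y i • (SmoothDensity.mul f σ).coeff e y) x
        (EuclideanSpace.single i 1) = f (e.1.symm x) *
          fderiv ℝ (fun y ↦ vectorCoeff e X y i • σ.coeff e y) x (EuclideanSpace.single i 1) +
        (vectorCoeff e X x i • fderiv ℝ (fun y ↦ f (e.1.symm y)) x (EuclideanSpace.single i 1)) *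
          σ.coeff e x := fun i ↦ by
      have h3 := ((differentiableAt_comp_symm f e hx).hasFDerivAt.mul (h1 i).hasFDerivAt).fderiv
      have h4 : (fun y ↦ vectorCoeff e X y i • (SmoothDensity.mul f σ).coeff e y) =
          (fun y ↦ f (e.1.symm y)) * fun y ↦ vectorCoeff e X y i • σ.coeff e y := by
        funext y
        rw [mul_coeff, Pi.mul_apply, mul_smul_comm]
      rw [h4, h3]
      simp only [FunLike.coe_add, FunLike.coe_smul, Pi.add_apply, Pi.smul_apply, smul_eq_mul,
        RCLike.real_smul_eq_coe_mul]
      ring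
    have h3 : dirDeriv X f (e.1.symm x) =
        ∑ i, vectorCoeff e X x i • fderiv ℝ (fun y ↦ f (e.1.symm y)) x
          (EuclideanSpace.single i 1) := by
      rw [dirDeriv_eq X f e (e.1.map_target hx), e.1.right_inv hx]
      conv_lhs => rw [eq_sum_single (vectorCoeff e X x), map_sum]
      simp_rw [map_smul]
    simp_rw [h2]
    change _ = _ + dirDeriv X f (e.1.symm x) * _
    rw [h3, Finset.sum_add_distrib, ← Finset.mul_sum, ← Finset.sum_mul]
    ring
  · simp [SmoothDensity.coeff_eq_zero _ _ _ hx]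

/-- The commutator of a field and a function is again a function; this moves all functions to the
left of the fields in a product. -/
theorem lieOp_mul_mulOp (X : SmoothVectorField n M) (f : C^∞⟮𝓡 n, M; 𝓘(ℝ, 𝕜), 𝕜⟯) :
    lieOp X * mulOp f = mulOp f * lieOp X + mulOp (dirDerivMap X f) := by
  ext u σ
  change u (SmoothDensity.mul f (SmoothDensity.lieTranspose X σ)) =
    u (SmoothDensity.lieTranspose X (SmoothDensity.mul f σ)) +
      u (SmoothDensity.mul (dirDerivMap X f) σ)
  rw [lieTranspose_mul, map_add]

theorem mulOp_mul_mulOp (f g : C^∞⟮𝓡 n, M; 𝓘(ℝ, 𝕜), 𝕜⟯) :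
    (mulOp f * mulOp g : Module.End 𝕜 (DistributionSpace 𝕜 n M)) = mulOp (smoothMul f g) := by
  ext u σ
  change u (SmoothDensity.mul g (SmoothDensity.mul f σ)) = u (SmoothDensity.mul (smoothMul f g) σ)
  congr 1
  ext e x
  simp only [mul_coeff, smoothMul_apply]
  ring

theorem mulOp_one : (mulOp 1 : Module.End 𝕜 (DistributionSpace 𝕜 n M)) = 1 := by
  ext u σ
  change u (SmoothDensity.mul 1 σ) = u σ
  congr 1
  ext e x
  simp [mul_coeff]

/-- The composition of the derivatives along the vector fields `Y j`, for `j` in a list. -/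
noncomputable def wordOp (𝕜 : Type*) [RCLike 𝕜] {m : ℕ} (Y : Fin m → SmoothVectorField n M)
    (l : List (Fin m)) : Module.End 𝕜 (DistributionSpace 𝕜 n M) :=
  (l.map fun j ↦ lieOp (Y j)).prod

variable {k : ℕ} {L : Set M}

theorem wordOp_mem_diffOps {m : ℕ} {Y : Fin m → SmoothVectorField n M}
    (hY : ∀ j, IsTangentTo k L (Y j)) (l : List (Fin m)) : wordOp 𝕜 Y l ∈ diffOps 𝕜 n k L := by
  refine Subalgebra.list_prod_mem _ fun T hT ↦ ?_
  obtain ⟨j, -, rfl⟩ := List.mem_map.1 hT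
  exact Algebra.subset_adjoin (Or.inr ⟨_, hY j, rfl⟩)

theorem mulOp_mem_diffOps (f : C^∞⟮𝓡 n, M; 𝓘(ℝ, 𝕜), 𝕜⟯) : mulOp f ∈ diffOps 𝕜 n k L :=
  Algebra.subset_adjoin (Or.inl ⟨f, rfl⟩)

/-- As a left module over the smooth functions, the algebra `Diff(M, L)` is generated by the
compositions of generating vector fields. -/
theorem mem_span_of_mem_diffOps {m : ℕ} {Y : Fin m → SmoothVectorField n M}
    (hY : ∀ X : SmoothVectorField n M, IsTangentTo k L X →
        ∃ f : Fin m → C^∞⟮𝓡 n, M; 𝓘(ℝ), ℝ⟯, ∀ p, X p = ∑ j, f j p • Y j p)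
    {T : Module.End 𝕜 (DistributionSpace 𝕜 n M)} (hT : T ∈ diffOps 𝕜 n k L) :
    T ∈ Submodule.span 𝕜 (range fun q : C^∞⟮𝓡 n, M; 𝓘(ℝ, 𝕜), 𝕜⟯ × List (Fin m) ↦
      mulOp q.1 * wordOp 𝕜 Y q.2) := by
  set D := Submodule.span 𝕜 (range fun q : C^∞⟮𝓡 n, M; 𝓘(ℝ, 𝕜), 𝕜⟯ × List (Fin m) ↦
      (mulOp q.1 * wordOp 𝕜 Y q.2 : Module.End 𝕜 (DistributionSpace 𝕜 n M))) with hD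
  have hmem : ∀ f l, mulOp f * wordOp 𝕜 Y l ∈ D := fun f l ↦ Submodule.subset_span ⟨(f, l), rfl⟩
  have hext : ∀ T : Module.End 𝕜 (DistributionSpace 𝕜 n M),
      (∀ f l, T * (mulOp f * wordOp 𝕜 Y l) ∈ D) → ∀ d ∈ D, T * d ∈ D := fun T hT d hd ↦ by
    induction hd using Submodule.span_induction with
    | mem x hx =>
      obtain ⟨⟨f, l⟩, rfl⟩ := hx
      exact hT f l
    | zero => rw [mul_zero]; exact D.zero_mem
    | add x y _ _ hx hy => rw [mul_add]; exact D.add_mem hx hy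
    | smul c x _ hx => rw [mul_smul_comm]; exact D.smul_mem c hx
  have hmul : ∀ f, ∀ d ∈ D, mulOp f * d ∈ D := fun f ↦ hext _ fun g l ↦ by
    rw [← mul_assoc, mulOp_mul_mulOp]
    exact hmem _ _
  -- Commuting `Y j` past `g` gives one term with the longer word `j :: l` and one with the word
  -- `l`.
  have hlie : ∀ j, ∀ d ∈ D, lieOp (Y j) * d ∈ D := fun j ↦ hext _ fun g l ↦ by
    rw [← mul_assoc, lieOp_mul_mulOp, add_mul, mul_assoc]
    exact D.add_mem (hmem g (j :: l)) (hmem _ l)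
  -- That left multiplication by `T` preserves `D` is a property which passes to products, so it
  -- suits induction on the generated algebra. It is evaluated at `1 ∈ D` at the end.
  have hall : ∀ d ∈ D, T * d ∈ D := by
    induction hT using Algebra.adjoin_induction with
    | mem T hT =>
      rcases hT with ⟨f, rfl⟩ | ⟨X, hX, rfl⟩
      · exact hmul f
      · obtain ⟨f, hf⟩ := hY X hX
        intro d hd
        rw [lieOp_eq_sum hf, Finset.sum_mul]
        refine D.sum_mem fun j _ ↦ ?_
        rw [mul_assoc]
        exact hmul _ _ (hlie j d hd)
    | algebraMap c =>
      intro d hd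
      rw [← Algebra.smul_def]
      exact D.smul_mem c hd
    | add S T _ _ hS hT =>
      intro d hd
      rw [add_mul]
      exact D.add_mem (hS d hd) (hT d hd)
    | mul S T _ _ hS hT =>
      intro d hd
      rw [mul_assoc]
      exact hS _ (hT d hd)
  have h1 : (1 : Module.End 𝕜 (DistributionSpace 𝕜 n M)) ∈ D := by
    have := hmem 1 []
    rwa [mulOp_one, one_mul] at this
  simpa using hall 1 h1

/-- The elements of `Diff(M, L)` act on distributions by transposition. -/
theorem exists_transpose {T : Module.End 𝕜 (DistributionSpace 𝕜 n M)} (hT : T ∈ diffOps 𝕜 n k L) :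
    ∃ S : SmoothDensity 𝕜 n M → SmoothDensity 𝕜 n M, ∀ u σ, T u σ = u (S σ) := by
  induction hT using Algebra.adjoin_induction with
  | mem T hT =>
    rcases hT with ⟨f, rfl⟩ | ⟨X, -, rfl⟩
    exacts [⟨_, fun _ _ ↦ rfl⟩, ⟨_, fun _ _ ↦ rfl⟩]
  | algebraMap c => exact ⟨fun σ ↦ c • σ, fun u σ ↦ by
      rw [map_smul, Module.algebraMap_end_apply]; rfl⟩
  | add S T _ _ hS hT =>
    obtain ⟨S', hS⟩ := hS
    obtain ⟨T', hT⟩ := hT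
    refine ⟨fun σ ↦ S' σ + T' σ, fun u σ ↦ ?_⟩
    rw [map_add, ← hS, ← hT]
    rfl
  | mul S T _ _ hS hT =>
    obtain ⟨S', hS⟩ := hS
    obtain ⟨T', hT⟩ := hT
    exact ⟨fun σ ↦ T' (S' σ), fun u σ ↦ by rw [Module.End.mul_apply, hS, hT]⟩

end Operators

/-! ### Finite sums of squares of seminorms -/

section SquareSum

variable {𝕜 E : Type*} [NormedField 𝕜] [AddCommGroup E] [Module 𝕜 E]

theorem sqrt_sum_add_sq_le {κ : Type*} (s : Finset κ) {f g h : κ → ℝ} (h0 : ∀ j, 0 ≤ h j)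
    (hf : ∀ j, 0 ≤ f j) (hg : ∀ j, 0 ≤ g j) (hh : ∀ j, h j ≤ f j + g j) :
    √(∑ j ∈ s, h j ^ 2) ≤ √(∑ j ∈ s, f j ^ 2) + √(∑ j ∈ s, g j ^ 2) := by
  have h1 := Real.Lp_add_le_of_nonneg s (p := 2) one_le_two (fun j _ ↦ hf j) (fun j _ ↦ hg j)
  simp only [Real.rpow_ofNat, ← Real.sqrt_eq_rpow] at h1
  refine (Real.sqrt_le_sqrt (Finset.sum_le_sum fun j _ ↦ ?_)).trans h1
  exact pow_le_pow_left₀ (h0 j) (hh j) 2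

/-- The square root of the sum of the squares of finitely many seminorms. -/
noncomputable def sqSumSeminorm {κ : Type*} (s : Finset κ) (q : κ → Seminorm 𝕜 E) :
    Seminorm 𝕜 E :=
  Seminorm.of (fun x ↦ √(∑ j ∈ s, q j x ^ 2))
    (fun x y ↦ sqrt_sum_add_sq_le s (fun j ↦ apply_nonneg _ _) (fun j ↦ apply_nonneg _ _)
      (fun j ↦ apply_nonneg _ _) fun j ↦ map_add_le_add (q j) x y)
    (fun c x ↦ by
      simp_rw [map_smul_eq_mul, mul_pow]
      rw [← Finset.mul_sum, Real.sqrt_mul (sq_nonneg _), Real.sqrt_sq (norm_nonneg c)])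

theorem sqSumSeminorm_sq {κ : Type*} (s : Finset κ) (q : κ → Seminorm 𝕜 E) (x : E) :
    sqSumSeminorm s q x ^ 2 = ∑ j ∈ s, q j x ^ 2 :=
  Real.sq_sqrt (Finset.sum_nonneg fun _ _ ↦ sq_nonneg _)

theorem sqSumSeminorm_mono {κ : Type*} {s t : Finset κ} (h : s ⊆ t) (q : κ → Seminorm 𝕜 E) :
    sqSumSeminorm s q ≤ sqSumSeminorm t q := fun _ ↦
  Real.sqrt_le_sqrt (Finset.sum_le_sum_of_subset_of_nonneg h fun _ _ _ ↦ sq_nonneg _)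

theorem le_sqSumSeminorm {κ : Type*} {s : Finset κ} (q : κ → Seminorm 𝕜 E) {j : κ} (hj : j ∈ s)
    (x : E) : q j x ≤ sqSumSeminorm s q x :=
  Real.le_sqrt_of_sq_le (Finset.single_le_sum (f := fun j ↦ q j x ^ 2)
    (fun _ _ ↦ sq_nonneg _) hj)

theorem IsHilbertian.sqSumSeminorm {κ : Type*} (s : Finset κ) {q : κ → Seminorm 𝕜 E}
    (hq : ∀ j, IsHilbertian (q j)) : IsHilbertian (sqSumSeminorm s q) := fun x y ↦ by
  simp_rw [sqSumSeminorm_sq, ← Finset.sum_add_distrib, Finset.mul_sum]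
  exact Finset.sum_congr rfl fun j _ ↦ hq j x y

end SquareSum

/-- A topology which is defined by countably many Hilbertian seminorms is also defined by an
increasing sequence of Hilbertian seminorms. -/
theorem exists_monotone_isHilbertian {𝕜 E κ : Type*} [NontriviallyNormedField 𝕜] [AddCommGroup E]
    [Module 𝕜 E] [TopologicalSpace E] [IsTopologicalAddGroup E] [Countable κ]
    {q : SeminormFamily 𝕜 E κ} (hq : WithSeminorms q) (hpar : ∀ j, IsHilbertian (q j)) :
    ∃ p : SeminormFamily 𝕜 E ℕ, WithSeminorms p ∧ Monotone p ∧ ∀ m, IsHilbertian (p m) := by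
  obtain ⟨c, hc⟩ := Countable.exists_injective_nat κ
  have hfin : ∀ N, (c ⁻¹' (Finset.range N : Set ℕ)).Finite := fun N ↦
    (Finset.finite_toSet _).preimage hc.injOn
  -- The `N`-th new seminorm combines the finitely many old ones with code below `N`. Sums of
  -- squares are used instead of maxima because they keep the parallelogram law.
  let s : ℕ → Finset κ := fun N ↦ (hfin N).toFinset
  have hs : ∀ j N, j ∈ s N ↔ c j < N := fun j N ↦ by simp [s]
  refine ⟨fun N ↦ sqSumSeminorm (s N) q, ?_, fun N N' h ↦ sqSumSeminorm_mono (fun j hj ↦ ?_) q,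
    fun N ↦ IsHilbertian.sqSumSeminorm _ hpar⟩
  · rw [SeminormFamily.withSeminorms_iff_nhds_eq_iInf]
    apply le_antisymm
    · refine le_iInf fun N ↦ ?_
      rw [← tendsto_iff_comap]
      have h1 : Continuous fun x ↦ sqSumSeminorm (s N) q x :=
        (continuous_finsetSum _ fun j _ ↦ (hq.continuous_seminorm j).pow 2).sqrt
      exact h1.tendsto' 0 0 (map_zero _)
    · rw [(SeminormFamily.withSeminorms_iff_nhds_eq_iInf q).1 hq]
      refine le_iInf fun j ↦ iInf_le_of_le (c j + 1) ?_
      rw [← tendsto_iff_comap]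
      exact squeeze_zero (fun x ↦ apply_nonneg _ _)
        (fun x ↦ le_sqSumSeminorm q ((hs j _).2 (Nat.lt_succ_self _)) x) tendsto_comap
  · exact (hs j _).2 (((hs j _).1 hj).trans_le h)

/-! ### Seminorms and the projective topology of the conormal space -/

section Conormal

variable {𝕜 : Type*} [RCLike 𝕜] {n : ℕ} {M : Type*} [TopologicalSpace M]
  [ChartedSpace (EuclideanSpace ℝ (Fin n)) M] [IsManifold (𝓡 n) ∞ M] {A : SobolevAtlas n M}
  {k : ℕ} {L : Set M} {s : ℝ}

open SobolevSpace ConormalSpace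

theorem norm_rclike_map (c : 𝕜) : ‖RCLike.map 𝕜 ℂ c‖ = ‖c‖ := by
  rw [← sq_eq_sq₀ (norm_nonneg _) (norm_nonneg _), RCLike.norm_sq_eq_def, RCLike.norm_sq_eq_def]
  simp

/-- The seminorm `u ↦ ‖(1 + |D|²)^{s/2} e_*(ρᵢ P u)‖` on the space `I^{(s)}(M, L)`. -/
noncomputable def opSeminorm (P : diffOps 𝕜 n k L) (i : A.ι) :
    Seminorm 𝕜 (ConormalSpace 𝕜 A k L s) :=
  Seminorm.of (fun u ↦ ‖besselComponent i (applyOp P u)‖)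
    (fun u v ↦ by
      have h : applyOp P (u + v) = applyOp P u + applyOp P v := Subtype.ext (map_add P.1 u.1 v.1)
      rw [h, besselComponent_add]
      exact norm_add_le _ _)
    (fun c u ↦ by
      have h : applyOp P (c • u) = c • applyOp P u := Subtype.ext (map_smul P.1 c u.1)
      rw [h, besselComponent_smul, norm_smul, norm_rclike_map])

theorem opSeminorm_apply (P : diffOps 𝕜 n k L) (i : A.ι) (u : ConormalSpace 𝕜 A k L s) :
    opSeminorm P i u = ‖besselComponent i (applyOp P u)‖ := rfl

/-- The map `u ↦ (1 + |D|²)^{s/2} e_*(ρᵢ P u)`. -/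
noncomputable def opComponent (P : diffOps 𝕜 n k L) (i : A.ι) :
    ConormalSpace 𝕜 A k L s →+ Lp ℂ 2 (volume : Measure (EuclideanSpace ℝ (Fin n))) :=
  AddMonoidHom.mk' (fun u ↦ besselComponent i (applyOp P u)) fun u v ↦ by
    have h : applyOp P (u + v) = applyOp P u + applyOp P v := Subtype.ext (map_add P.1 u.1 v.1)
    rw [h, besselComponent_add]

theorem isHilbertian_opSeminorm (P : diffOps 𝕜 n k L) (i : A.ι) :
    IsHilbertian (opSeminorm (s := s) P i) := fun u v ↦ by
  change ‖opComponent P i (u + v)‖ ^ 2 + ‖opComponent P i (u - v)‖ ^ 2 =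
    2 * (‖opComponent P i u‖ ^ 2 + ‖opComponent P i v‖ ^ 2)
  rw [map_add, map_sub]
  have := parallelogram_law_with_norm ℂ (opComponent P i u) (opComponent P i v)
  linarith

theorem topology_eq_iInf :
    (inferInstance : TopologicalSpace (ConormalSpace 𝕜 A k L s)) =
      ⨅ P : diffOps 𝕜 n k L, ⨅ i, TopologicalSpace.induced (opComponent P i) inferInstance := by
  change (⨅ P : diffOps 𝕜 n k L, TopologicalSpace.induced (applyOp P)
    (TopologicalSpace.induced (fun u i ↦ besselComponent i u) Pi.topologicalSpace)) = _
  refine iInf_congr fun P ↦ ?_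
  rw [induced_compose, Pi.topologicalSpace, induced_iInf]
  refine iInf_congr fun i ↦ ?_
  rw [induced_compose]
  rfl

instance : IsTopologicalAddGroup (ConormalSpace 𝕜 A k L s) := by
  have h := topologicalAddGroup_iInf (G := ConormalSpace 𝕜 A k L s)
    (ts' := fun P : diffOps 𝕜 n k L ↦
      ⨅ i, TopologicalSpace.induced (opComponent (A := A) (s := s) P i) inferInstance)
    fun P ↦ topologicalAddGroup_iInf fun i ↦ topologicalAddGroup_induced (opComponent P i)
  rw [← topology_eq_iInf] at h
  exact h

theorem nhds_zero_eq_iInf : 𝓝 (0 : ConormalSpace 𝕜 A k L s) =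
    ⨅ (P : diffOps 𝕜 n k L) (i : A.ι), (𝓝 0).comap (opSeminorm (s := s) P i) := by
  have h := congrArg (fun t ↦ @nhds _ t (0 : ConormalSpace 𝕜 A k L s))
    (topology_eq_iInf (𝕜 := 𝕜) (A := A) (k := k) (L := L) (s := s))
  refine h.trans ?_
  simp only [nhds_iInf, nhds_induced, map_zero]
  refine iInf_congr fun P ↦ iInf_congr fun i ↦ ?_
  rw [← comap_norm_nhds_zero, comap_comap]
  rfl

end Conormal

/-! ### Reduction to countably many seminorms, completeness and conclusion -/

section Conormal

variable {𝕜 : Type*} [RCLike 𝕜] {n : ℕ} {M : Type*} [TopologicalSpace M]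
  [ChartedSpace (EuclideanSpace ℝ (Fin n)) M] [IsManifold (𝓡 n) ∞ M] {A : SobolevAtlas n M}
  {k : ℕ} {L : Set M} {s : ℝ}

open SobolevSpace ConormalSpace

theorem isFrechetSpace_of_withSeminorms {E κ : Type*} [AddCommGroup E] [Module 𝕜 E]
    [TopologicalSpace E] [IsTopologicalAddGroup E] [Countable κ]
    {q : SeminormFamily 𝕜 E κ} (hq : WithSeminorms q) (hsep : ∀ x, (∀ j, q j x = 0) → x = 0)
    (hcomplete : ∀ u : ℕ → E,
      (∀ j, ∀ ε > 0, ∃ N, ∀ l ≥ N, ∀ m ≥ N, q j (u l - u m) < ε) →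
      ∃ v, ∀ j, Tendsto (fun m ↦ q j (u m - v)) atTop (𝓝 0)) : IsFrechetSpace 𝕜 E := by
  let _ : UniformSpace E := IsTopologicalAddGroup.rightUniformSpace E
  have : IsUniformAddGroup E := isUniformAddGroup_of_addCommGroup
  have := hq.firstCountableTopology
  have : (uniformity E).IsCountablyGenerated := IsUniformAddGroup.uniformity_countably_generated
  have : T1Space E := hq.T1_of_separating fun x hx ↦ by
    by_contra! h
    exact hx (hsep x h)
  refine ⟨inferInstance, hq.continuousSMul, hq.toPolynormableSpace,
    UniformSpace.metrizableSpace, ?_⟩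
  refine UniformSpace.complete_of_cauchySeq_tendsto fun u hu ↦ ?_
  obtain ⟨v, hv⟩ := hcomplete u ((cauchySeq_iff_seminorm hq).1 hu)
  refine ⟨v, (hq.tendsto_nhds _ _).2 fun j ε hε ↦ ?_⟩
  exact (hv j).eventually_lt_const hε

/-- The Sobolev norms of `T u` in the charts are controlled by finitely many of those of `w u`,
where `w` is a composition of the vector fields `Y j`. -/
def IsControlled (A : SobolevAtlas n M) (s : ℝ) {k : ℕ} {L : Set M} {m : ℕ}
    {Y : Fin m → SmoothVectorField n M} (hY : ∀ j, IsTangentTo k L (Y j))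
    (T : Module.End 𝕜 (DistributionSpace 𝕜 n M)) : Prop :=
  ∃ hT : T ∈ diffOps 𝕜 n k L, ∀ i : A.ι, ∃ (C : ℝ) (t : Finset (List (Fin m))),
    ∀ u : ConormalSpace 𝕜 A k L s, opSeminorm ⟨T, hT⟩ i u ≤
      C * ∑ l ∈ t, opSeminorm ⟨wordOp 𝕜 Y l, wordOp_mem_diffOps hY l⟩ i u

variable {m : ℕ} {Y : Fin m → SmoothVectorField n M} (hY : ∀ j, IsTangentTo k L (Y j))

theorem IsControlled.add {S T : Module.End 𝕜 (DistributionSpace 𝕜 n M)}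
    (hS : IsControlled A s hY S) (hT : IsControlled A s hY T) : IsControlled A s hY (S + T) := by
  classical
  obtain ⟨hS, hS'⟩ := hS
  obtain ⟨hT, hT'⟩ := hT
  refine ⟨add_mem hS hT, fun i ↦ ?_⟩
  obtain ⟨C, t, h⟩ := hS' i
  obtain ⟨C', t', h'⟩ := hT' i
  -- The given constants have no prescribed sign, so absolute values are taken before the sums are
  -- enlarged to the union.
  refine ⟨|C| + |C'|, t ∪ t', fun u ↦ ?_⟩
  have h1 : applyOp ⟨S + T, add_mem hS hT⟩ u = applyOp ⟨S, hS⟩ u + applyOp ⟨T, hT⟩ u := rfl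
  have h2 : opSeminorm ⟨S + T, add_mem hS hT⟩ i u ≤
      opSeminorm ⟨S, hS⟩ i u + opSeminorm ⟨T, hT⟩ i u := by
    simp_rw [opSeminorm_apply, h1, besselComponent_add]
    exact norm_add_le _ _
  have h3 : ∀ r r' : Finset (List (Fin m)), r ⊆ r' →
      ∑ l ∈ r, opSeminorm ⟨wordOp 𝕜 Y l, wordOp_mem_diffOps hY l⟩ i u ≤
        ∑ l ∈ r', opSeminorm ⟨wordOp 𝕜 Y l, wordOp_mem_diffOps hY l⟩ i u := fun r r' hr ↦
    Finset.sum_le_sum_of_subset_of_nonneg hr fun _ _ _ ↦ apply_nonneg _ _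
  have h0 : ∀ r : Finset (List (Fin m)),
      0 ≤ ∑ l ∈ r, opSeminorm ⟨wordOp 𝕜 Y l, wordOp_mem_diffOps hY l⟩ i u := fun r ↦
    Finset.sum_nonneg fun _ _ ↦ apply_nonneg _ _
  rw [add_mul]
  refine h2.trans (add_le_add ((h u).trans ?_) ((h' u).trans ?_))
  · exact mul_le_mul (le_abs_self C) (h3 _ _ Finset.subset_union_left) (h0 _) (abs_nonneg _)
  · exact mul_le_mul (le_abs_self C') (h3 _ _ Finset.subset_union_right) (h0 _) (abs_nonneg _)

theorem IsControlled.smul (c : 𝕜) {T : Module.End 𝕜 (DistributionSpace 𝕜 n M)}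
    (hT : IsControlled A s hY T) : IsControlled A s hY (c • T) := by
  obtain ⟨hT, hT'⟩ := hT
  refine ⟨Subalgebra.smul_mem _ hT c, fun i ↦ ?_⟩
  obtain ⟨C, t, h⟩ := hT' i
  refine ⟨‖c‖ * C, t, fun u ↦ ?_⟩
  have h1 : applyOp ⟨c • T, Subalgebra.smul_mem _ hT c⟩ u = c • applyOp ⟨T, hT⟩ u := rfl
  rw [opSeminorm_apply, h1, besselComponent_smul, norm_smul, norm_rclike_map, mul_assoc]
  exact mul_le_mul_of_nonneg_left (h u) (norm_nonneg c)

variable [CompactSpace M] [T2Space M]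

/-- Multiplication by `f` is bounded on `H^s` within each chart, so the single word `l` suffices. -/
theorem isControlled_mulOp_mul_wordOp (f : C^∞⟮𝓡 n, M; 𝓘(ℝ, 𝕜), 𝕜⟯) (l : List (Fin m)) :
    IsControlled A s hY (mulOp f * wordOp 𝕜 Y l) := by
  refine ⟨mul_mem (mulOp_mem_diffOps f) (wordOp_mem_diffOps hY l), fun i ↦ ?_⟩
  obtain ⟨C, hC⟩ := exists_norm_besselComponent_mulOp_le (A := A) (s := s) f i
  refine ⟨C, {l}, fun u ↦ ?_⟩
  rw [Finset.sum_singleton]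
  exact hC _ _ rfl

/-- The fields `Y` generate the fields tangent to `L` over the smooth functions. -/
abbrev IsGenerating (k : ℕ) (L : Set M) {m : ℕ} (Y : Fin m → SmoothVectorField n M) : Prop :=
  ∀ X : SmoothVectorField n M, IsTangentTo k L X →
    ∃ f : Fin m → C^∞⟮𝓡 n, M; 𝓘(ℝ), ℝ⟯, ∀ p, X p = ∑ j, f j p • Y j p

theorem isControlled_of_mem_diffOps (hgen : IsGenerating k L Y)
    {T : Module.End 𝕜 (DistributionSpace 𝕜 n M)} (hT : T ∈ diffOps 𝕜 n k L) :
    IsControlled A s hY T := by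
  have h := mem_span_of_mem_diffOps hgen hT
  clear hT
  induction h using Submodule.span_induction with
  | mem x hx =>
    obtain ⟨⟨f, l⟩, rfl⟩ := hx
    exact isControlled_mulOp_mul_wordOp hY f l
  | zero => simpa using (isControlled_mulOp_mul_wordOp hY 1 []).smul hY (0 : 𝕜)
  | add x y _ _ hx hy => exact hx.add hY hy
  | smul c x _ hx => exact hx.smul hY c

/-- The seminorms given by the compositions of the fields `Y`. -/
noncomputable def wordSeminorm (A : SobolevAtlas n M) (s : ℝ) :
    SeminormFamily 𝕜 (ConormalSpace 𝕜 A k L s) (List (Fin m) × A.ι) := fun q ↦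
  opSeminorm ⟨wordOp 𝕜 Y q.1, wordOp_mem_diffOps hY q.1⟩ q.2

/-- Here the uncountable family of all operators is replaced by the countable family of words, which
makes metrizability possible: every operator is controlled by finitely many words in each chart. -/
theorem withSeminorms_wordSeminorm (hgen : IsGenerating k L Y) :
    WithSeminorms (wordSeminorm (𝕜 := 𝕜) hY A s) := by
  rw [SeminormFamily.withSeminorms_iff_nhds_eq_iInf, nhds_zero_eq_iInf]
  apply le_antisymm
  · exact le_iInf fun q ↦ iInf₂_le _ _
  · refine le_iInf₂ fun P i ↦ ?_
    obtain ⟨hP, h⟩ := isControlled_of_mem_diffOps (A := A) (s := s) hY hgen P.2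
    obtain ⟨C, t, h⟩ := h i
    rw [← tendsto_iff_comap]
    refine squeeze_zero (fun u ↦ apply_nonneg _ _) h ?_
    have h1 : Tendsto (fun u : ConormalSpace 𝕜 A k L s ↦
        C * ∑ l ∈ t, opSeminorm ⟨wordOp 𝕜 Y l, wordOp_mem_diffOps hY l⟩ i u)
        (⨅ q, comap (wordSeminorm (𝕜 := 𝕜) hY A s q) (𝓝 0)) (𝓝 (C * ∑ l ∈ t, 0)) :=
      (tendsto_finsetSum _ fun l _ ↦ tendsto_comap.mono_left
        (iInf_le (fun q ↦ comap (wordSeminorm (𝕜 := 𝕜) hY A s q) (𝓝 0)) (l, i))).const_mul C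
    simpa using h1

theorem mem_sobolevSubmodule_of_wordOp (hgen : IsGenerating k L Y) {v : DistributionSpace 𝕜 n M}
    (hv : ∀ l, wordOp 𝕜 Y l v ∈ sobolevSubmodule 𝕜 A s) : v ∈ conormalSubmodule 𝕜 A k L s := by
  intro P hP
  have h := mem_span_of_mem_diffOps hgen hP
  clear hP
  induction h using Submodule.span_induction with
  | mem x hx =>
    obtain ⟨⟨f, l⟩, rfl⟩ := hx
    exact mulOp_mem_sobolevSubmodule f (hv l)
  | zero => exact zero_mem _
  | add x y _ _ hx hy => exact add_mem hx hy
  | smul c x _ hx => exact Submodule.smul_mem _ c hx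

/-- For every word the images of the sequence converge in `H^s(M)`. The limit sought is the one for
the empty word, and the others have to be recognized as its images under the words. -/
theorem exists_tendsto_wordSeminorm (hgen : IsGenerating k L Y)
    (u : ℕ → ConormalSpace 𝕜 A k L s)
    (hu : ∀ j, ∀ ε > 0, ∃ N, ∀ l ≥ N, ∀ m ≥ N, wordSeminorm hY A s j (u l - u m) < ε) :
    ∃ v, ∀ j, Tendsto (fun m ↦ wordSeminorm hY A s j (u m - v)) atTop (𝓝 0) := by
  let W : List (Fin m) → diffOps 𝕜 n k L := fun l ↦ ⟨wordOp 𝕜 Y l, wordOp_mem_diffOps hY l⟩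
  have hW : ∀ l i (x y : ConormalSpace 𝕜 A k L s), wordSeminorm hY A s (l, i) (x - y) =
      ‖besselComponent i (applyOp (W l) x) - besselComponent i (applyOp (W l) y)‖ :=
    fun l i x y ↦ congrArg norm (map_sub (opComponent (W l) i) x y)
  have hlim : ∀ l, ∃ v : SobolevSpace 𝕜 A s,
      (∀ σ, Tendsto (fun r ↦ (applyOp (W l) (u r)).1 σ) atTop (𝓝 (v.1 σ))) ∧
      ∀ i, Tendsto (fun r ↦ besselComponent i (applyOp (W l) (u r))) atTop
        (𝓝 (besselComponent i v)) := fun l ↦ by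
    refine exists_tendsto_of_cauchySeq_besselComponent fun i ↦ Metric.cauchySeq_iff.2 fun ε hε ↦ ?_
    obtain ⟨N, hN⟩ := hu (l, i) ε hε
    refine ⟨N, fun a ha b hb ↦ ?_⟩
    rw [dist_eq_norm, ← hW]
    exact hN a ha b hb
  choose v hvσ hv using hlim
  -- Testing the word against `σ` is testing the distribution against another density, so pointwise
  -- convergence of `u r` passes through the word.
  have hvl : ∀ l, wordOp 𝕜 Y l (v []).1 = (v l).1 := fun l ↦ by
    obtain ⟨S, hS⟩ := exists_transpose (wordOp_mem_diffOps (𝕜 := 𝕜) hY l)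
    ext σ
    refine tendsto_nhds_unique ?_ (hvσ l σ)
    rw [hS]
    exact (hvσ [] (S σ)).congr fun r ↦ (hS (u r).1 σ).symm
  obtain ⟨V, hV⟩ : ∃ V : ConormalSpace 𝕜 A k L s, V.1 = (v []).1 :=
    ⟨⟨(v []).1, mem_sobolevSubmodule_of_wordOp hgen fun l ↦ (hvl l).symm ▸ (v l).2⟩, rfl⟩
  have hVl : ∀ l, applyOp (W l) V = v l := fun l ↦ Subtype.ext (by
    rw [← hvl l, ← hV]; rfl)
  refine ⟨V, fun ⟨l, i⟩ ↦ ?_⟩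
  simp_rw [hW, hVl]
  exact tendsto_iff_norm_sub_tendsto_zero.1 (hv l i)

/-- The empty word is the identity operator, and the components of `u` itself in the charts already
determine `u`. -/
theorem eq_zero_of_wordSeminorm {u : ConormalSpace 𝕜 A k L s}
    (hu : ∀ j, wordSeminorm hY A s j u = 0) : u = 0 := by
  have h := eq_zero_of_besselComponent
    (u := applyOp (⟨wordOp 𝕜 Y [], wordOp_mem_diffOps hY []⟩ : diffOps 𝕜 n k L) u)
    fun i ↦ norm_eq_zero.1 (hu ([], i))
  have h' : wordOp 𝕜 Y [] u.1 = 0 := congrArg (fun w : SobolevSpace 𝕜 A s ↦ w.1) h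
  exact Subtype.ext h'

theorem isFrechetSpace_conormalSpace (hL : IsClosedSubmanifold n k L) :
    IsFrechetSpace 𝕜 (ConormalSpace 𝕜 A k L s) := by
  obtain ⟨m, Y, hY, hgen⟩ := exists_generators hL
  exact isFrechetSpace_of_withSeminorms (withSeminorms_wordSeminorm hY hgen)
    (fun u ↦ eq_zero_of_wordSeminorm hY) (exists_tendsto_wordSeminorm hY hgen)

theorem isTotallyReflexive_conormalSpace (hL : IsClosedSubmanifold n k L) :
    IsTotallyReflexive 𝕜 (ConormalSpace 𝕜 A k L s) := by
  obtain ⟨m, Y, hY, hgen⟩ := exists_generators hL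
  obtain ⟨p, hp, hmono, hpar⟩ := exists_monotone_isHilbertian
    (withSeminorms_wordSeminorm (𝕜 := 𝕜) (A := A) (s := s) hY hgen)
    fun q ↦ isHilbertian_opSeminorm _ _
  let _ : UniformSpace (ConormalSpace 𝕜 A k L s) := IsTopologicalAddGroup.rightUniformSpace _
  have : IsUniformAddGroup (ConormalSpace 𝕜 A k L s) := isUniformAddGroup_of_addCommGroup
  have : CompleteSpace (ConormalSpace 𝕜 A k L s) :=
    (isFrechetSpace_conormalSpace (𝕜 := 𝕜) hL).completeSpace
  exact isTotallyReflexive_of_isHilbertian hp hmono hpar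

end Conormal

end ConormalDistributions

theorem propositionp (𝕜 : Type*) [RCLike 𝕜] (n : ℕ) (M : Type*) [TopologicalSpace M]
    [ChartedSpace (EuclideanSpace ℝ (Fin n)) M] [IsManifold (𝓡 n) ∞ M] [T2Space M]
    [CompactSpace M] (A : ConormalDistributions.SobolevAtlas n M) (k : ℕ) (L : Set M)
    (hL : ConormalDistributions.IsClosedSubmanifold n k L) (s : ℝ) :
    ConormalDistributions.IsFrechetSpace 𝕜 (ConormalDistributions.ConormalSpace 𝕜 A k L s) ∧
      ConormalDistributions.IsTotallyReflexive 𝕜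
        (ConormalDistributions.ConormalSpace 𝕜 A k L s) :=
  ⟨ConormalDistributions.isFrechetSpace_conormalSpace hL,
    ConormalDistributions.isTotallyReflexive_conormalSpace hL⟩
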